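/- Let $n\geqslant1$ be an integer and $N\in\mathbb C$. Let $B(n,N)$ be the Brauer algebra: the complex associative algebra with a basis $b(\gamma)$, where $\gamma$ runs through the partitions of the set $\{1,\dots,n,\bar1,\dots,\bar n\}$ into pairs (edges), and with the product $b(\gamma)\,b(\gamma')=N^{q}\,b(\gamma\circ\gamma')$. Here one identifies the vertices $\bar1,\dots,\bar n$ of $\gamma$ with the vertices $1,\dots,n$ of $\gamma'$ respectively; $q$ is the number of loops (components without terminal vertices) of the resulting graph, and $\gamma\circ\gamma'$ is obtained by removing the loops and replacing every other connected component by a single edge between its two terminal vertices. For $1\leqslant k<n$ let $s_k=b(\gamma)$ where $\gamma$ has the edges $\{k,\overline{k+1}\}$, $\{k+1,\bar k\}$ and $\{l,\bar l\}$ for $l\neq k,k+1$, and let $\bar s_k=b(\gamma)$ where $\gamma$ has the edges $\{k,k+1\}$, $\{\bar k,\overline{k+1}\}$ and $\{l,\bar l\}$ for $l\neq k,k+1$. The affine Brauer algebra $A(n,N)$ is the complex associative unital algebra generated by the algebra $B(n,N)$ (with the same unit), pairwise commuting elements $y_1,\dots,y_n$ and central elements $w_1,w_2,\dots$, subject to the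 following relations, where $w_0=N$ and $1\leqslant k<n$: $$s_k\,y_l=y_l\,s_k,\qquad \bar s_k\,y_l=y_l\,\bar s_k\qquad(l\neq k,k+1);$$ $$s_k\,y_k-y_{k+1}\,s_k=\bar s_k-1,\qquad s_k\,y_{k+1}-y_k\,s_k=1-\bar s_k;$$ $$\bar s_k\,(y_k+y_{k+1})=0,\qquad (y_k+y_{k+1})\,\bar s_k=0;$$ $$\bar s_1\,y_1^{\,i}\,\bar s_1=w_i\,\bar s_1\qquad(i=1,2,\dots;\ n\geqslant2);$$ $$-2\,w_i=w_{i-1}+\sum_{j=1}^{i}(-1)^j\,w_{i-j}\,w_{j-1}\qquad(i=1,3,5,\dots).$$ Then the subalgebra of $A(n,N)$ generated by $y_1,\dots,y_n$ and $w_1,w_2,\dots$ is maximal commutative, that is, it is commutative and is not properly contained in any commutative subalgebra of $A(n,N)$. The centre of $A(n,N)$ is the subalgebra generated by the elements $y_1^i+\dots+y_n^i$ with $i=1,3,5,\dots$ together with the elements $w_i$ with $i=2,4,6,\dots$. -/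

import Mathlib

/-- A graph with the `2n` vertices `1, …, n, 1̄, …, n̄` and `n` edges in which every vertex is
incident with an edge, i.e. a partition of the vertices into pairs. The vertex `k` is `Sum.inl k`,
the vertex `k̄` is `Sum.inr k` (indices start at `0`); `mate v` is the other end of the edge at
`v`. -/
@[ext] structure BrauerDiagram (n : ℕ) where
  mate : Fin n ⊕ Fin n → Fin n ⊕ Fin n
  mate_mate : ∀ v, mate (mate v) = v
  mate_ne : ∀ v, mate v ≠ v

namespace BrauerDiagram

/-- The diagram of a permutation `s`, with edges `{s i, ī}`. -/
def ofPerm {n : ℕ} (s : Equiv.Perm (Fin n)) : BrauerDiagram n where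
  mate := Sum.elim (fun i => Sum.inr (s.symm i)) (fun i => Sum.inl (s i))
  mate_mate := by rintro (i | i) <;> simp
  mate_ne := by rintro (i | i) <;> simp

/-- The diagram whose only non-vertical edges are `{i, j}` and `{ī, j̄}`, for `i ≠ j`. -/
def bar {n : ℕ} (i j : Fin n) (h : i ≠ j) : BrauerDiagram n where
  mate := Sum.elim
    (fun m => if m = i then Sum.inl j else if m = j then Sum.inl i else Sum.inr m)
    (fun m => if m = i then Sum.inr j else if m = j then Sum.inr i else Sum.inl m)
  mate_mate := by
    rintro (m | m) <;> by_cases h1 : m = i <;> by_cases h2 : m = j <;> simp_all [Ne.symm h]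
  mate_ne := by
    rintro (m | m) <;> by_cases h1 : m = i <;> by_cases h2 : m = j <;> simp_all [Ne.symm h]

/-- The vertices of a diagram placed in rows `0` and `1` of three rows of `n` points. -/
def upper {n : ℕ} : Fin n ⊕ Fin n → Fin 3 × Fin n :=
  Sum.elim (fun k => (0, k)) (fun k => (1, k))

/-- The vertices of a diagram placed in rows `1` and `2` of three rows of `n` points. -/
def lower {n : ℕ} : Fin n ⊕ Fin n → Fin 3 × Fin n :=
  Sum.elim (fun k => (1, k)) (fun k => (2, k))

/-- The vertices of a diagram placed in rows `0` and `2` of three rows of `n` points: the terminal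
vertices of two diagrams glued along row `1`. -/
def outer {n : ℕ} : Fin n ⊕ Fin n → Fin 3 × Fin n :=
  Sum.elim (fun k => (0, k)) (fun k => (2, k))

/-- The graph obtained from `γ` and `γ'` by identifying the vertices `1̄, …, n̄` of `γ` with the
vertices `1, …, n` of `γ'` (they form row `1`). -/
def glue {n : ℕ} (γ γ' : BrauerDiagram n) : SimpleGraph (Fin 3 × Fin n) :=
  SimpleGraph.fromRel fun u v =>
    (∃ x, u = upper x ∧ v = upper (γ.mate x)) ∨ (∃ x, u = lower x ∧ v = lower (γ'.mate x))

/-- The number of loops in the glued graph: the connected components without a terminal vertex. -/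
noncomputable def loops {n : ℕ} (γ γ' : BrauerDiagram n) : ℕ :=
  Nat.card {c : (glue γ γ').ConnectedComponent //
    ∀ x, (glue γ γ').connectedComponentMk (outer x) ≠ c}

/-- In a component of a graph whose edges come from two involutions `a`, `b`, a fixed point of `b`
comes with exactly one further fixed point of `a` or `b`. -/
theorem exists_other_end {V : Type*} [Finite V] (a b : Equiv.Perm V) (ha : ∀ v, a (a v) = v)
    (hb : ∀ v, b (b v) = v) (hab : ∀ v, a v = v → b v ≠ v) (x : V) (hx : b x = x)
    (P : V → Prop) (hPx : P x) (hPa : ∀ v, P v → P (a v)) (hPb : ∀ v, P v → P (b v))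
    (hmin : ∀ Q : V → Prop, Q x → (∀ v, Q v → Q (a v)) → (∀ v, Q v → Q (b v)) → ∀ w, P w → Q w) :
    ∃! y, y ≠ x ∧ (a y = y ∨ b y = y) ∧ P y := by
  classical
  have haa : a * a = 1 := Equiv.ext ha
  have hbb : b * b = 1 := Equiv.ext hb
  have ha' : a⁻¹ = a := inv_eq_of_mul_eq_one_left haa
  have hb' : b⁻¹ = b := inv_eq_of_mul_eq_one_left hbb
  set c : Equiv.Perm V := b * a with hc
  have hcinv : c⁻¹ = a * b := by rw [hc, mul_inv_rev, ha', hb']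
  have hac : ∀ k : ℤ, a * c ^ k = c ^ (-k) * a := fun k => by
    have h : a * c * a⁻¹ = c⁻¹ := by rw [hcinv, hc, ha']; simp [mul_assoc, haa]
    have h2 := conj_zpow (i := k) (a := a) (b := c)
    rw [h] at h2
    rw [zpow_neg, ← inv_zpow, h2]; simp
  have hbc : ∀ k : ℤ, b * c ^ k = c ^ (-k) * b := fun k => by
    have h : b * c * b⁻¹ = c⁻¹ := by rw [hcinv, hc, hb', ← mul_assoc, hbb, one_mul]
    have h2 := conj_zpow (i := k) (a := b) (b := c)
    rw [h] at h2
    rw [zpow_neg, ← inv_zpow, h2]; simp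
  have hax : a x = (c ^ (-1 : ℤ)) x := by
    rw [zpow_neg_one, hcinv, Equiv.Perm.mul_apply, hx]
  have hak : ∀ k : ℤ, a ((c ^ k) x) = (c ^ (-k - 1)) x := fun k => by
    rw [← Equiv.Perm.mul_apply, hac, Equiv.Perm.mul_apply, hax, ← Equiv.Perm.mul_apply,
      ← zpow_add]; rfl
  have hbk : ∀ k : ℤ, b ((c ^ k) x) = (c ^ (-k)) x := fun k => by
    rw [← Equiv.Perm.mul_apply, hbc, Equiv.Perm.mul_apply, hx]
  set m := Function.minimalPeriod (c • ·) x with hm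
  have hdvd : ∀ i j : ℤ, (c ^ i) x = (c ^ j) x ↔ (m : ℤ) ∣ i - j := fun i j => by
    rw [← MulAction.zpow_smul_eq_iff_minimalPeriod_dvd, zpow_sub, ← zpow_neg, (Commute.zpow_zpow
      (Commute.refl c) i (-j)).eq, zpow_neg, mul_smul, inv_smul_eq_iff]; rfl
  have hm0 : 0 < m := Function.minimalPeriod_pos_of_mem_periodicPts
    (Function.Injective.mem_periodicPts (MulAction.injective c) x)
  have hPc : ∀ k : ℕ, P ((c ^ k) x) := fun k => by
    induction k with
    | zero => exact hPx
    | succ k ih => rw [pow_succ']; exact hPb _ (hPa _ ih)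
  have hm1 : m ≠ 1 := fun h => by
    refine hab x ?_ hx
    have := (hdvd (-1) 0).2 (by simp [h])
    rw [hax, this]; rfl
  have hx0 : x = (c ^ (0 : ℤ)) x := rfl
  have hfa : ∀ k : ℤ, a ((c ^ k) x) = (c ^ k) x ↔ (m : ℤ) ∣ 2 * k + 1 := fun k => by
    rw [hak, hdvd, ← dvd_neg]; ring_nf
  have hfb : ∀ k : ℤ, b ((c ^ k) x) = (c ^ k) x ↔ (m : ℤ) ∣ 2 * k := fun k => by
    rw [hbk, hdvd, ← dvd_neg]; ring_nf
  have hne : ∀ k : ℤ, (c ^ k) x ≠ x ↔ ¬ (m : ℤ) ∣ k := fun k => by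
    conv_lhs => rw [Ne, hx0, ← Equiv.Perm.mul_apply, ← zpow_add, hdvd]
    simp
  refine ⟨(c ^ ((m / 2 : ℕ) : ℤ)) x, ⟨?_, ?_, ?_⟩, ?_⟩
  · rw [hne, Int.natCast_dvd_natCast]
    exact fun h => by have := Nat.le_of_dvd (by omega) h; omega
  · rw [hfa, hfb]
    rcases Nat.even_or_odd' m with ⟨t, ht | ht⟩
    · exact Or.inr ⟨1, by push_cast [ht]; omega⟩
    · exact Or.inl ⟨1, by push_cast [ht]; omega⟩
  · rw [zpow_natCast]; exact hPc _
  · rintro z ⟨hzx, hz, hPz⟩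
    obtain ⟨k, rfl⟩ : ∃ k : ℤ, z = (c ^ k) x := by
      refine hmin (fun z => ∃ k : ℤ, z = (c ^ k) x) ⟨0, rfl⟩ ?_ ?_ z hPz
      · rintro _ ⟨k, rfl⟩; exact ⟨_, hak k⟩
      · rintro _ ⟨k, rfl⟩; exact ⟨_, hbk k⟩
    rw [hne] at hzx
    rw [hfa, hfb] at hz
    rw [hdvd]
    rcases hz with ⟨t, ht⟩ | ⟨t, ht⟩
    · rcases Nat.even_or_odd' m with ⟨q, hq | hq⟩
      · rw [hq] at ht; push_cast at ht
        have : (2 : ℤ) * (q * t) = 2 * k + 1 := by rw [ht]; ring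
        omega
      · rcases Int.even_or_odd' t with ⟨s, rfl | rfl⟩
        · have : 2 * ((m : ℤ) * s) = 2 * k + 1 := by rw [ht]; ring
          omega
        · refine ⟨s, ?_⟩
          have h1 : ((m / 2 : ℕ) : ℤ) = q := by omega
          rw [h1]; rw [hq] at ht ⊢; push_cast at ht ⊢; linarith
    · rcases Int.even_or_odd' t with ⟨s, rfl | rfl⟩
      · exact absurd ⟨s, by linarith⟩ hzx
      · rcases Nat.even_or_odd' m with ⟨q, hq | hq⟩
        · refine ⟨s, ?_⟩
          have h1 : ((m / 2 : ℕ) : ℤ) = q := by omega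
          rw [h1]; rw [hq] at ht ⊢; push_cast at ht ⊢; linarith
        · have : 2 * ((m : ℤ) * s) + m = 2 * k := by rw [ht]; ring
          omega

/-- The edges of `γ` as an involution of the three rows, fixing row `2`. -/
def upperFun {n : ℕ} (γ : BrauerDiagram n) (v : Fin 3 × Fin n) : Fin 3 × Fin n :=
  if v.1 = 0 then upper (γ.mate (Sum.inl v.2))
  else if v.1 = 1 then upper (γ.mate (Sum.inr v.2)) else v

/-- The edges of `γ'` as an involution of the three rows, fixing row `0`. -/
def lowerFun {n : ℕ} (γ' : BrauerDiagram n) (v : Fin 3 × Fin n) : Fin 3 × Fin n :=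
  if v.1 = 1 then lower (γ'.mate (Sum.inl v.2))
  else if v.1 = 2 then lower (γ'.mate (Sum.inr v.2)) else v

theorem upperFun_upper {n : ℕ} (γ : BrauerDiagram n) (x : Fin n ⊕ Fin n) :
    upperFun γ (upper x) = upper (γ.mate x) := by
  rcases x with k | k <;> simp [upperFun, upper]

theorem lowerFun_lower {n : ℕ} (γ : BrauerDiagram n) (x : Fin n ⊕ Fin n) :
    lowerFun γ (lower x) = lower (γ.mate x) := by
  rcases x with k | k <;> simp [lowerFun, lower]

theorem upper_or {n : ℕ} (v : Fin 3 × Fin n) : (∃ x, v = upper x) ∨ v.1 = 2 := by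
  obtain ⟨r, k⟩ := v
  fin_cases r
  · exact Or.inl ⟨Sum.inl k, rfl⟩
  · exact Or.inl ⟨Sum.inr k, rfl⟩
  · exact Or.inr rfl

theorem lower_or {n : ℕ} (v : Fin 3 × Fin n) : (∃ x, v = lower x) ∨ v.1 = 0 := by
  obtain ⟨r, k⟩ := v
  fin_cases r
  · exact Or.inr rfl
  · exact Or.inl ⟨Sum.inl k, rfl⟩
  · exact Or.inl ⟨Sum.inr k, rfl⟩

theorem upper_injective {n : ℕ} : Function.Injective (upper (n := n)) := by
  rintro (i | i) (j | j) h <;> simp_all [upper]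

theorem lower_injective {n : ℕ} : Function.Injective (lower (n := n)) := by
  rintro (i | i) (j | j) h <;> simp_all [lower]

theorem outer_injective {n : ℕ} : Function.Injective (outer (n := n)) := by
  rintro (i | i) (j | j) h <;> simp_all [outer]

theorem upper_ne_two {n : ℕ} (x : Fin n ⊕ Fin n) : (upper x).1 ≠ 2 := by
  rcases x with k | k <;> simp [upper]

theorem lower_ne_zero {n : ℕ} (x : Fin n ⊕ Fin n) : (lower x).1 ≠ 0 := by
  rcases x with k | k <;> simp [lower]

theorem upperFun_two {n : ℕ} (γ : BrauerDiagram n) (v : Fin 3 × Fin n) (h : v.1 = 2) :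
    upperFun γ v = v := by simp [upperFun, h]

theorem lowerFun_zero {n : ℕ} (γ : BrauerDiagram n) (v : Fin 3 × Fin n) (h : v.1 = 0) :
    lowerFun γ v = v := by simp [lowerFun, h]

theorem upperFun_invol {n : ℕ} (γ : BrauerDiagram n) (v : Fin 3 × Fin n) :
    upperFun γ (upperFun γ v) = v := by
  rcases upper_or v with ⟨x, rfl⟩ | h
  · rw [upperFun_upper, upperFun_upper, γ.mate_mate]
  · rw [upperFun_two γ v h, upperFun_two γ v h]

theorem lowerFun_invol {n : ℕ} (γ : BrauerDiagram n) (v : Fin 3 × Fin n) :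
    lowerFun γ (lowerFun γ v) = v := by
  rcases lower_or v with ⟨x, rfl⟩ | h
  · rw [lowerFun_lower, lowerFun_lower, γ.mate_mate]
  · rw [lowerFun_zero γ v h, lowerFun_zero γ v h]

theorem upperFun_fixed {n : ℕ} (γ : BrauerDiagram n) (v : Fin 3 × Fin n) :
    upperFun γ v = v ↔ v.1 = 2 := by
  refine ⟨fun h => (upper_or v).resolve_left ?_, upperFun_two γ v⟩
  rintro ⟨x, rfl⟩
  exact γ.mate_ne x (upper_injective (by rwa [upperFun_upper] at h))

theorem lowerFun_fixed {n : ℕ} (γ : BrauerDiagram n) (v : Fin 3 × Fin n) :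
    lowerFun γ v = v ↔ v.1 = 0 := by
  refine ⟨fun h => (lower_or v).resolve_left ?_, lowerFun_zero γ v⟩
  rintro ⟨x, rfl⟩
  exact γ.mate_ne x (lower_injective (by rwa [lowerFun_lower] at h))

theorem fixed_iff_outer {n : ℕ} (γ γ' : BrauerDiagram n) (v : Fin 3 × Fin n) :
    (upperFun γ v = v ∨ lowerFun γ' v = v) ↔ ∃ x, v = outer x := by
  rw [upperFun_fixed, lowerFun_fixed]
  constructor
  · obtain ⟨r, k⟩ := v
    rintro (rfl | rfl)
    · exact ⟨Sum.inr k, rfl⟩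
    · exact ⟨Sum.inl k, rfl⟩
  · rintro ⟨k | k, rfl⟩ <;> simp [outer]

theorem glue_adj {n : ℕ} (γ γ' : BrauerDiagram n) (u v : Fin 3 × Fin n) :
    (glue γ γ').Adj u v ↔ u ≠ v ∧ (v = upperFun γ u ∨ v = lowerFun γ' u) := by
  have key : ∀ u v : Fin 3 × Fin n, ((∃ x, u = upper x ∧ v = upper (γ.mate x)) ∨
      (∃ x, u = lower x ∧ v = lower (γ'.mate x))) → (v = upperFun γ u ∨ v = lowerFun γ' u) := by
    rintro u v (⟨x, rfl, rfl⟩ | ⟨x, rfl, rfl⟩)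
    · exact Or.inl (upperFun_upper γ x).symm
    · exact Or.inr (lowerFun_lower γ' x).symm
  rw [glue, SimpleGraph.fromRel_adj]
  refine and_congr_right fun hne => ⟨?_, ?_⟩
  · rintro (h | h)
    · exact key _ _ h
    · rcases key _ _ h with h | h
      · exact Or.inl (by rw [h, upperFun_invol])
      · exact Or.inr (by rw [h, lowerFun_invol])
  · rintro (rfl | rfl)
    · rcases upper_or u with ⟨x, rfl⟩ | h
      · exact Or.inl (Or.inl ⟨x, rfl, upperFun_upper γ x⟩)
      · exact absurd (upperFun_two γ u h).symm hne
    · rcases lower_or u with ⟨x, rfl⟩ | h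
      · exact Or.inl (Or.inr ⟨x, rfl, lowerFun_lower γ' x⟩)
      · exact absurd (lowerFun_zero γ' u h).symm hne

/-- Every terminal vertex of the glued graph is connected to exactly one other terminal vertex. -/
theorem existsUnique_end {n : ℕ} (γ γ' : BrauerDiagram n) (x : Fin n ⊕ Fin n) :
    ∃! y, y ≠ x ∧ (glue γ γ').Reachable (outer x) (outer y) := by
  have hstepA : ∀ v, (glue γ γ').Reachable v (upperFun γ v) := fun v => by
    by_cases h : v = upperFun γ v
    · rw [← h]
    · exact ((glue_adj γ γ' _ _).2 ⟨h, Or.inl rfl⟩).reachable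
  have hstepB : ∀ v, (glue γ γ').Reachable v (lowerFun γ' v) := fun v => by
    by_cases h : v = lowerFun γ' v
    · rw [← h]
    · exact ((glue_adj γ γ' _ _).2 ⟨h, Or.inr rfl⟩).reachable
  have hmin : ∀ Q : Fin 3 × Fin n → Prop, Q (outer x) → (∀ v, Q v → Q (upperFun γ v)) →
      (∀ v, Q v → Q (lowerFun γ' v)) → ∀ w, (glue γ γ').Reachable (outer x) w → Q w := by
    rintro Q hQ hA hB w ⟨p⟩
    generalize outer x = u at p hQ
    induction p with
    | nil => exact hQ
    | cons h p ih =>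
      apply ih
      rcases ((glue_adj γ γ' _ _).1 h).2 with rfl | rfl
      · exact hA _ hQ
      · exact hB _ hQ
  let a : Equiv.Perm (Fin 3 × Fin n) := ⟨upperFun γ, upperFun γ, upperFun_invol γ, upperFun_invol γ⟩
  let b : Equiv.Perm (Fin 3 × Fin n) :=
    ⟨lowerFun γ', lowerFun γ', lowerFun_invol γ', lowerFun_invol γ'⟩
  have hab : ∀ v, upperFun γ v = v → lowerFun γ' v ≠ v := fun v h1 h2 => by
    rw [upperFun_fixed] at h1; rw [lowerFun_fixed, h1] at h2; simp at h2
  have hV : ∃! y, y ≠ outer x ∧ (upperFun γ y = y ∨ lowerFun γ' y = y) ∧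
      (glue γ γ').Reachable (outer x) y := by
    rcases (fixed_iff_outer γ γ' (outer x)).2 ⟨x, rfl⟩ with hx | hx
    · have := exists_other_end b a (lowerFun_invol γ') (upperFun_invol γ)
        (fun v h1 h2 => hab v h2 h1) (outer x) hx (fun v => (glue γ γ').Reachable (outer x) v)
        (SimpleGraph.Reachable.refl _) (fun v h => h.trans (hstepB v))
        (fun v h => h.trans (hstepA v)) (fun Q h hB hA => hmin Q h hA hB)
      obtain ⟨y, hy, huniq⟩ := this
      exact ⟨y, ⟨hy.1, hy.2.1.symm, hy.2.2⟩, fun z hz => huniq z ⟨hz.1, hz.2.1.symm, hz.2.2⟩⟩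
    · exact exists_other_end a b (upperFun_invol γ) (lowerFun_invol γ')
        hab (outer x) hx (fun v => (glue γ γ').Reachable (outer x) v)
        (SimpleGraph.Reachable.refl _) (fun v h => h.trans (hstepA v))
        (fun v h => h.trans (hstepB v)) hmin
  obtain ⟨w, ⟨hwx, hw, hxw⟩, huniq⟩ := hV
  obtain ⟨y, rfl⟩ := (fixed_iff_outer γ γ' w).1 hw
  refine ⟨y, ⟨fun h => hwx (by rw [h]), hxw⟩, fun z hz => outer_injective (huniq _
    ⟨fun h => hz.1 (outer_injective h), (fixed_iff_outer γ γ' _).2 ⟨z, rfl⟩, hz.2⟩)⟩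

/-- The diagram `γ ∘ γ'`: remove the loops of the glued graph and replace each other connected
component by a single edge between its two terminal vertices. -/
noncomputable def comp {n : ℕ} (γ γ' : BrauerDiagram n) : BrauerDiagram n where
  mate x := (existsUnique_end γ γ' x).choose
  mate_mate x := by
    have h1 := (existsUnique_end γ γ' x).choose_spec.1
    exact ((existsUnique_end γ γ' _).choose_spec.2 x ⟨h1.1.symm, h1.2.symm⟩).symm
  mate_ne x := (existsUnique_end γ γ' x).choose_spec.1.1

theorem comp_mate_eq_iff {n : ℕ} (γ γ' : BrauerDiagram n) (x y : Fin n ⊕ Fin n) :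
    (comp γ γ').mate x = y ↔ y ≠ x ∧ (glue γ γ').Reachable (outer x) (outer y) := by
  refine ⟨?_, fun h => ((existsUnique_end γ γ' x).choose_spec.2 y h).symm⟩
  rintro rfl
  exact (existsUnique_end γ γ' x).choose_spec.1

end BrauerDiagram

/-- Generators of the affine Brauer algebra: the basis elements `b γ` of the Brauer algebra
`B(n, N)`, the elements `y_1, …, y_n` (indexed from `0`), and `w_0, w_1, w_2, …`, where `w_0` is
only a name for the scalar `N`. -/
inductive AffineBrauerGen (n : ℕ) : Type
  | b (γ : BrauerDiagram n)
  | y (k : Fin n)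
  | w (i : ℕ)

namespace AffineBrauerGen

/-- The generators as elements of the free associative algebra. -/
noncomputable def of {n : ℕ} (g : AffineBrauerGen n) : FreeAlgebra ℂ (AffineBrauerGen n) :=
  FreeAlgebra.ι ℂ g

/-- The transposition `s_k = (k, k+1)` in the Brauer algebra. -/
noncomputable def s {n : ℕ} (k : ℕ) (hk : k + 1 < n) : FreeAlgebra ℂ (AffineBrauerGen n) :=
  of (b (BrauerDiagram.ofPerm (Equiv.swap ⟨k, by omega⟩ ⟨k + 1, hk⟩)))

/-- The element `s̄_k` of the Brauer algebra. -/
noncomputable def sbar {n : ℕ} (k : ℕ) (hk : k + 1 < n) : FreeAlgebra ℂ (AffineBrauerGen n) :=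
  of (b (BrauerDiagram.bar ⟨k, by omega⟩ ⟨k + 1, hk⟩ (by simp)))

end AffineBrauerGen

open AffineBrauerGen in
/-- The defining relations of the affine Brauer algebra. -/
inductive AffineBrauerRel (n : ℕ) (N : ℂ) :
    FreeAlgebra ℂ (AffineBrauerGen n) → FreeAlgebra ℂ (AffineBrauerGen n) → Prop
  /- The `b γ` multiply as in the Brauer algebra `B(n, N)`, with the same unit. -/
  | b_one : AffineBrauerRel n N (of (b (BrauerDiagram.ofPerm 1))) 1
  | b_mul (γ γ' : BrauerDiagram n) : AffineBrauerRel n N (of (b γ) * of (b γ'))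
      (N ^ BrauerDiagram.loops γ γ' • of (b (BrauerDiagram.comp γ γ')))
  | w_zero : AffineBrauerRel n N (of (w 0)) (algebraMap ℂ _ N)
  /- The `y_k` commute pairwise, the `w_i` are central. -/
  | y_comm (k l : Fin n) : AffineBrauerRel n N (of (y k) * of (y l)) (of (y l) * of (y k))
  | w_central (i : ℕ) (g : AffineBrauerGen n) :
      AffineBrauerRel n N (of (w i) * of g) (of g * of (w i))
  | s_y (k : ℕ) (hk : k + 1 < n) (l : Fin n) (h : (l : ℕ) ≠ k) (h' : (l : ℕ) ≠ k + 1) :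
      AffineBrauerRel n N (s k hk * of (y l)) (of (y l) * s k hk)
  | sbar_y (k : ℕ) (hk : k + 1 < n) (l : Fin n) (h : (l : ℕ) ≠ k) (h' : (l : ℕ) ≠ k + 1) :
      AffineBrauerRel n N (sbar k hk * of (y l)) (of (y l) * sbar k hk)
  | s_y_self (k : ℕ) (hk : k + 1 < n) : AffineBrauerRel n N
      (s k hk * of (y ⟨k, by omega⟩) - of (y ⟨k + 1, hk⟩) * s k hk) (sbar k hk - 1)
  | s_y_succ (k : ℕ) (hk : k + 1 < n) : AffineBrauerRel n N
      (s k hk * of (y ⟨k + 1, hk⟩) - of (y ⟨k, by omega⟩) * s k hk) (1 - sbar k hk)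
  | sbar_mul_y_add (k : ℕ) (hk : k + 1 < n) : AffineBrauerRel n N
      (sbar k hk * (of (y ⟨k, by omega⟩) + of (y ⟨k + 1, hk⟩))) 0
  | y_add_mul_sbar (k : ℕ) (hk : k + 1 < n) : AffineBrauerRel n N
      ((of (y ⟨k, by omega⟩) + of (y ⟨k + 1, hk⟩)) * sbar k hk) 0
  | sbar_y_pow_sbar (h : 0 + 1 < n) (i : ℕ) (hi : 1 ≤ i) : AffineBrauerRel n N
      (sbar 0 h * of (y ⟨0, by omega⟩) ^ i * sbar 0 h) (of (w i) * sbar 0 h)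
  /- The recursion that expresses the `w_i` with `i` odd through the earlier ones. The relations
  above only imply its product with `s̄_1`; in the quotient by all the `s̄_k` they say nothing
  about the `w_i`. -/
  | w_odd (i : ℕ) (hi : Odd i) : AffineBrauerRel n N ((-2 : ℂ) • of (w i))
      (of (w (i - 1)) + ∑ j ∈ Finset.Icc 1 i, (-1) ^ j * (of (w (i - j)) * of (w (j - 1))))

/-- The affine Brauer algebra `A(n, N)`. -/
abbrev AffineBrauer (n : ℕ) (N : ℂ) : Type := RingQuot (AffineBrauerRel n N)

namespace AffineBrauer

/-- The element `y_{k+1}` of the affine Brauer algebra. -/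
noncomputable def y {n : ℕ} (N : ℂ) (k : Fin n) : AffineBrauer n N :=
  RingQuot.mkAlgHom ℂ (AffineBrauerRel n N) (AffineBrauerGen.of (AffineBrauerGen.y k))

/-- The element `w_i` of the affine Brauer algebra. -/
noncomputable def w (n : ℕ) (N : ℂ) (i : ℕ) : AffineBrauer n N :=
  RingQuot.mkAlgHom ℂ (AffineBrauerRel n N) (AffineBrauerGen.of (AffineBrauerGen.w i))

end AffineBrauer

/-! Give each `y k` degree 1, each `w i` degree `i`, and the diagrams degree 0. Modulo terms of
lower degree the `y k` are permuted by permutations and slide along the edges of a diagram `γ`: the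
elements at the two ends of an edge agree up to a sign, which is `-1` when the edge stays in one
row. So the leading part of any element is a combination of the `b γ` whose coefficients are
polynomials in one variable for each edge of `γ` and in the `w i` with `i` even. The odd `w i` do
not occur, because their recursion places them in lower degree. That such combinations suffice is a
computation (`act_sub_reduce`, `filt_succ_le_regular`). The heart of the proof is the converse, a
basis theorem for the associated graded algebra: the coefficients, read in edge variables, are
unique (`AffineBrauer.specialize_reduce`).

Uniqueness is tested in representations. On tensors with entries in a module over an orthogonal Lie
algebra, `y k` acts by the matrix of generators in slot `k`, plus the Casimir operators with the
earlier slots, plus a scalar, and `w i` acts by the trace of the `i`-th power of the shifted matrix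
(`TensorModel.isAffineBrauerModel`). The module is a polynomial ring on which a Lie algebra element
acts by a vector field plus multiplication by a linear form. Only the multiplication raises the
degree, so in top degree `y k` becomes a scalar antisymmetric matrix in slot `k`, and this matrix
can be prescribed. Matrix coefficients between products of its eigenvectors, chosen to pair
nontrivially only along the edges of `γ`, single out the coefficient of `γ` and evaluate it at
arbitrary values of the edge variables. Further eigenvalues prescribe `w 2, w 4, …`, and zero
eigenvalues make `w 0`, the size of the index set, run through infinitely many integers
(`TensorModel.reduce_eq_zero`). In the product of all these models `w 0` therefore behaves as a free
variable, `w 0 - N` is not a zero divisor on leading parts, and uniqueness survives in the quotient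
by `w 0 = N` for every complex `N`.

Now let an element commute with all `y k`. Its commutator with `y k` multiplies the coefficient of
`γ` by the difference of the variables at `k` and `k̄`, which is nonzero unless `{k, k̄}` is an
edge. Hence only the identity diagram occurs in the leading part, which is thus the leading part of
a polynomial in the `y k` and `w i`. Subtracting it and inducting on the degree shows that this
commutative subalgebra is its own centralizer (`AffineBrauer.mem_range_polyHom`), so it is maximal.

If the element is central, its leading polynomial may in addition be moved across every diagram.
Permutations make it symmetric in the `y k`, and the diagrams `bar k l` show that it is unchanged
when two opposite arguments are replaced by zero. Such polynomials are polynomials in the odd power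
sums (`MvPolynomial.mem_oddPowerSums`). The odd power sums are central by a direct computation, so
the same induction gives the centre. -/

set_option linter.unusedSectionVars false

/-! ### Brauer diagrams through colourings of their vertices -/

namespace BrauerDiagram

variable {n : ℕ} {I : Type*}

/-- A colouring of the vertices of a diagram that is constant on the edges. -/
def Compat (γ : BrauerDiagram n) (c : Fin n ⊕ Fin n → I) : Prop := ∀ v, c (γ.mate v) = c v

/-- The colouring of three rows of points with prescribed rows. -/
def rows (f g h : Fin n → I) (v : Fin 3 × Fin n) : I := ![f, g, h] v.1 v.2

theorem rows_upper (f g h : Fin n → I) (v) : rows f g h (upper v) = Sum.elim f g v := by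
  rcases v with k | k <;> simp [rows, upper]

theorem rows_lower (f g h : Fin n → I) (v) : rows f g h (lower v) = Sum.elim g h v := by
  rcases v with k | k <;> simp [rows, lower]

theorem rows_outer (f g h : Fin n → I) (v) : rows f g h (outer v) = Sum.elim f h v := by
  rcases v with k | k <;> simp [rows, outer]

/-- Both sides say that the colouring of the three rows is constant on the edges, and hence on the
components, of the glued graph. Products of diagrams thereby become a matter of counting colourings.
-/
theorem compat_and_compat_iff (γ γ' : BrauerDiagram n) (f g h : Fin n → I) :
    (γ.Compat (Sum.elim f g) ∧ γ'.Compat (Sum.elim g h)) ↔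
      ∀ u v, (glue γ γ').Reachable u v → rows f g h u = rows f g h v := by
  constructor
  · rintro ⟨h1, h2⟩ u v ⟨p⟩
    induction p with
    | nil => rfl
    | cons hadj _ ih =>
      rw [← ih]
      rcases ((glue_adj _ _ _ _).1 hadj).2 with rfl | rfl
      · rename_i u _ _
        rcases upper_or u with ⟨x, rfl⟩ | hu
        · rw [upperFun_upper, rows_upper, rows_upper, h1]
        · rw [upperFun_two _ _ hu]
      · rename_i u _ _
        rcases lower_or u with ⟨x, rfl⟩ | hu
        · rw [lowerFun_lower, rows_lower, rows_lower, h2]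
        · rw [lowerFun_zero _ _ hu]
  · intro H
    constructor
    · intro v
      rw [← rows_upper f g h, ← rows_upper f g h]
      refine H _ _ (SimpleGraph.Adj.reachable ((glue_adj _ _ _ _).2
        ⟨fun he => γ.mate_ne v (upper_injective he), Or.inl ?_⟩))
      rw [upperFun_upper, mate_mate]
    · intro v
      rw [← rows_lower f g h, ← rows_lower f g h]
      refine H _ _ (SimpleGraph.Adj.reachable ((glue_adj _ _ _ _).2
        ⟨fun he => γ'.mate_ne v (lower_injective he), Or.inr ?_⟩))
      rw [lowerFun_lower, mate_mate]

theorem compat_comp_of_compat {γ γ' : BrauerDiagram n} {f g h : Fin n → I}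
    (h1 : γ.Compat (Sum.elim f g)) (h2 : γ'.Compat (Sum.elim g h)) :
    (comp γ γ').Compat (Sum.elim f h) := by
  intro v
  rw [← rows_outer f g h, ← rows_outer f g h]
  exact ((compat_and_compat_iff γ γ' f g h).1 ⟨h1, h2⟩ _ _
    ((comp_mate_eq_iff γ γ' v _).1 rfl).2).symm

open Classical in
/-- The colourings of the middle row of two glued diagrams that extend a colouring of the outer
rows: a compatible outer colouring leaves one free colour for each loop. -/
theorem card_compat [Fintype I] (γ γ' : BrauerDiagram n) (f h : Fin n → I) :
    Fintype.card {g : Fin n → I // γ.Compat (Sum.elim f g) ∧ γ'.Compat (Sum.elim g h)} =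
      if (comp γ γ').Compat (Sum.elim f h) then Fintype.card I ^ loops γ γ' else 0 := by
  split_ifs with hc
  · set G := glue γ γ' with hG
    let Loop := {c : G.ConnectedComponent // ∀ x, G.connectedComponentMk (outer x) ≠ c}
    have hwd : ∀ x y, G.Reachable (outer x) (outer y) → Sum.elim f h x = Sum.elim f h y := by
      intro x y hxy
      by_cases hxy' : y = x
      · rw [hxy']
      · rw [← (comp_mate_eq_iff γ γ' x y).2 ⟨hxy', hxy⟩, hc]
    -- A loop carries a free colour. Any other component takes the colour of a terminal vertex in
    -- it, independent of the choice by `hwd`.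
    let ext : (Loop → I) → G.ConnectedComponent → I := fun r c =>
      if hl : ∀ x, G.connectedComponentMk (outer x) ≠ c then r ⟨c, hl⟩
      else Sum.elim f h (not_forall.1 hl).choose
    have hext : ∀ r x, ext r (G.connectedComponentMk (outer x)) = Sum.elim f h x := by
      intro r x
      have hl : ¬ ∀ y, G.connectedComponentMk (outer y) ≠ G.connectedComponentMk (outer x) :=
        fun H => H x rfl
      simp only [ext, dif_neg hl]
      exact hwd _ _ (SimpleGraph.ConnectedComponent.eq.1
        (not_not.1 (not_forall.1 hl).choose_spec))
    have hrows : ∀ r v, rows f (fun k => ext r (G.connectedComponentMk (1, k))) h v =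
        ext r (G.connectedComponentMk v) := by
      rintro r ⟨i, k⟩
      fin_cases i
      · exact (hext r (Sum.inl k)).symm
      · rfl
      · exact (hext r (Sum.inr k)).symm
    -- Rows 0 and 2 consist of terminal vertices, so a loop lies in the middle row and is seen by
    -- the colouring `g`.
    have hrep : ∀ c : Loop, ∃ k, G.connectedComponentMk (1, k) = c.1 := by
      rintro ⟨c, hl⟩
      induction c using SimpleGraph.ConnectedComponent.ind with | _ v =>
      obtain ⟨i, k⟩ := v
      fin_cases i
      · exact absurd rfl (hl (Sum.inl k))
      · exact ⟨k, rfl⟩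
      · exact absurd rfl (hl (Sum.inr k))
    choose rep hrep using hrep
    let e : {g : Fin n → I // γ.Compat (Sum.elim f g) ∧ γ'.Compat (Sum.elim g h)} ≃
        (Loop → I) :=
      { toFun := fun g c => g.1 (rep c)
        invFun := fun r => ⟨fun k => ext r (G.connectedComponentMk (1, k)),
          (compat_and_compat_iff γ γ' _ _ _).2 fun u v huv => by
            rw [hrows, hrows, SimpleGraph.ConnectedComponent.eq.2 huv]⟩
        left_inv := by
          rintro ⟨g, hg⟩
          have hg' := (compat_and_compat_iff γ γ' f g h).1 hg
          apply Subtype.ext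
          funext k
          change ext (fun c => g (rep c)) (G.connectedComponentMk (1, k)) = g k
          by_cases hl : ∀ x, G.connectedComponentMk (outer x) ≠ G.connectedComponentMk (1, k)
          · simp only [ext, dif_pos hl]
            exact hg' (1, _) (1, k) (SimpleGraph.ConnectedComponent.eq.1 (hrep ⟨_, hl⟩))
          · obtain ⟨x, hx⟩ := not_forall.1 hl
            rw [not_not] at hx
            have h3 := hext (fun c => g (rep c)) x
            rw [hx] at h3
            refine h3.trans ?_
            rw [← rows_outer f g h]
            exact hg' _ (1, k) (SimpleGraph.ConnectedComponent.eq.1 hx)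
        right_inv := by
          intro r
          funext c
          change ext r (G.connectedComponentMk (1, rep c)) = r c
          rw [hrep]
          exact dif_pos c.2 }
    rw [Fintype.card_congr e, Fintype.card_fun, loops, Nat.card_eq_fintype_card]
  · rw [Fintype.card_eq_zero_iff]
    exact ⟨fun g => hc (compat_comp_of_compat g.2.1 g.2.2)⟩

/-- Colour one edge of `γ` true and everything else false. Any diagram compatible with this
colouring joins the same two vertices. -/
theorem eq_of_compat_iff {γ γ' : BrauerDiagram n}
    (h : ∀ f g : Fin n → Bool, γ.Compat (Sum.elim f g) ↔ γ'.Compat (Sum.elim f g)) : γ = γ' := by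
  ext1
  funext v
  let c : Fin n ⊕ Fin n → Bool := fun u => decide (u = v ∨ u = γ.mate v)
  have hc : c = Sum.elim (fun k => c (Sum.inl k)) (fun k => c (Sum.inr k)) := by
    funext u; rcases u with k | k <;> rfl
  have h1 : γ.Compat c := by
    intro u
    simp only [c, decide_eq_decide]
    constructor
    · rintro (h | h)
      · right; rw [← h, mate_mate]
      · left; simpa [mate_mate] using congrArg γ.mate h
    · rintro (rfl | rfl)
      · exact Or.inr rfl
      · exact Or.inl (mate_mate _ _)
  rw [hc, h, ← hc] at h1
  have h2 := h1 v
  simp only [c, true_or, decide_true, decide_eq_true_eq] at h2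
  exact (h2.resolve_left (γ'.mate_ne v)).symm

/-- With two colours the number of middle rows is `2 ^ loops` or zero. A middle row that is forced
by the outer rows thus excludes loops and identifies the composite, without any look at paths in the
glued graph. -/
theorem comp_eq_of_unique {γ γ' δ : BrauerDiagram n}
    (G : (Fin n → Bool) → (Fin n → Bool) → Fin n → Bool)
    (h1 : ∀ f g h, γ.Compat (Sum.elim f g) → γ'.Compat (Sum.elim g h) → g = G f h)
    (h2 : ∀ f h, δ.Compat (Sum.elim f h) ↔
      γ.Compat (Sum.elim f (G f h)) ∧ γ'.Compat (Sum.elim (G f h) h)) :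
    loops γ γ' = 0 ∧ comp γ γ' = δ := by
  classical
  have key : ∀ f h, Fintype.card {g : Fin n → Bool // γ.Compat (Sum.elim f g) ∧
      γ'.Compat (Sum.elim g h)} = if δ.Compat (Sum.elim f h) then 1 else 0 := by
    intro f h
    split_ifs with hd
    · rw [Fintype.card_eq_one_iff]
      exact ⟨⟨G f h, (h2 f h).1 hd⟩, fun g => Subtype.ext (h1 f g.1 h g.2.1 g.2.2)⟩
    · rw [Fintype.card_eq_zero_iff]
      refine ⟨fun g => hd ((h2 f h).2 ?_)⟩
      rw [← h1 f g.1 h g.2.1 g.2.2]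
      exact g.2
  simp only [card_compat, Fintype.card_bool] at key
  -- A constant colouring is compatible with every diagram, so its count is exactly `2 ^ loops`.
  have h0 : loops γ γ' = 0 := by
    have := key (fun _ => true) (fun _ => true)
    have hc : ∀ ε : BrauerDiagram n, ε.Compat (Sum.elim (fun _ => true) (fun _ => true)) := by
      intro ε v
      rcases v with k | k <;> rcases ε.mate _ with l | l <;> rfl
    rw [if_pos (hc _), if_pos (hc _)] at this
    by_contra hne
    have := Nat.one_lt_two_pow hne
    omega
  refine ⟨h0, eq_of_compat_iff fun f h => ?_⟩
  have := key f h
  rw [h0] at this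
  split_ifs at this <;> simp_all

/-! ### Permutations, bars, and the generation of all diagrams -/

/-- Relabelling the vertices of a diagram. -/
def relabel (e : Equiv.Perm (Fin n ⊕ Fin n)) (γ : BrauerDiagram n) : BrauerDiagram n where
  mate v := e (γ.mate (e.symm v))
  mate_mate v := by simp [γ.mate_mate]
  mate_ne v h := γ.mate_ne (e.symm v) (by rw [← e.symm_apply_apply (γ.mate _), h])

theorem relabel_mate (e : Equiv.Perm (Fin n ⊕ Fin n)) (γ : BrauerDiagram n) (v) :
    (relabel e γ).mate v = e (γ.mate (e.symm v)) := rfl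

theorem compat_relabel (e : Equiv.Perm (Fin n ⊕ Fin n)) (γ : BrauerDiagram n)
    (c : Fin n ⊕ Fin n → I) : (relabel e γ).Compat c ↔ γ.Compat (c ∘ e) := by
  constructor
  · intro h v; simpa [relabel] using h (e v)
  · intro h v; simpa [relabel] using h (e.symm v)

theorem compat_ofPerm (s : Equiv.Perm (Fin n)) (f g : Fin n → I) :
    (ofPerm s).Compat (Sum.elim f g) ↔ g = f ∘ s := by
  constructor
  · intro h; funext i; exact (h (Sum.inr i)).symm
  · rintro rfl (i | i) <;> simp [ofPerm]

theorem comp_ofPerm_left (s : Equiv.Perm (Fin n)) (γ : BrauerDiagram n) :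
    loops (ofPerm s) γ = 0 ∧ comp (ofPerm s) γ = relabel (Equiv.sumCongr s 1) γ := by
  refine comp_eq_of_unique (fun f _ => f ∘ s) (fun f g h hg _ => (compat_ofPerm s f g).1 hg) ?_
  intro f h
  rw [compat_relabel, compat_ofPerm, eq_self_iff_true, true_and]
  have : Sum.elim f h ∘ (Equiv.sumCongr s 1) = Sum.elim (f ∘ s) h := by
    funext v; rcases v with k | k <;> rfl
  rw [this]

theorem comp_ofPerm_right (s : Equiv.Perm (Fin n)) (γ : BrauerDiagram n) :
    loops γ (ofPerm s) = 0 ∧ comp γ (ofPerm s) = relabel (Equiv.sumCongr 1 s.symm) γ := by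
  refine comp_eq_of_unique (fun _ h => h ∘ s.symm) (fun f g h _ hg => ?_) ?_
  · rw [(compat_ofPerm s g h).1 hg]; funext k; simp
  intro f h
  rw [compat_relabel, compat_ofPerm]
  have : Sum.elim f h ∘ (Equiv.sumCongr 1 s.symm) = Sum.elim f (h ∘ s.symm) := by
    funext v; rcases v with k | k <;> rfl
  rw [this]
  refine ⟨fun H => ⟨H, ?_⟩, fun H => H.1⟩
  funext k; simp

theorem compat_bar {p q : Fin n} (hpq : p ≠ q) (f g : Fin n → I) :
    (bar p q hpq).Compat (Sum.elim f g) ↔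
      f p = f q ∧ g p = g q ∧ ∀ m, m ≠ p → m ≠ q → f m = g m := by
  constructor
  · intro h
    refine ⟨?_, ?_, fun m hp hq => ?_⟩
    · simpa [bar] using (h (Sum.inl p)).symm
    · simpa [bar] using (h (Sum.inr p)).symm
    · simpa [bar, hp, hq] using (h (Sum.inl m)).symm
  · rintro ⟨h1, h2, h3⟩ (m | m)
    · by_cases hp : m = p
      · subst hp; simp [bar, h1]
      by_cases hq : m = q
      · subst hq; simp [bar, hp, h1]
      simp [bar, hp, hq, h3 m hp hq]
    · by_cases hp : m = p
      · subst hp; simp [bar, h2]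
      by_cases hq : m = q
      · subst hq; simp [bar, hp, h2]
      simp [bar, hp, hq, h3 m hp hq]

theorem relabel_bar (s : Equiv.Perm (Fin n)) {p q : Fin n} (hpq : p ≠ q) :
    relabel (Equiv.sumCongr s s) (bar p q hpq) =
      bar (s p) (s q) (fun h => hpq (s.injective h)) := by
  refine eq_of_compat_iff fun f g => ?_
  rw [compat_relabel]
  have : Sum.elim f g ∘ (Equiv.sumCongr s s) = Sum.elim (f ∘ s) (g ∘ s) := by
    funext v; rcases v with k | k <;> rfl
  rw [this, compat_bar, compat_bar]
  refine and_congr Iff.rfl (and_congr Iff.rfl ⟨fun h m hp hq => ?_, fun h m hp hq => ?_⟩)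
  · have := h (s.symm m) (fun he => hp (by rw [← he, s.apply_symm_apply]))
      (fun he => hq (by rw [← he, s.apply_symm_apply]))
    simpa using this
  · exact h (s m) (fun he => hp (s.injective he)) (fun he => hq (s.injective he))

theorem relabel_relabel (e e' : Equiv.Perm (Fin n ⊕ Fin n)) (γ : BrauerDiagram n) :
    relabel e (relabel e' γ) = relabel (e'.trans e) γ := rfl

theorem relabel_ofPerm (s t u : Equiv.Perm (Fin n)) :
    relabel (Equiv.sumCongr s t.symm) (ofPerm u) = ofPerm (s * u * t) := by
  refine eq_of_compat_iff fun f g => ?_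
  rw [compat_relabel]
  have : Sum.elim f g ∘ (Equiv.sumCongr s t.symm) = Sum.elim (f ∘ s) (g ∘ t.symm) := by
    funext v; rcases v with k | k <;> rfl
  rw [this, compat_ofPerm, compat_ofPerm]
  constructor
  · intro h; funext k; simpa using congrFun h (t k)
  · rintro rfl; funext k; simp

theorem relabel_swap_mate {γ : BrauerDiagram n} {p q r t : Fin n} (hpq : p ≠ q)
    (hp : γ.mate (Sum.inl p) = Sum.inl q) (hr : γ.mate (Sum.inr r) = Sum.inr t) :
    (relabel (Equiv.swap (Sum.inl q) (Sum.inr r)) γ).mate (Sum.inl p) = Sum.inr r ∧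
    (relabel (Equiv.swap (Sum.inl q) (Sum.inr r)) γ).mate (Sum.inl q) = Sum.inr t ∧
    ∀ v, v ≠ Sum.inl p → v ≠ Sum.inl q → v ≠ Sum.inr r → v ≠ Sum.inr t →
      (relabel (Equiv.swap (Sum.inl q) (Sum.inr r)) γ).mate v = γ.mate v ∧
      γ.mate v ≠ Sum.inl p ∧ γ.mate v ≠ Sum.inl q := by
  have hq : γ.mate (Sum.inl q) = Sum.inl p := by rw [← hp, mate_mate]
  have hrt : r ≠ t := fun h => γ.mate_ne (Sum.inr r) (by rw [hr, h])
  refine ⟨?_, ?_, fun v h1 h2 h3 h4 => ?_⟩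
  · simp [relabel, Equiv.swap_apply_of_ne_of_ne, hpq, hp]
  · simp [relabel, Equiv.swap_apply_of_ne_of_ne, hrt.symm, hr]
  · have h5 : γ.mate v ≠ Sum.inl p := fun h => h2 (by rw [← γ.mate_mate v, h, hp])
    have h6 : γ.mate v ≠ Sum.inl q := fun h => h1 (by rw [← γ.mate_mate v, h, hq])
    have h7 : γ.mate v ≠ Sum.inr r := fun h => h4 (by rw [← γ.mate_mate v, h, hr])
    exact ⟨by simp only [relabel, Equiv.symm_swap, Equiv.swap_apply_of_ne_of_ne h2 h3,
      Equiv.swap_apply_of_ne_of_ne h6 h7], h5, h6⟩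

/-- A diagram with the edges `{p, q}` and `{r̄, t̄}` is the product of `bar p q` and the diagram
in which these two edges are replaced by `{p, r̄}` and `{q, t̄}`. -/
theorem comp_bar_relabel {γ : BrauerDiagram n} {p q r t : Fin n} (hpq : p ≠ q)
    (hp : γ.mate (Sum.inl p) = Sum.inl q) (hr : γ.mate (Sum.inr r) = Sum.inr t) :
    loops (bar p q hpq) (relabel (Equiv.swap (Sum.inl q) (Sum.inr r)) γ) = 0 ∧
      comp (bar p q hpq) (relabel (Equiv.swap (Sum.inl q) (Sum.inr r)) γ) = γ := by
  have hq : γ.mate (Sum.inl q) = Sum.inl p := by rw [← hp, mate_mate]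
  have ht : γ.mate (Sum.inr t) = Sum.inr r := by rw [← hr, mate_mate]
  obtain ⟨hp', hq', hmate'⟩ := relabel_swap_mate hpq hp hr
  set γ' := relabel (Equiv.swap (Sum.inl q) (Sum.inr r)) γ with hγ'
  have hr' : γ'.mate (Sum.inr r) = Sum.inl p := by rw [← hp', mate_mate]
  have ht' : γ'.mate (Sum.inr t) = Sum.inl q := by rw [← hq', mate_mate]
  have hcγ : ∀ {c : Fin n ⊕ Fin n → Bool}, γ.Compat c ↔ c (Sum.inl p) = c (Sum.inl q) ∧
      c (Sum.inr r) = c (Sum.inr t) ∧ ∀ v, v ≠ Sum.inl p → v ≠ Sum.inl q → v ≠ Sum.inr r →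
        v ≠ Sum.inr t → c (γ.mate v) = c v := by
    intro c
    refine ⟨fun h => ⟨by rw [← h, hp], by rw [← h, hr], fun v _ _ _ _ => h v⟩, ?_⟩
    rintro ⟨h1, h2, h3⟩ v
    by_cases e1 : v = Sum.inl p
    · rw [e1, hp, h1]
    by_cases e2 : v = Sum.inl q
    · rw [e2, hq, h1]
    by_cases e3 : v = Sum.inr r
    · rw [e3, hr, h2]
    by_cases e4 : v = Sum.inr t
    · rw [e4, ht, h2]
    exact h3 v e1 e2 e3 e4
  have hcγ' : ∀ {c : Fin n ⊕ Fin n → Bool}, γ'.Compat c ↔ c (Sum.inl p) = c (Sum.inr r) ∧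
      c (Sum.inl q) = c (Sum.inr t) ∧ ∀ v, v ≠ Sum.inl p → v ≠ Sum.inl q → v ≠ Sum.inr r →
        v ≠ Sum.inr t → c (γ.mate v) = c v := by
    intro c
    refine ⟨fun h => ⟨by rw [← h, hp'], by rw [← h, hq'], fun v h1 h2 h3 h4 => ?_⟩, ?_⟩
    · rw [← (hmate' v h1 h2 h3 h4).1, h v]
    rintro ⟨h1, h2, h3⟩ v
    by_cases e1 : v = Sum.inl p
    · rw [e1, hp', h1]
    by_cases e2 : v = Sum.inl q
    · rw [e2, hq', h2]
    by_cases e3 : v = Sum.inr r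
    · rw [e3, hr', h1]
    by_cases e4 : v = Sum.inr t
    · rw [e4, ht', h2]
    rw [(hmate' v e1 e2 e3 e4).1]
    exact h3 v e1 e2 e3 e4
  -- Away from `p` and `q` the bar is vertical and copies the upper colours. At `p` and `q` the
  -- colour arrives along the new edge from `p` to `r̄`.
  refine comp_eq_of_unique (fun f h m => if m = p ∨ m = q then h r else f m) ?_ ?_
  · intro f g h h1 h2
    obtain ⟨_, hg, hfg⟩ := (compat_bar hpq f g).1 h1
    obtain ⟨hgr, -, -⟩ := hcγ'.1 h2
    simp only [Sum.elim_inl, Sum.elim_inr] at hgr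
    funext m
    split_ifs with hm
    · rcases hm with rfl | rfl
      · exact hgr
      · rw [← hg, hgr]
    · rw [not_or] at hm; exact (hfg m hm.1 hm.2).symm
  · intro f h
    rw [hcγ, compat_bar, hcγ']
    have key : ∀ v, v ≠ Sum.inl p → v ≠ Sum.inl q →
        Sum.elim (fun m => if m = p ∨ m = q then h r else f m) h v = Sum.elim f h v := by
      rintro (m | m) h1 h2
      · have e1 : m ≠ p := fun e => h1 (by rw [e])
        have e2 : m ≠ q := fun e => h2 (by rw [e])
        simp [e1, e2]
      · rfl
    simp only [Sum.elim_inl, Sum.elim_inr, true_or, or_true, if_true, true_and]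
    constructor
    · rintro ⟨h1, h2, h3⟩
      refine ⟨⟨h1, fun m e1 e2 => by simp [e1, e2]⟩, h2, fun v e1 e2 e3 e4 => ?_⟩
      obtain ⟨-, e5, e6⟩ := hmate' v e1 e2 e3 e4
      rw [key _ e1 e2, key _ e5 e6]
      exact h3 v e1 e2 e3 e4
    · rintro ⟨⟨h1, -⟩, h2, h3⟩
      refine ⟨h1, h2, fun v e1 e2 e3 e4 => ?_⟩
      obtain ⟨-, e5, e6⟩ := hmate' v e1 e2 e3 e4
      rw [← key _ e1 e2, ← key _ e5 e6]
      exact h3 v e1 e2 e3 e4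

/-- Otherwise the lower vertices would be matched injectively, hence bijectively, with the upper
ones, leaving no room for an edge between `p` and `q`. -/
theorem exists_mate_inr_eq_inr {γ : BrauerDiagram n} {p q : Fin n}
    (hp : γ.mate (Sum.inl p) = Sum.inl q) : ∃ r t, γ.mate (Sum.inr r) = Sum.inr t := by
  by_contra hno
  push Not at hno
  have : ∀ r : Fin n, ∃ k, γ.mate (Sum.inr r) = Sum.inl k := by
    intro r
    rcases h : γ.mate (Sum.inr r) with k | k
    · exact ⟨k, rfl⟩
    · exact absurd h (hno r k)
  choose φ hφ using this
  have hinj : Function.Injective φ := by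
    intro r s hrs
    have : γ.mate (Sum.inr r) = γ.mate (Sum.inr s) := by rw [hφ, hφ, hrs]
    have := congrArg γ.mate this
    rw [mate_mate, mate_mate] at this
    exact Sum.inr_injective this
  obtain ⟨r, hr⟩ := (Finite.injective_iff_surjective.1 hinj) p
  have := hφ r
  rw [hr] at this
  have := congrArg γ.mate this
  rw [mate_mate, hp] at this
  exact absurd this (by simp)

/-- Every diagram arises from permutations by products `bar p q ∘ γ'` without loops. -/
theorem induction_bar {P : BrauerDiagram n → Prop} (perm : ∀ s, P (ofPerm s))
    (step : ∀ γ (p q r t : Fin n), p ≠ q → γ.mate (Sum.inl p) = Sum.inl q →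
      γ.mate (Sum.inr r) = Sum.inr t →
      P (relabel (Equiv.swap (Sum.inl q) (Sum.inr r)) γ) → P γ) : ∀ γ, P γ := by
  classical
  -- Induction on the number of upper vertices whose partner is also upper. The exchange in `step`
  -- removes `p` from them and adds none.
  suffices H : ∀ (m : ℕ) (γ : BrauerDiagram n),
      (Finset.univ.filter fun k : Fin n => (γ.mate (Sum.inl k)).isLeft).card = m → P γ from
    fun γ => H _ γ rfl
  intro m
  induction m using Nat.strong_induction_on with | _ m ih =>
  intro γ hm
  by_cases hex : ∃ p q : Fin n, γ.mate (Sum.inl p) = Sum.inl q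
  · obtain ⟨p, q, hp⟩ := hex
    have hpq : p ≠ q := fun h => γ.mate_ne (Sum.inl p) (by rw [hp, h])
    obtain ⟨r, t, hr⟩ := exists_mate_inr_eq_inr hp
    refine step γ p q r t hpq hp hr (ih _ ?_ _ rfl)
    rw [← hm]
    apply Finset.card_lt_card
    have hq : γ.mate (Sum.inl q) = Sum.inl p := by rw [← hp, mate_mate]
    constructor
    · intro k hk
      replace hk := (Finset.mem_filter.1 hk).2
      refine Finset.mem_filter.2 ⟨Finset.mem_univ _, ?_⟩
      by_cases e1 : k = p
      · rw [e1, hp]; rfl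
      by_cases e2 : k = q
      · rw [e2, hq]; rfl
      have e5 : (Sum.inl k : Fin n ⊕ Fin n) ≠ Sum.inl q := fun e => e2 (Sum.inl_injective e)
      rw [relabel_mate, Equiv.symm_swap, Equiv.swap_apply_of_ne_of_ne e5 Sum.inl_ne_inr] at hk
      by_cases e3 : γ.mate (Sum.inl k) = Sum.inr r
      · have := congrArg γ.mate e3
        rw [mate_mate, hr] at this
        exact absurd this (by simp)
      have e4 : γ.mate (Sum.inl k) ≠ Sum.inl q := by
        intro e
        have := congrArg γ.mate e
        rw [mate_mate, hq] at this
        exact e1 (Sum.inl_injective this)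
      rwa [Equiv.swap_apply_of_ne_of_ne e4 e3] at hk
    · intro hsub
      have e5 : (Sum.inl p : Fin n ⊕ Fin n) ≠ Sum.inl q := fun e => hpq (Sum.inl_injective e)
      have := (Finset.mem_filter.1 (@hsub p (by simp [hp]))).2
      rw [relabel_mate, Equiv.symm_swap, Equiv.swap_apply_of_ne_of_ne e5 Sum.inl_ne_inr, hp,
        Equiv.swap_apply_left] at this
      simp at this
  · push Not at hex
    have : ∀ k : Fin n, ∃ r, γ.mate (Sum.inl k) = Sum.inr r := by
      intro k
      rcases h : γ.mate (Sum.inl k) with r | r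
      · exact absurd h (hex k r)
      · exact ⟨r, rfl⟩
    choose φ hφ using this
    have hinj : Function.Injective φ := by
      intro r s hrs
      have : γ.mate (Sum.inl r) = γ.mate (Sum.inl s) := by rw [hφ, hφ, hrs]
      have := congrArg γ.mate this
      rw [mate_mate, mate_mate] at this
      exact Sum.inl_injective this
    let s : Equiv.Perm (Fin n) :=
      (Equiv.ofBijective φ ⟨hinj, Finite.injective_iff_surjective.1 hinj⟩).symm
    have hs : ∀ k, s.symm k = φ k := fun k => rfl
    have : γ = ofPerm s := by
      ext1
      funext v
      rcases v with k | k
      · simp [ofPerm, hs, hφ]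
      · have h1 : φ (s k) = k := by rw [← hs]; simp
        have := hφ (s k)
        rw [h1] at this
        conv_lhs => rw [← this, mate_mate]
        rfl
    rw [this]
    exact perm s

instance : Finite (BrauerDiagram n) :=
  Finite.of_injective (fun γ : BrauerDiagram n => γ.mate) fun _ _ h => BrauerDiagram.ext h

noncomputable instance : Fintype (BrauerDiagram n) := Fintype.ofFinite _

end BrauerDiagram

/-! ### Models of the relations and their degree filtration -/

/-- A family of elements of an algebra that satisfies the relations of the affine Brauer algebra,
with a central element `gen (w 0)` in place of the scalar `N`. -/
structure IsAffineBrauerModel {n : ℕ} {A : Type*} [Ring A] [Algebra ℂ A]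
    (gen : AffineBrauerGen n → A) : Prop where
  b_one : gen (.b (BrauerDiagram.ofPerm 1)) = 1
  b_mul (γ γ' : BrauerDiagram n) : gen (.b γ) * gen (.b γ') =
    gen (.w 0) ^ BrauerDiagram.loops γ γ' * gen (.b (BrauerDiagram.comp γ γ'))
  y_comm (k l : Fin n) : gen (.y k) * gen (.y l) = gen (.y l) * gen (.y k)
  w_central (i : ℕ) (g : AffineBrauerGen n) : gen (.w i) * gen g = gen g * gen (.w i)
  s_y (k : ℕ) (hk : k + 1 < n) (l : Fin n) (h : (l : ℕ) ≠ k) (h' : (l : ℕ) ≠ k + 1) :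
    gen (.b (.ofPerm (Equiv.swap ⟨k, by omega⟩ ⟨k + 1, hk⟩))) * gen (.y l) =
      gen (.y l) * gen (.b (.ofPerm (Equiv.swap ⟨k, by omega⟩ ⟨k + 1, hk⟩)))
  sbar_y (k : ℕ) (hk : k + 1 < n) (l : Fin n) (h : (l : ℕ) ≠ k) (h' : (l : ℕ) ≠ k + 1) :
    gen (.b (.bar ⟨k, by omega⟩ ⟨k + 1, hk⟩ (by simp))) * gen (.y l) =
      gen (.y l) * gen (.b (.bar ⟨k, by omega⟩ ⟨k + 1, hk⟩ (by simp)))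
  s_y_self (k : ℕ) (hk : k + 1 < n) :
    gen (.b (.ofPerm (Equiv.swap ⟨k, by omega⟩ ⟨k + 1, hk⟩))) * gen (.y ⟨k, by omega⟩) -
      gen (.y ⟨k + 1, hk⟩) * gen (.b (.ofPerm (Equiv.swap ⟨k, by omega⟩ ⟨k + 1, hk⟩))) =
      gen (.b (.bar ⟨k, by omega⟩ ⟨k + 1, hk⟩ (by simp))) - 1
  s_y_succ (k : ℕ) (hk : k + 1 < n) :
    gen (.b (.ofPerm (Equiv.swap ⟨k, by omega⟩ ⟨k + 1, hk⟩))) * gen (.y ⟨k + 1, hk⟩) -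
      gen (.y ⟨k, by omega⟩) * gen (.b (.ofPerm (Equiv.swap ⟨k, by omega⟩ ⟨k + 1, hk⟩))) =
      1 - gen (.b (.bar ⟨k, by omega⟩ ⟨k + 1, hk⟩ (by simp)))
  sbar_mul_y_add (k : ℕ) (hk : k + 1 < n) :
    gen (.b (.bar ⟨k, by omega⟩ ⟨k + 1, hk⟩ (by simp))) *
      (gen (.y ⟨k, by omega⟩) + gen (.y ⟨k + 1, hk⟩)) = 0
  y_add_mul_sbar (k : ℕ) (hk : k + 1 < n) :
    (gen (.y ⟨k, by omega⟩) + gen (.y ⟨k + 1, hk⟩)) *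
      gen (.b (.bar ⟨k, by omega⟩ ⟨k + 1, hk⟩ (by simp))) = 0
  sbar_y_pow_sbar (h : 0 + 1 < n) (i : ℕ) (hi : 1 ≤ i) :
    gen (.b (.bar ⟨0, by omega⟩ ⟨0 + 1, h⟩ (by simp))) * gen (.y ⟨0, by omega⟩) ^ i *
      gen (.b (.bar ⟨0, by omega⟩ ⟨0 + 1, h⟩ (by simp))) =
      gen (.w i) * gen (.b (.bar ⟨0, by omega⟩ ⟨0 + 1, h⟩ (by simp)))
  w_odd (i : ℕ) (hi : Odd i) : (-2 : ℂ) • gen (.w i) =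
    gen (.w (i - 1)) + ∑ j ∈ Finset.Icc 1 i, (-1) ^ j * (gen (.w (i - j)) * gen (.w (j - 1)))

namespace AffineBrauerGen

variable {n : ℕ}

/-- The degrees of the generators. -/
def wt : AffineBrauerGen n → ℕ
  | b _ => 0
  | y _ => 1
  | w i => i

section Filtration

variable {A : Type*} [Ring A] [Algebra ℂ A] (gen : AffineBrauerGen n → A)

/-- The span of the words of degree less than `e` in the generators. -/
def filt (e : ℕ) : Submodule ℂ A :=
  Submodule.span ℂ {u | ∃ l : List (AffineBrauerGen n), (l.map wt).sum < e ∧ u = (l.map gen).prod}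

variable {gen}

theorem filt_zero : filt gen 0 = ⊥ := by
  rw [filt, Submodule.span_eq_bot]
  rintro x ⟨l, hl, -⟩
  omega

theorem filt_mono {d e : ℕ} (h : d ≤ e) : filt gen d ≤ filt gen e :=
  Submodule.span_mono fun _ ⟨l, hl, hu⟩ => ⟨l, hl.trans_le h, hu⟩

theorem gen_mem_filt (g : AffineBrauerGen n) {e : ℕ} (h : wt g < e) : gen g ∈ filt gen e :=
  Submodule.subset_span ⟨[g], by simpa using h, by simp⟩

theorem one_mem_filt {e : ℕ} (h : 0 < e) : (1 : A) ∈ filt gen e :=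
  Submodule.subset_span ⟨[], by simpa using h, by simp⟩

/-- `filt gen d` contains the degrees up to `d - 1`, so products have degree at most `d + e - 2`.
This is the source of the `+ 1` in the bound, and it makes each `filt gen e` stable under
multiplication by `filt gen 1`. -/
theorem mul_mem_filt {d e k : ℕ} (h : d + e ≤ k + 1) {x z : A} (hx : x ∈ filt gen d)
    (hz : z ∈ filt gen e) : x * z ∈ filt gen k := by
  induction hx using Submodule.span_induction with
  | mem x hx =>
    obtain ⟨l, hl, rfl⟩ := hx
    induction hz using Submodule.span_induction with
    | mem z hz =>
      obtain ⟨l', hl', rfl⟩ := hz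
      refine Submodule.subset_span ⟨l ++ l', ?_, by simp⟩
      rw [List.map_append, List.sum_append]; omega
    | zero => rw [mul_zero]; exact zero_mem _
    | add a c _ _ ha hc => rw [mul_add]; exact add_mem ha hc
    | smul r a _ ha => rw [mul_smul_comm]; exact Submodule.smul_mem _ _ ha
  | zero => rw [zero_mul]; exact zero_mem _
  | add a c _ _ ha hc => rw [add_mul]; exact add_mem ha hc
  | smul r a _ ha => rw [smul_mul_assoc]; exact Submodule.smul_mem _ _ ha

theorem mul_mem_filt_left {e : ℕ} {x z : A} (hx : x ∈ filt gen 1) (hz : z ∈ filt gen e) :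
    x * z ∈ filt gen e := mul_mem_filt (by omega) hx hz

theorem mul_mem_filt_right {e : ℕ} {x z : A} (hx : x ∈ filt gen e) (hz : z ∈ filt gen 1) :
    x * z ∈ filt gen e := mul_mem_filt (by omega) hx hz

theorem b_mem_filt (γ : BrauerDiagram n) : gen (.b γ) ∈ filt gen 1 :=
  gen_mem_filt _ (by simp [wt])

theorem y_mem_filt (k : Fin n) : gen (.y k) ∈ filt gen 2 :=
  gen_mem_filt _ (by simp [wt])

theorem y_pow_mem_filt (k : Fin n) (m : ℕ) : gen (.y k) ^ m ∈ filt gen (m + 1) := by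
  induction m with
  | zero => simpa using one_mem_filt (gen := gen) one_pos
  | succ m ih => rw [pow_succ]; exact mul_mem_filt (by omega) ih (y_mem_filt k)

theorem map_filt {B : Type*} [Ring B] [Algebra ℂ B] (f : A →ₐ[ℂ] B) (e : ℕ) :
    (filt gen e).map f.toLinearMap = filt (fun g => f (gen g)) e := by
  rw [filt, Submodule.map_span, filt]
  congr 1
  ext u
  constructor
  · rintro ⟨_, ⟨l, hl, rfl⟩, rfl⟩
    exact ⟨l, hl, by simp [map_list_prod, Function.comp_def]⟩
  · rintro ⟨l, hl, rfl⟩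
    exact ⟨_, ⟨l, hl, rfl⟩, by simp [map_list_prod, Function.comp_def]⟩

theorem exists_mem_filt {x : A} (hx : x ∈ Algebra.adjoin ℂ (Set.range gen)) :
    ∃ e, x ∈ filt gen e := by
  induction hx using Algebra.adjoin_induction with
  | mem x hx => obtain ⟨g, rfl⟩ := hx; exact ⟨_, gen_mem_filt g (Nat.lt_succ_self _)⟩
  | algebraMap r =>
    exact ⟨1, by rw [Algebra.algebraMap_eq_smul_one]
                 exact Submodule.smul_mem _ _ (one_mem_filt one_pos)⟩
  | add x z _ _ hx hz =>
    obtain ⟨d, hd⟩ := hx; obtain ⟨e, he⟩ := hz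
    exact ⟨d + e, add_mem (filt_mono (by omega) hd) (filt_mono (by omega) he)⟩
  | mul x z _ _ hx hz =>
    obtain ⟨d, hd⟩ := hx; obtain ⟨e, he⟩ := hz
    exact ⟨d + e, mul_mem_filt (by omega) hd he⟩

end Filtration

end AffineBrauerGen

/-! ### The relations modulo lower degree -/

namespace IsAffineBrauerModel

open AffineBrauerGen BrauerDiagram

variable {n : ℕ} {A : Type*} [Ring A] [Algebra ℂ A] {gen : AffineBrauerGen n → A}
  (hm : IsAffineBrauerModel gen)

include hm

theorem b_mul_of_loops {γ γ' δ : BrauerDiagram n} (h : loops γ γ' = 0 ∧ comp γ γ' = δ) :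
    gen (.b γ) * gen (.b γ') = gen (.b δ) := by
  rw [hm.b_mul, h.1, h.2, pow_zero, one_mul]

theorem b_perm_mul (s : Equiv.Perm (Fin n)) (γ : BrauerDiagram n) :
    gen (.b (.ofPerm s)) * gen (.b γ) = gen (.b (relabel (Equiv.sumCongr s 1) γ)) :=
  hm.b_mul_of_loops (comp_ofPerm_left s γ)

theorem b_mul_perm (s : Equiv.Perm (Fin n)) (γ : BrauerDiagram n) :
    gen (.b γ) * gen (.b (.ofPerm s)) = gen (.b (relabel (Equiv.sumCongr 1 s.symm) γ)) :=
  hm.b_mul_of_loops (comp_ofPerm_right s γ)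

theorem b_ofPerm_mul (s t : Equiv.Perm (Fin n)) :
    gen (.b (.ofPerm (s * t))) = gen (.b (.ofPerm s)) * gen (.b (.ofPerm t)) := by
  rw [hm.b_perm_mul]
  have := relabel_ofPerm s 1 t
  rw [mul_one] at this
  rw [← this]; rfl

theorem b_ofPerm_inv_mul (s : Equiv.Perm (Fin n)) :
    gen (.b (.ofPerm s⁻¹)) * gen (.b (.ofPerm s)) = 1 := by
  rw [← hm.b_ofPerm_mul, inv_mul_cancel, hm.b_one]

/-- All bars are conjugate under the symmetric group. The defining relations, which treat only
adjacent slots, spread from the first bar to all others in this way. -/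
theorem b_conj_bar (s : Equiv.Perm (Fin n)) {p q : Fin n} (hpq : p ≠ q) :
    gen (.b (.bar (s p) (s q) fun h => hpq (s.injective h))) =
      gen (.b (.ofPerm s)) * gen (.b (.bar p q hpq)) * gen (.b (.ofPerm s⁻¹)) := by
  rw [hm.b_perm_mul, hm.b_mul_perm, relabel_relabel, ← relabel_bar]
  congr 3
  ext v; rcases v with k | k <;> simp <;> rfl

omit hm in
/-- An induction principle for the symmetric group on `Fin n` through adjacent transpositions. -/
theorem _root_.Equiv.Perm.induction_adjacent {P : Equiv.Perm (Fin n) → Prop} (one : P 1)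
    (swap : ∀ (k : ℕ) (hk : k + 1 < n), P (Equiv.swap ⟨k, by omega⟩ ⟨k + 1, hk⟩))
    (mul : ∀ s t, P s → P t → P (s * t)) (s : Equiv.Perm (Fin n)) : P s := by
  rcases n with _ | n
  · rwa [Subsingleton.elim s 1]
  · have hs : s ∈ Submonoid.closure (Set.range fun i : Fin n =>
        Equiv.swap i.castSucc i.succ) := by
      rw [Equiv.Perm.mclosure_swap_castSucc_succ]; trivial
    induction hs using Submonoid.closure_induction with
    | mem x hx =>
      obtain ⟨i, rfl⟩ := hx
      exact swap i.1 (by omega)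
    | one => exact one
    | mul x y _ _ hx hy => exact mul x y hx hy

/-- For adjacent transpositions the error term is `± (s̄ - 1)` or zero, of degree zero. Composing
permutations multiplies the errors only by elements of degree zero. -/
theorem perm_y (s : Equiv.Perm (Fin n)) : ∀ k : Fin n,
    gen (.b (.ofPerm s)) * gen (.y k) - gen (.y (s k)) * gen (.b (.ofPerm s)) ∈ filt gen 1 := by
  induction s using Equiv.Perm.induction_adjacent with
  | one => intro k; simp [hm.b_one]
  | swap j hj =>
    intro k
    by_cases h1 : k = ⟨j, by omega⟩
    · subst h1
      rw [Equiv.swap_apply_left, hm.s_y_self]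
      exact sub_mem (b_mem_filt _) (one_mem_filt one_pos)
    by_cases h2 : k = ⟨j + 1, hj⟩
    · subst h2
      rw [Equiv.swap_apply_right, hm.s_y_succ]
      exact sub_mem (one_mem_filt one_pos) (b_mem_filt _)
    · rw [Equiv.swap_apply_of_ne_of_ne h1 h2, hm.s_y, sub_self]
      · exact zero_mem _
      · exact fun h => h1 (Fin.ext h)
      · exact fun h => h2 (Fin.ext h)
  | mul s t hs ht =>
    intro k
    rw [hm.b_ofPerm_mul, Equiv.Perm.mul_apply]
    have h1 := mul_mem_filt_left (b_mem_filt (gen := gen) (.ofPerm s)) (ht k)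
    have h2 := mul_mem_filt_right (hs (t k)) (b_mem_filt (gen := gen) (.ofPerm t))
    convert add_mem h1 h2 using 1
    noncomm_ring

theorem perm_y_pow (s : Equiv.Perm (Fin n)) (k : Fin n) (m : ℕ) :
    gen (.b (.ofPerm s)) * gen (.y k) ^ m - gen (.y (s k)) ^ m * gen (.b (.ofPerm s)) ∈
      filt gen m := by
  induction m with
  | zero => simp
  | succ m ih =>
    have h1 := mul_mem_filt (k := m + 1) (by omega) ih (y_mem_filt (gen := gen) k)
    have h2 := mul_mem_filt (k := m + 1) (by omega) (y_pow_mem_filt (gen := gen) (s k) m)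
      (hm.perm_y s k)
    convert add_mem h1 h2 using 1
    rw [pow_succ, pow_succ]
    noncomm_ring

theorem bar_mul_y (s : Equiv.Perm (Fin n)) {p q : Fin n} (hpq : p ≠ q) (l : Fin n) :
    gen (.b (.bar (s p) (s q) fun h => hpq (s.injective h))) * gen (.y (s l)) -
      gen (.b (.ofPerm s)) * (gen (.b (.bar p q hpq)) * gen (.y l)) * gen (.b (.ofPerm s⁻¹)) ∈
      filt gen 1 := by
  rw [hm.b_conj_bar]
  have h1 := mul_mem_filt_left (mul_mem_filt_left (b_mem_filt (gen := gen) (.ofPerm s))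
    (b_mem_filt (.bar p q hpq))) (hm.perm_y s⁻¹ (s l))
  rw [show s⁻¹ (s l) = l from s.symm_apply_apply l] at h1
  convert h1 using 1
  noncomm_ring

theorem y_mul_bar (s : Equiv.Perm (Fin n)) {p q : Fin n} (hpq : p ≠ q) (l : Fin n) :
    gen (.y (s l)) * gen (.b (.bar (s p) (s q) fun h => hpq (s.injective h))) -
      gen (.b (.ofPerm s)) * (gen (.y l) * gen (.b (.bar p q hpq))) * gen (.b (.ofPerm s⁻¹)) ∈
      filt gen 1 := by
  rw [hm.b_conj_bar]
  have h1 := mul_mem_filt_right (mul_mem_filt_right (hm.perm_y s l)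
    (b_mem_filt (.bar p q hpq))) (b_mem_filt (gen := gen) (.ofPerm s⁻¹))
  rw [← neg_mem_iff] at h1
  convert h1 using 1
  noncomm_ring

theorem bar_y_pow_bar_conj (s : Equiv.Perm (Fin n)) {p q : Fin n} (hpq : p ≠ q) (m : ℕ) :
    gen (.b (.bar (s p) (s q) fun h => hpq (s.injective h))) * gen (.y (s p)) ^ m *
        gen (.b (.bar (s p) (s q) fun h => hpq (s.injective h))) -
      gen (.b (.ofPerm s)) * (gen (.b (.bar p q hpq)) * gen (.y p) ^ m *
        gen (.b (.bar p q hpq))) * gen (.b (.ofPerm s⁻¹)) ∈ filt gen m := by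
  rw [hm.b_conj_bar]
  have h0 := hm.perm_y_pow s⁻¹ (s p) m
  rw [show s⁻¹ (s p) = p from s.symm_apply_apply p] at h0
  have h1 := mul_mem_filt_right (mul_mem_filt_left (mul_mem_filt_left
    (b_mem_filt (gen := gen) (.ofPerm s)) (b_mem_filt (.bar p q hpq))) h0)
    (mul_mem_filt_left (mul_mem_filt_left (b_mem_filt (gen := gen) (.ofPerm s))
    (b_mem_filt (.bar p q hpq))) (b_mem_filt (gen := gen) (.ofPerm s⁻¹)))
  have h2 := hm.b_ofPerm_inv_mul s
  have h3 : ∀ x z : A, x * gen (.b (.ofPerm s⁻¹)) * (gen (.b (.ofPerm s)) * z) = x * z := by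
    intro x z
    rw [← mul_assoc, mul_assoc x, h2, mul_one]
  convert h1 using 1
  rw [mul_sub, sub_mul]
  congr 1
  · simp only [mul_assoc]
  · have := h3 (gen (.b (.ofPerm s)) * gen (.b (.bar p q hpq)) * gen (.y p) ^ m)
      (gen (.b (.bar p q hpq)) * gen (.b (.ofPerm s⁻¹)))
    simp only [mul_assoc] at this ⊢
    rw [this]

omit hm in
theorem _root_.Equiv.Perm.exists_apply_eq_and {α : Type*} [DecidableEq α] {a c p q : α}
    (h : a ≠ c) (hpq : p ≠ q) : ∃ s : Equiv.Perm α, s a = p ∧ s c = q := by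
  refine ⟨Equiv.swap a p * Equiv.swap c (Equiv.swap a p q), ?_, ?_⟩
  · have : a ≠ Equiv.swap a p q := by
      intro h'
      have := congrArg (Equiv.swap a p) h'
      rw [Equiv.swap_apply_left, Equiv.swap_apply_self] at this
      exact hpq this
    rw [Equiv.Perm.mul_apply, Equiv.swap_apply_of_ne_of_ne h this, Equiv.swap_apply_left]
  · rw [Equiv.Perm.mul_apply, Equiv.swap_apply_left, Equiv.swap_apply_self]

/-- The exact relations of the first bar are conjugated by a permutation. By `perm_y` each passage
of a `y` through the permutation costs only terms of lower degree. -/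
theorem bar_relations {p q : Fin n} (hpq : p ≠ q) :
    (∀ l, l ≠ p → l ≠ q → gen (.b (.bar p q hpq)) * gen (.y l) -
      gen (.y l) * gen (.b (.bar p q hpq)) ∈ filt gen 1) ∧
    gen (.b (.bar p q hpq)) * gen (.y p) + gen (.b (.bar p q hpq)) * gen (.y q) ∈ filt gen 1 ∧
    gen (.y p) * gen (.b (.bar p q hpq)) + gen (.y q) * gen (.b (.bar p q hpq)) ∈ filt gen 1 ∧
    ∀ m, 1 ≤ m → gen (.b (.bar p q hpq)) * gen (.y p) ^ m * gen (.b (.bar p q hpq)) -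
      gen (.w m) * gen (.b (.bar p q hpq)) ∈ filt gen m := by
  have hn : 0 + 1 < n := by
    have := p.2; have := q.2; have : (p : ℕ) ≠ q := fun h => hpq (Fin.ext h); omega
  have h01 : (⟨0, by omega⟩ : Fin n) ≠ ⟨0 + 1, hn⟩ := by simp
  obtain ⟨s, rfl, rfl⟩ := Equiv.Perm.exists_apply_eq_and h01 hpq
  refine ⟨fun l hp hq => ?_, ?_, ?_, fun m hm1 => ?_⟩
  · obtain ⟨l, rfl⟩ := s.surjective l
    have h := hm.sbar_y 0 hn l (fun h => hp (congrArg s (Fin.ext h)))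
      (fun h => hq (congrArg s (Fin.ext h)))
    have h1 := hm.bar_mul_y s h01 l
    rw [h] at h1
    convert sub_mem h1 (hm.y_mul_bar s h01 l) using 1
    abel
  · have h := hm.sbar_mul_y_add 0 hn
    rw [mul_add] at h
    have h1 := add_mem (hm.bar_mul_y s h01 ⟨0, by omega⟩) (hm.bar_mul_y s h01 ⟨0 + 1, hn⟩)
    have h2 := congrArg (fun x => gen (.b (.ofPerm s)) * x * gen (.b (.ofPerm s⁻¹))) h
    simp only [mul_add, add_mul, mul_zero, zero_mul] at h2
    rwa [sub_add_sub_comm, h2, sub_zero] at h1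
  · have h := hm.y_add_mul_sbar 0 hn
    rw [add_mul] at h
    have h1 := add_mem (hm.y_mul_bar s h01 ⟨0, by omega⟩) (hm.y_mul_bar s h01 ⟨0 + 1, hn⟩)
    have h2 := congrArg (fun x => gen (.b (.ofPerm s)) * x * gen (.b (.ofPerm s⁻¹))) h
    simp only [mul_add, add_mul, mul_zero, zero_mul] at h2
    rwa [sub_add_sub_comm, h2, sub_zero] at h1
  · have h := hm.sbar_y_pow_sbar hn m hm1
    have h1 := hm.bar_y_pow_bar_conj s h01 m
    rw [h] at h1
    convert h1 using 2
    rw [hm.b_conj_bar s h01, ← mul_assoc (gen (.b (.ofPerm s))), ← hm.w_central m]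
    simp only [mul_assoc]

end IsAffineBrauerModel

/-! ### Polynomials in vertex variables and sliding along edges -/

open scoped IsMulCommutative in
/-- Pairwise commuting elements of an algebra are values of a polynomial algebra. -/
theorem MvPolynomial.exists_algHom_of_commute {σ R E : Type*} [CommRing R] [Ring E] [Algebra R E]
    (f : σ → E) (h : ∀ i j, f i * f j = f j * f i) :
    ∃ F : MvPolynomial σ R →ₐ[R] E, ∀ i, F (X i) = f i := by
  have := Algebra.isMulCommutative_adjoin R (s := Set.range f)
    (by rintro _ ⟨i, rfl⟩ _ ⟨j, rfl⟩; exact h i j)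
  refine ⟨(Subalgebra.val _).comp (aeval (R := R) fun i =>
    (⟨f i, Algebra.subset_adjoin ⟨i, rfl⟩⟩ : Algebra.adjoin R (Set.range f))), fun i => ?_⟩
  simp

/-- A linear map sends weighted homogeneous polynomials into a submodule if it does so for
monomials. -/
theorem MvPolynomial.IsWeightedHomogeneous.map_mem {σ R B : Type*} [CommSemiring R]
    [AddCommMonoid B] [Module R B] {w : σ → ℕ} {e : ℕ} {p : MvPolynomial σ R}
    (hp : IsWeightedHomogeneous w p e) (f : MvPolynomial σ R →ₗ[R] B) (W : Submodule R B)
    (h : ∀ m, Finsupp.weight w m = e → f (monomial m 1) ∈ W) : f p ∈ W := by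
  rw [p.as_sum, map_sum]
  refine Submodule.sum_mem _ fun m hmem => ?_
  rw [← mul_one (coeff m p), ← smul_eq_mul, ← smul_monomial, map_smul]
  exact Submodule.smul_mem _ _ (h m (hp (mem_support_iff.1 hmem)))

namespace AffineBrauerGen

open MvPolynomial BrauerDiagram

variable {n : ℕ}

/-- Polynomials in variables for the vertices of a diagram and for `w_0, w_2, w_4, …`. -/
abbrev VertexPoly (n : ℕ) : Type := MvPolynomial ((Fin n ⊕ Fin n) ⊕ ℕ) ℂ

/-- The degrees of the variables. -/
def vwt : (Fin n ⊕ Fin n) ⊕ ℕ → ℕ := Sum.elim (fun _ => 1) (fun i => 2 * i)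

/-- The sign in the relation between the variables at the two ends of an edge. -/
def edgeSign (u v : Fin n ⊕ Fin n) : ℂ := if u.isLeft = v.isLeft then -1 else 1

theorem edgeSign_comm (u v : Fin n ⊕ Fin n) : edgeSign u v = edgeSign v u := by
  simp only [edgeSign, eq_comm]

theorem edgeSign_mul_self (u v : Fin n ⊕ Fin n) : edgeSign u v * edgeSign u v = 1 := by
  unfold edgeSign; split_ifs <;> norm_num

/-- The position of a vertex. -/
def vertexRank : Fin n ⊕ Fin n → ℕ := Sum.elim (fun k => k) (fun k => n + k)

theorem vertexRank_injective : Function.Injective (vertexRank (n := n)) := by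
  rintro (i | i) (j | j) h <;> simp only [vertexRank, Sum.elim_inl, Sum.elim_inr] at h
  · rw [Fin.ext h]
  · omega
  · omega
  · rw [Fin.ext (Nat.add_left_cancel h)]

/-- The first vertex of the edge at `u`. -/
def edgeRep (γ : BrauerDiagram n) (u : Fin n ⊕ Fin n) : Fin n ⊕ Fin n :=
  if vertexRank u < vertexRank (γ.mate u) then u else γ.mate u

/-- The sign between the variables at `u` and at the first vertex of the edge at `u`. -/
def repSign (γ : BrauerDiagram n) (u : Fin n ⊕ Fin n) : ℂ :=
  if vertexRank u < vertexRank (γ.mate u) then 1 else edgeSign u (γ.mate u)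

/-- The substitution that expresses the variable at each vertex through the variable at the first
vertex of its edge. -/
noncomputable def reduce (γ : BrauerDiagram n) : VertexPoly n →ₐ[ℂ] VertexPoly n :=
  aeval (Sum.elim (fun u => repSign γ u • X (Sum.inl (edgeRep γ u))) (fun i => X (Sum.inr i)))

section

variable {A : Type*} [Ring A] [Algebra ℂ A] (gen : AffineBrauerGen n → A)

/-- The variables at the vertices `k` and `k̄` act as left and right multiplication by `y_k`, the
other variables act as multiplication by `w_{2i}`. -/
def vop : (Fin n ⊕ Fin n) ⊕ ℕ → Module.End ℂ A
  | Sum.inl (Sum.inl k) => LinearMap.mulLeft ℂ (gen (.y k))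
  | Sum.inl (Sum.inr k) => LinearMap.mulRight ℂ (gen (.y k))
  | Sum.inr i => LinearMap.mulLeft ℂ (gen (.w (2 * i)))

variable {gen}

theorem vop_mem_filt (v) {e : ℕ} {x : A} (hx : x ∈ filt gen e) :
    vop gen v x ∈ filt gen (e + vwt v) := by
  rcases v with (k | k) | i
  · exact mul_mem_filt (by simp [vwt]; omega) (y_mem_filt k) hx
  · exact mul_mem_filt (by simp [vwt]) hx (y_mem_filt k)
  · exact mul_mem_filt (by simp [vwt, wt]; omega) (gen_mem_filt (.w (2 * i)) (Nat.lt_succ_self _)) hx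

end

end AffineBrauerGen

namespace IsAffineBrauerModel

open AffineBrauerGen BrauerDiagram MvPolynomial

variable {n : ℕ} {A : Type*} [Ring A] [Algebra ℂ A] {gen : AffineBrauerGen n → A}
  (hm : IsAffineBrauerModel gen)

include hm

theorem vop_comm (u v) : vop gen u * vop gen v = vop gen v * vop gen u := by
  ext x
  rcases u with (k | k) | i <;> rcases v with (l | l) | j <;>
    simp only [vop, Module.End.mul_apply, LinearMap.mulLeft_apply, LinearMap.mulRight_apply]
  · rw [← mul_assoc, hm.y_comm, mul_assoc]
  · rw [mul_assoc]
  · rw [← mul_assoc, ← hm.w_central, mul_assoc]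
  · rw [mul_assoc]
  · rw [mul_assoc, hm.y_comm, ← mul_assoc]
  · rw [mul_assoc]
  · rw [← mul_assoc, hm.w_central, mul_assoc]
  · rw [mul_assoc]
  · rw [← mul_assoc, hm.w_central, mul_assoc]

/-- The action of polynomials on a model by multiplication from both sides. -/
noncomputable def act : VertexPoly n →ₐ[ℂ] Module.End ℂ A :=
  (exists_algHom_of_commute (vop gen) hm.vop_comm).choose

theorem act_X (v) : hm.act (X v) = vop gen v :=
  (exists_algHom_of_commute (vop gen) hm.vop_comm).choose_spec v

theorem act_monomial_mem (m) : ∀ {e : ℕ} {x : A}, x ∈ filt gen e →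
    hm.act (monomial m 1) x ∈ filt gen (e + Finsupp.weight vwt m) := by
  induction m using Finsupp.induction_linear with
  | zero => intro e x hx; simpa using hx
  | add f g hf hg =>
    intro e x hx
    have : (monomial (f + g) (1 : ℂ) : VertexPoly n) = monomial g 1 * monomial f 1 := by
      rw [monomial_mul, one_mul, add_comm]
    rw [this, map_mul, Module.End.mul_apply, map_add, ← add_assoc]
    exact hg (hf hx)
  | single v k =>
    rw [Finsupp.weight_single, ← X_pow_eq_monomial, map_pow, hm.act_X]
    induction k with
    | zero => intro e x hx; simpa using hx
    | succ k ih =>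
      intro e x hx
      rw [pow_succ, Module.End.mul_apply, add_smul, one_smul, add_comm (k • _), ← add_assoc]
      exact ih (vop_mem_filt v hx)

theorem act_mem {p : VertexPoly n} {d e : ℕ} (hp : IsWeightedHomogeneous vwt p d) {x : A}
    (hx : x ∈ filt gen e) : hm.act p x ∈ filt gen (e + d) :=
  hp.map_mem ((LinearMap.applyₗ x).comp hm.act.toLinearMap) _ fun m hmd => by
    rw [← hmd]; exact hm.act_monomial_mem m hx

/-- Sliding a generator `y` along an edge of a diagram. -/
theorem slide (γ : BrauerDiagram n) : ∀ u, vop gen (Sum.inl u) (gen (.b γ)) -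
    edgeSign u (γ.mate u) • vop gen (Sum.inl (γ.mate u)) (gen (.b γ)) ∈ filt gen 1 := by
  induction γ using BrauerDiagram.induction_bar with
  | perm s =>
    rintro (k | k)
    · have h := hm.perm_y s (s.symm k)
      rw [s.apply_symm_apply, ← neg_mem_iff, neg_sub] at h
      simpa [vop, ofPerm, edgeSign] using h
    · have h := hm.perm_y s k
      simpa [vop, ofPerm, edgeSign] using h
  | step γ p q r t hpq hp hr ih =>
    have hq : γ.mate (Sum.inl q) = Sum.inl p := by rw [← hp, mate_mate]
    have ht : γ.mate (Sum.inr t) = Sum.inr r := by rw [← hr, mate_mate]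
    obtain ⟨hp', hq', hother⟩ := relabel_swap_mate hpq hp hr
    have hprod := hm.b_mul_of_loops (comp_bar_relabel hpq hp hr)
    obtain ⟨hc, hR, hL, -⟩ := hm.bar_relations hpq
    have ihp := ih (Sum.inl p)
    have ihq := ih (Sum.inl q)
    rw [hp'] at ihp
    rw [hq'] at ihq
    set γ' := relabel (Equiv.swap (Sum.inl q) (Sum.inr r)) γ with hγ'
    rw [← hprod]
    set B := gen (.b (.bar p q hpq))
    have hB : B ∈ filt gen 1 := b_mem_filt _
    have htop : gen (.y p) * (B * gen (.b γ')) + gen (.y q) * (B * gen (.b γ')) ∈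
        filt gen 1 := by
      rw [← mul_assoc, ← mul_assoc, ← add_mul]
      exact mul_mem_filt_right hL (b_mem_filt _)
    -- In `γ'` the elements at `r̄` and `t̄` slide up to `p` and `q`, where their sum is annihilated
    -- by the bar up to lower degree.
    have hbot : B * gen (.b γ') * gen (.y r) + B * gen (.b γ') * gen (.y t) ∈
        filt gen 1 := by
      have h1 := mul_mem_filt_right hR (b_mem_filt (gen := gen) γ')
      have h2 := mul_mem_filt_left hB ihp
      have h3 := mul_mem_filt_left hB ihq
      simp only [vop, edgeSign, Sum.isLeft_inl, Sum.isLeft_inr, reduceCtorEq, if_false, one_smul,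
        LinearMap.mulLeft_apply, LinearMap.mulRight_apply, mul_sub] at h2 h3
      convert sub_mem (sub_mem h1 h2) h3 using 1
      noncomm_ring
    -- At all other vertices the bar is transparent, so that sliding in `γ` is inherited from
    -- sliding in `γ'`.
    have hcom : ∀ u, u ≠ Sum.inl p → u ≠ Sum.inl q → vop gen (Sum.inl u) (B * gen (.b γ')) -
        B * vop gen (Sum.inl u) (gen (.b γ')) ∈ filt gen 1 := by
      rintro (k | k) h1 h2
      · have := mul_mem_filt_right (hc k (fun h => h1 (by rw [h])) (fun h => h2 (by rw [h])))
          (b_mem_filt (gen := gen) γ')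
        rw [← neg_mem_iff] at this
        convert this using 1
        simp only [vop, LinearMap.mulLeft_apply]
        noncomm_ring
      · simp [vop, mul_assoc]
    intro u
    by_cases e1 : u = Sum.inl p
    · subst e1; rw [hp]; simpa [vop, edgeSign] using htop
    by_cases e2 : u = Sum.inl q
    · subst e2; rw [hq, add_comm] at *; simpa [vop, edgeSign] using htop
    by_cases e3 : u = Sum.inr r
    · subst e3; rw [hr]; simpa [vop, edgeSign] using hbot
    by_cases e4 : u = Sum.inr t
    · subst e4; rw [ht]; rw [add_comm] at hbot; simpa [vop, edgeSign] using hbot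
    obtain ⟨h5, h6, h7⟩ := hother u e1 e2 e3 e4
    have ihu := mul_mem_filt_left hB (ih u)
    rw [h5] at ihu
    convert add_mem (add_mem (hcom u e1 e2) ihu) (Submodule.smul_mem _
      (-edgeSign u (γ.mate u)) (hcom _ h6 h7)) using 1
    rw [mul_sub, mul_smul_comm, smul_sub, neg_smul, neg_smul]
    abel

end IsAffineBrauerModel

namespace AffineBrauerGen

open MvPolynomial BrauerDiagram

variable {n : ℕ}

theorem isWeightedHomogeneous_reduce_X (γ : BrauerDiagram n) (v) :
    IsWeightedHomogeneous vwt (reduce γ (X v)) (vwt v) := by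
  rcases v with u | i
  · simp only [reduce, aeval_X, Sum.elim_inl, smul_eq_C_mul]
    exact (isWeightedHomogeneous_X ℂ vwt (Sum.inl (edgeRep γ u))).C_mul _
  · simp only [reduce, aeval_X, Sum.elim_inr]
    exact isWeightedHomogeneous_X ℂ vwt (Sum.inr i)

theorem isWeightedHomogeneous_reduce_monomial (γ : BrauerDiagram n) (m) :
    IsWeightedHomogeneous vwt (reduce γ (monomial m 1)) (Finsupp.weight vwt m) := by
  induction m using Finsupp.induction_linear with
  | zero => simpa using isWeightedHomogeneous_one ℂ vwt
  | add f g hf hg =>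
    have : (monomial (f + g) (1 : ℂ) : VertexPoly n) = monomial f 1 * monomial g 1 := by
      rw [monomial_mul, one_mul]
    rw [this, map_mul, map_add]
    exact hf.mul hg
  | single v k =>
    rw [Finsupp.weight_single, ← X_pow_eq_monomial, map_pow]
    exact (isWeightedHomogeneous_reduce_X γ v).pow k

end AffineBrauerGen

namespace IsAffineBrauerModel

open AffineBrauerGen BrauerDiagram MvPolynomial

variable {n : ℕ} {A : Type*} [Ring A] [Algebra ℂ A] {gen : AffineBrauerGen n → A}
  (hm : IsAffineBrauerModel gen)

include hm

theorem act_mul_apply (p q : VertexPoly n) (x : A) :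
    hm.act (p * q) x = hm.act p (hm.act q x) := by rw [map_mul, Module.End.mul_apply]

theorem act_X_sub_reduce (γ : BrauerDiagram n) (v) :
    hm.act (X v) (gen (.b γ)) - hm.act (reduce γ (X v)) (gen (.b γ)) ∈ filt gen (vwt v) := by
  rcases v with u | i
  · simp only [reduce, aeval_X, Sum.elim_inl, map_smul, hm.act_X, edgeRep, repSign]
    split_ifs
    · simp
    · simpa [vwt] using hm.slide γ u
  · simp [reduce]

/-- Because the acting operators commute, the congruence is multiplicative in the polynomial
(`hadd`). For a single variable it is `slide`, or trivial if the variable is at the first vertex of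
its edge or belongs to a `w`. -/
theorem act_monomial_sub_reduce (γ : BrauerDiagram n) (m) :
    hm.act (monomial m 1) (gen (.b γ)) - hm.act (reduce γ (monomial m 1)) (gen (.b γ)) ∈
      filt gen (Finsupp.weight vwt m) := by
  have hadd : ∀ (p q : VertexPoly n) (d e : ℕ), (∀ (c : ℕ) (x : A), x ∈ filt gen c →
      hm.act p x ∈ filt gen (c + d)) →
      (∀ (c : ℕ) (x : A), x ∈ filt gen c → hm.act (reduce γ q) x ∈ filt gen (c + e)) →
      hm.act p (gen (.b γ)) - hm.act (reduce γ p) (gen (.b γ)) ∈ filt gen d →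
      hm.act q (gen (.b γ)) - hm.act (reduce γ q) (gen (.b γ)) ∈ filt gen e →
      hm.act (p * q) (gen (.b γ)) - hm.act (reduce γ (p * q)) (gen (.b γ)) ∈
        filt gen (d + e) := by
    intro p q d e hp hq h1 h2
    have h3 := hp _ _ h2
    have h4 := hq _ _ h1
    rw [add_comm e d] at h3
    convert add_mem h3 h4 using 1
    have h5 : hm.act (reduce γ q) (hm.act p (gen (.b γ))) =
        hm.act p (hm.act (reduce γ q) (gen (.b γ))) := by
      rw [← hm.act_mul_apply, mul_comm, hm.act_mul_apply]
    have h6 : hm.act (reduce γ (p * q)) (gen (.b γ)) =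
        hm.act (reduce γ q) (hm.act (reduce γ p) (gen (.b γ))) := by
      rw [map_mul, mul_comm, hm.act_mul_apply]
    rw [map_sub, map_sub, hm.act_mul_apply, h5, h6]
    abel
  induction m using Finsupp.induction_linear with
  | zero => simp
  | add f g hf hg =>
    have : (monomial (f + g) (1 : ℂ) : VertexPoly n) = monomial f 1 * monomial g 1 := by
      rw [monomial_mul, one_mul]
    rw [this, map_add]
    exact hadd _ _ _ _ (fun c x hx => hm.act_monomial_mem f hx)
      (fun c x hx => hm.act_mem (isWeightedHomogeneous_reduce_monomial γ g) hx) hf hg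
  | single v k =>
    rw [Finsupp.weight_single, ← X_pow_eq_monomial]
    induction k with
    | zero => simp
    | succ k ih =>
      rw [pow_succ, add_smul, one_smul]
      refine hadd _ _ _ _ (fun c x hx => ?_) (fun c x hx => ?_) ih (hm.act_X_sub_reduce γ v)
      · exact hm.act_mem ((isWeightedHomogeneous_X ℂ vwt v).pow k) hx
      · exact hm.act_mem (isWeightedHomogeneous_reduce_X γ v) hx

theorem act_sub_reduce {p : VertexPoly n} {e : ℕ} (hp : IsWeightedHomogeneous vwt p e)
    (γ : BrauerDiagram n) :
    hm.act p (gen (.b γ)) - hm.act (reduce γ p) (gen (.b γ)) ∈ filt gen e :=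
  hp.map_mem ((LinearMap.applyₗ (gen (.b γ))).comp
    (hm.act.toLinearMap - (hm.act.comp (reduce γ)).toLinearMap)) _ fun m hmd => by
      rw [← hmd]; exact hm.act_monomial_sub_reduce γ m

/-! ### Leading parts are combinations of diagrams with polynomial coefficients -/

/-- Moving an element past a monomial, up to terms of lower degree. -/
theorem mul_act_monomial {B : A} (s : (Fin n ⊕ Fin n) ⊕ ℕ → (Fin n ⊕ Fin n) ⊕ ℕ)
    (hs : ∀ v, vwt (s v) = vwt v) (good : Set ((Fin n ⊕ Fin n) ⊕ ℕ))
    (hB : ∀ v ∈ good, ∃ D ∈ filt gen (vwt v), ∀ x,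
      B * vop gen v x - vop gen (s v) (B * x) = D * x) (m : (Fin n ⊕ Fin n) ⊕ ℕ →₀ ℕ) :
    (∀ v, m v ≠ 0 → v ∈ good) → ∀ {e : ℕ} {x : A}, x ∈ filt gen (e + 1) →
      B * hm.act (monomial m 1) x - hm.act (rename s (monomial m 1)) (B * x) ∈
        filt gen (e + Finsupp.weight vwt m) := by
  have hadd : ∀ (p q : VertexPoly n) (d e : ℕ),
      (∀ (c : ℕ) (x : A), x ∈ filt gen c → hm.act q x ∈ filt gen (c + e)) →
      (∀ (c : ℕ) (x : A), x ∈ filt gen c → hm.act (rename s p) x ∈ filt gen (c + d)) →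
      (∀ (c : ℕ) (x : A), x ∈ filt gen (c + 1) →
        B * hm.act p x - hm.act (rename s p) (B * x) ∈ filt gen (c + d)) →
      (∀ (c : ℕ) (x : A), x ∈ filt gen (c + 1) →
        B * hm.act q x - hm.act (rename s q) (B * x) ∈ filt gen (c + e)) →
      ∀ (c : ℕ) (x : A), x ∈ filt gen (c + 1) →
        B * hm.act (p * q) x - hm.act (rename s (p * q)) (B * x) ∈ filt gen (c + (d + e)) := by
    intro p q d e hq hp h1 h2 c x hx
    have h3 := h1 (c + e) (hm.act q x) (by have := hq _ x hx; convert this using 2; omega)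
    have h4 := hp _ _ (h2 c x hx)
    rw [add_assoc, add_comm e d] at h3 h4
    convert add_mem h3 h4 using 1
    rw [map_sub, hm.act_mul_apply, map_mul (rename s), hm.act_mul_apply]
    abel
  have hren : ∀ v k, IsWeightedHomogeneous vwt (rename s (X v ^ k) : VertexPoly n) (k • vwt v) := by
    intro v k
    rw [map_pow, rename_X, ← hs]
    exact (isWeightedHomogeneous_X ℂ vwt (s v)).pow k
  have hren' : ∀ m : (Fin n ⊕ Fin n) ⊕ ℕ →₀ ℕ, IsWeightedHomogeneous vwt
      (rename s (monomial m 1) : VertexPoly n) (Finsupp.weight vwt m) := by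
    intro m
    induction m using Finsupp.induction_linear with
    | zero => simpa using isWeightedHomogeneous_one ℂ vwt
    | add f g hf hg =>
      have : (monomial (f + g) (1 : ℂ) : VertexPoly n) = monomial f 1 * monomial g 1 := by
        rw [monomial_mul, one_mul]
      rw [this, map_mul, map_add]
      exact hf.mul hg
    | single v k =>
      rw [Finsupp.weight_single, ← X_pow_eq_monomial]
      exact hren v k
  induction m using Finsupp.induction_linear with
  | zero => intro _ e x _; simp
  | add f g hf hg =>
    intro hgood e x hx
    have : (monomial (f + g) (1 : ℂ) : VertexPoly n) = monomial f 1 * monomial g 1 := by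
      rw [monomial_mul, one_mul]
    rw [this, map_add]
    refine hadd _ _ _ _ (fun c x hx => hm.act_monomial_mem g hx)
      (fun c x hx => hm.act_mem (hren' f) hx)
      (fun c x hx => hf (fun v hv => hgood v ?_) hx)
      (fun c x hx => hg (fun v hv => hgood v ?_) hx) e x hx <;>
    · rw [Finsupp.add_apply]; omega
  | single v k =>
    intro hgood
    have key : ∀ (e : ℕ) (x : A), x ∈ filt gen (e + 1) → B * hm.act (X v ^ k) x -
        hm.act (rename s (X v ^ k)) (B * x) ∈ filt gen (e + k • vwt v) := by
      rcases k with _ | k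
      · intro e x _; simp
      have hv : v ∈ good := hgood v (by simp)
      clear hgood
      obtain ⟨D, hD, hBv⟩ := hB v hv
      have hone : ∀ (e : ℕ) (x : A), x ∈ filt gen (e + 1) → B * hm.act (X v) x -
          hm.act (rename s (X v)) (B * x) ∈ filt gen (e + vwt v) := by
        intro e x hx
        rw [rename_X, hm.act_X, hm.act_X, hBv]
        exact mul_mem_filt (by omega) hD hx
      induction k with
      | zero => simpa using hone
      | succ k ih =>
        rw [pow_succ, add_smul, one_smul]
        refine hadd _ _ _ _ (fun c x hx => ?_) (fun c x hx => ?_) ih hone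
        · exact hm.act_mem (isWeightedHomogeneous_X ℂ vwt v) hx
        · exact hm.act_mem (hren v (k + 1)) hx
    intro e x hx
    rw [Finsupp.weight_single, ← X_pow_eq_monomial]
    exact key e x hx

/-- The elements whose part of degree `e` is a combination of diagrams with polynomial
coefficients. -/
def regular (e : ℕ) : Submodule ℂ A :=
  Submodule.span ℂ {u | ∃ (γ : BrauerDiagram n) (p : VertexPoly n),
    IsWeightedHomogeneous vwt p e ∧ u = hm.act p (gen (.b γ))} ⊔ filt gen e

theorem act_b_mem_regular (γ : BrauerDiagram n) {p : VertexPoly n} {e : ℕ}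
    (hp : IsWeightedHomogeneous vwt p e) : hm.act p (gen (.b γ)) ∈ hm.regular e :=
  Submodule.mem_sup_left (Submodule.subset_span ⟨γ, p, hp, rfl⟩)

theorem filt_le_regular (e : ℕ) : filt gen e ≤ hm.regular e := le_sup_right

theorem regular_induction {e : ℕ} {f : A →ₗ[ℂ] A} {W : Submodule ℂ A}
    (h1 : ∀ γ p, IsWeightedHomogeneous vwt p e → f (hm.act p (gen (.b γ))) ∈ W)
    (h2 : ∀ x ∈ filt gen e, f x ∈ W) {x : A} (hx : x ∈ hm.regular e) : f x ∈ W := by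
  have : hm.regular e ≤ W.comap f := by
    refine sup_le (Submodule.span_le.2 ?_) h2
    rintro _ ⟨γ, p, hp, rfl⟩
    exact h1 γ p hp
  exact this hx

theorem act_mem_regular {q : VertexPoly n} {d e : ℕ} (hq : IsWeightedHomogeneous vwt q d) {x : A}
    (hx : x ∈ hm.regular e) : hm.act q x ∈ hm.regular (e + d) := by
  refine hm.regular_induction (fun γ p hp => ?_) (fun x hx => ?_) hx
  · rw [← hm.act_mul_apply, add_comm]
    exact hm.act_b_mem_regular γ (hq.mul hp)
  · exact hm.filt_le_regular _ (hm.act_mem hq hx)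

theorem regular_of_sub_mem {x z : A} {e : ℕ} (hz : z ∈ hm.regular e) (h : x - z ∈ filt gen e) :
    x ∈ hm.regular e := by
  rw [← sub_add_cancel x z]
  exact add_mem (hm.filt_le_regular e h) hz

/-- For even `i` this is multiplication by a variable. For odd `i` every term of the recursion has
degree `i - 1`, so `w i` contributes nothing to the leading part. -/
theorem w_mul_mem_regular (i : ℕ) {e : ℕ} {x : A} (hx : x ∈ hm.regular e) :
    gen (.w i) * x ∈ hm.regular (e + i) := by
  rcases Nat.even_or_odd' i with ⟨j, rfl | rfl⟩
  · have := hm.act_mem_regular (isWeightedHomogeneous_X ℂ vwt (Sum.inr j)) hx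
    rwa [hm.act_X] at this
  · have hw : gen (.w (2 * j + 1)) ∈ filt gen (2 * j + 1) := by
      have h : (-2 : ℂ) • gen (.w (2 * j + 1)) ∈ filt gen (2 * j + 1) := by
        rw [hm.w_odd _ ⟨j, rfl⟩]
        refine add_mem (gen_mem_filt _ (by simp [wt])) (Submodule.sum_mem _ fun l hl => ?_)
        rw [Finset.mem_Icc] at hl
        have h1 : gen (.w (2 * j + 1 - l)) * gen (.w (l - 1)) ∈ filt gen (2 * j + 1) :=
          mul_mem_filt (by simp only [wt]; omega)
            (gen_mem_filt (.w (2 * j + 1 - l)) (Nat.lt_succ_self _))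
            (gen_mem_filt (.w (l - 1)) (Nat.lt_succ_self _))
        rcases neg_one_pow_eq_or A l with h | h <;> rw [h]
        · rwa [one_mul]
        · rw [neg_one_mul]; exact neg_mem h1
      have := Submodule.smul_mem _ (-2 : ℂ)⁻¹ h
      rwa [smul_smul, inv_mul_cancel₀ (by norm_num), one_smul] at this
    have hle : hm.regular e ≤ filt gen (e + 1) := by
      refine sup_le (Submodule.span_le.2 ?_) (filt_mono (by omega))
      rintro _ ⟨γ, p, hp, rfl⟩
      rw [add_comm]
      exact hm.act_mem hp (b_mem_filt γ)
    exact hm.filt_le_regular _ (mul_mem_filt (by omega) hw (hle hx))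

theorem b_perm_mul_mem_regular (s : Equiv.Perm (Fin n)) {e : ℕ} {x : A}
    (hx : x ∈ hm.regular e) : gen (.b (.ofPerm s)) * x ∈ hm.regular e := by
  refine hm.regular_induction (f := LinearMap.mulLeft ℂ (gen (.b (.ofPerm s))))
    (fun γ p hp => ?_) (fun x hx => ?_) hx
  · refine hp.map_mem ((LinearMap.mulLeft ℂ (gen (.b (.ofPerm s)))).comp
      ((LinearMap.applyₗ (gen (.b γ))).comp hm.act.toLinearMap)) _ fun m hmd => ?_
    let t : (Fin n ⊕ Fin n) ⊕ ℕ → (Fin n ⊕ Fin n) ⊕ ℕ := Sum.map (Sum.map s id) id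
    have ht : ∀ v, vwt (t v) = vwt v := by rintro (v | v) <;> rfl
    have key := hm.mul_act_monomial (B := gen (.b (.ofPerm s))) t ht Set.univ ?_ m
      (fun _ _ => trivial) (e := 0) (b_mem_filt γ)
    · rw [zero_add, hmd, hm.b_perm_mul] at key
      refine hm.regular_of_sub_mem (hm.act_b_mem_regular _ ?_) key
      rw [← hmd, rename_monomial]
      refine isWeightedHomogeneous_monomial _ _ _ ?_
      rw [Finsupp.weight_apply, Finsupp.weight_apply, Finsupp.sum_mapDomain_index] <;>
        simp [ht, add_mul]
    · rintro ((k | k) | i) -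
      · exact ⟨_, hm.perm_y s k, fun x => by
          simp only [vop, t, LinearMap.mulLeft_apply, Sum.map_inl]; noncomm_ring⟩
      · exact ⟨0, zero_mem _, fun x => by
          simp only [vop, t, LinearMap.mulRight_apply, Sum.map_inl, Sum.map_inr, id]; noncomm_ring⟩
      · refine ⟨0, zero_mem _, fun x => ?_⟩
        simp only [vop, t, LinearMap.mulLeft_apply, Sum.map_inr, id]
        rw [← mul_assoc, ← mul_assoc, hm.w_central]; simp
  · exact hm.filt_le_regular _ (mul_mem_filt_left (b_mem_filt _) hx)

end IsAffineBrauerModel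

namespace IsAffineBrauerModel

open AffineBrauerGen BrauerDiagram MvPolynomial

variable {n : ℕ} {A : Type*} [Ring A] [Algebra ℂ A] {gen : AffineBrauerGen n → A}
  (hm : IsAffineBrauerModel gen)

include hm

theorem slide_pow (γ : BrauerDiagram n) (u : Fin n ⊕ Fin n) (m : ℕ) :
    hm.act (X (Sum.inl u) ^ m) (gen (.b γ)) -
      edgeSign u (γ.mate u) ^ m • hm.act (X (Sum.inl (γ.mate u)) ^ m) (gen (.b γ)) ∈
        filt gen m := by
  induction m with
  | zero => simp
  | succ m ih =>
    have h1 := vop_mem_filt (Sum.inl u) ih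
    have h2 := Submodule.smul_mem _ (edgeSign u (γ.mate u) ^ m)
      (hm.act_mem ((isWeightedHomogeneous_X ℂ vwt (Sum.inl (γ.mate u))).pow m) (hm.slide γ u))
    have e1 : m + vwt (Sum.inl u : (Fin n ⊕ Fin n) ⊕ ℕ) = m + 1 := rfl
    have e2 : 1 + m • vwt (Sum.inl (γ.mate u) : (Fin n ⊕ Fin n) ⊕ ℕ) = m + 1 := by
      rw [show vwt (Sum.inl (γ.mate u) : (Fin n ⊕ Fin n) ⊕ ℕ) = 1 from rfl]; simp [add_comm]
    rw [e1] at h1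
    rw [e2] at h2
    convert add_mem h1 h2 using 1
    have h3 : ∀ x, vop gen (Sum.inl u) x = hm.act (X (Sum.inl u)) x := fun x => by rw [hm.act_X]
    have h4 : ∀ x, vop gen (Sum.inl (γ.mate u)) x = hm.act (X (Sum.inl (γ.mate u))) x :=
      fun x => by rw [hm.act_X]
    rw [h3, h3, h4]
    simp only [map_sub, map_smul, smul_sub, smul_smul]
    rw [← hm.act_mul_apply, ← hm.act_mul_apply, ← hm.act_mul_apply, ← hm.act_mul_apply,
      ← pow_succ', ← pow_succ, mul_comm (X _) (X (Sum.inl (γ.mate u)) ^ m), ← pow_succ]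
    abel

/-- Loops produce powers of `w 0`, and this variable has degree zero. -/
theorem bar_mul_b_mem_regular {p q : Fin n} (hpq : p ≠ q) (γ : BrauerDiagram n) :
    gen (.b (.bar p q hpq)) * gen (.b γ) ∈ hm.regular 0 := by
  rw [hm.b_mul]
  have h := hm.act_b_mem_regular (comp (bar p q hpq) γ)
    ((isWeightedHomogeneous_X ℂ vwt (Sum.inr 0)).pow (loops (bar p q hpq) γ))
  have e : loops (bar p q hpq) γ • vwt (Sum.inr 0 : (Fin n ⊕ Fin n) ⊕ ℕ) = 0 := by simp [vwt]
  rw [e, map_pow, hm.act_X] at h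
  simp only [vop, mul_zero] at h
  rwa [LinearMap.pow_mulLeft, LinearMap.mulLeft_apply] at h

theorem bar_mul_act_monomial {p q : Fin n} (hpq : p ≠ q) (m : (Fin n ⊕ Fin n) ⊕ ℕ →₀ ℕ)
    (h1 : m (Sum.inl (Sum.inl p)) = 0) (h2 : m (Sum.inl (Sum.inl q)) = 0) {e : ℕ} {x : A}
    (hx : x ∈ filt gen (e + 1)) :
    gen (.b (.bar p q hpq)) * hm.act (monomial m 1) x -
      hm.act (monomial m 1) (gen (.b (.bar p q hpq)) * x) ∈
        filt gen (e + Finsupp.weight vwt m) := by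
  have key := hm.mul_act_monomial (B := gen (.b (.bar p q hpq))) id (fun _ => rfl)
    {v | v ≠ Sum.inl (Sum.inl p) ∧ v ≠ Sum.inl (Sum.inl q)} ?_ m ?_ hx
  · rwa [rename_id_apply] at key
  · rintro ((k | k) | i) hv
    · refine ⟨_, (hm.bar_relations hpq).1 k (fun h => hv.1 (by rw [h]))
        (fun h => hv.2 (by rw [h])), fun x => ?_⟩
      simp only [vop, LinearMap.mulLeft_apply, id]; noncomm_ring
    · exact ⟨0, zero_mem _, fun x => by
        simp only [vop, LinearMap.mulRight_apply, id]; noncomm_ring⟩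
    · refine ⟨0, zero_mem _, fun x => ?_⟩
      simp only [vop, LinearMap.mulLeft_apply, id]
      rw [← mul_assoc, ← mul_assoc, hm.w_central]; simp
  · intro v hv
    exact ⟨fun h => hv (by rw [h, h1]), fun h => hv (by rw [h, h2])⟩

/-- If `γ` joins `p` and `q`, it splits off the same bar on top, and bar, power, bar collapses to `w
m` times the bar. Otherwise the power slides along the edge at `p` to a vertex other than the upper
`p` and `q`, where it no longer meets the bar. -/
theorem bar_mul_pow_b_mem_regular {p q : Fin n} (hpq : p ≠ q) (γ : BrauerDiagram n) (m : ℕ) :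
    gen (.b (.bar p q hpq)) * hm.act (X (Sum.inl (Sum.inl p)) ^ m) (gen (.b γ)) ∈
      hm.regular m := by
  rcases Nat.eq_zero_or_pos m with rfl | hm0
  · simpa using hm.bar_mul_b_mem_regular hpq γ
  have hB : gen (.b (.bar p q hpq)) ∈ filt gen 1 := b_mem_filt _
  have hX : ∀ u : Fin n ⊕ Fin n,
      IsWeightedHomogeneous vwt (X (Sum.inl u) ^ m : VertexPoly n) m := fun u => by
    simpa [vwt] using (isWeightedHomogeneous_X ℂ vwt (Sum.inl u)).pow m
  by_cases hq : γ.mate (Sum.inl p) = Sum.inl q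
  · obtain ⟨r, t, hr⟩ := exists_mate_inr_eq_inr hq
    have hprod := hm.b_mul_of_loops (comp_bar_relabel hpq hq hr)
    set γ' := relabel (Equiv.swap (Sum.inl q) (Sum.inr r)) γ
    have h1 := mul_mem_filt_right ((hm.bar_relations hpq).2.2.2 m hm0) (b_mem_filt (gen := gen) γ')
    rw [sub_mul, mul_assoc, mul_assoc, mul_assoc, hprod] at h1
    refine hm.regular_of_sub_mem (z := gen (.w m) * gen (.b γ)) ?_ ?_
    · have := hm.w_mul_mem_regular m (hm.act_b_mem_regular γ (isWeightedHomogeneous_one ℂ vwt))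
      simpa using this
    · rw [map_pow, hm.act_X]
      simp only [vop]
      rwa [LinearMap.pow_mulLeft, LinearMap.mulLeft_apply]
  · have h1 := mul_mem_filt_left hB (hm.slide_pow γ (Sum.inl p) m)
    rw [mul_sub, mul_smul_comm] at h1
    refine hm.regular_of_sub_mem (Submodule.smul_mem _ _ ?_) h1
    have h3 := hm.bar_mul_act_monomial hpq (Finsupp.single (Sum.inl (γ.mate (Sum.inl p))) m)
      (by rw [Finsupp.single_apply_eq_zero]
          exact fun h => absurd (Sum.inl_injective h).symm (γ.mate_ne _))
      (by rw [Finsupp.single_apply_eq_zero]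
          exact fun h => absurd (Sum.inl_injective h).symm hq)
      (e := 0) (b_mem_filt γ)
    rw [Finsupp.weight_single, ← X_pow_eq_monomial, zero_add,
      show m • vwt (Sum.inl (γ.mate (Sum.inl p)) : (Fin n ⊕ Fin n) ⊕ ℕ) = m by simp [vwt]] at h3
    refine hm.regular_of_sub_mem ?_ h3
    have := hm.act_mem_regular (hX (γ.mate (Sum.inl p))) (hm.bar_mul_b_mem_regular hpq γ)
    rwa [zero_add] at this

/-- Below the bar, `y q` may be traded for `- y p`, one factor at a time, until only powers of `y p`
remain. -/
theorem bar_mul_two_pow {p q : Fin n} (hpq : p ≠ q) (γ : BrauerDiagram n) (j : ℕ) : ∀ i : ℕ,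
    gen (.b (.bar p q hpq)) * hm.act (X (Sum.inl (Sum.inl p)) ^ i * X (Sum.inl (Sum.inl q)) ^ j)
      (gen (.b γ)) ∈ hm.regular (i + j) := by
  induction j with
  | zero => intro i; simpa using hm.bar_mul_pow_b_mem_regular hpq γ i
  | succ j ih =>
    intro i
    refine hm.regular_of_sub_mem (z := -(gen (.b (.bar p q hpq)) *
      hm.act (X (Sum.inl (Sum.inl p)) ^ (i + 1) * X (Sum.inl (Sum.inl q)) ^ j)
      (gen (.b γ)))) (neg_mem ?_) ?_
    · have := ih (i + 1)
      rwa [add_assoc, add_comm 1 j] at this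
    · have hpol : IsWeightedHomogeneous vwt (X (Sum.inl (Sum.inl p)) ^ i *
          X (Sum.inl (Sum.inl q)) ^ j : VertexPoly n) (i + j) := by
        simpa [vwt] using ((isWeightedHomogeneous_X ℂ vwt (Sum.inl (Sum.inl p))).pow i).mul
          ((isWeightedHomogeneous_X ℂ vwt (Sum.inl (Sum.inl q))).pow j)
      have h1 := mul_mem_filt_left (hm.bar_relations hpq).2.1
        (hm.act_mem hpol (b_mem_filt (gen := gen) γ))
      rw [add_comm 1, add_assoc] at h1
      convert h1 using 1
      have e1 : (X (Sum.inl (Sum.inl p)) ^ i * X (Sum.inl (Sum.inl q)) ^ (j + 1) : VertexPoly n) =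
          X (Sum.inl (Sum.inl q)) * (X (Sum.inl (Sum.inl p)) ^ i * X (Sum.inl (Sum.inl q)) ^ j) := by
        ring
      have e2 : (X (Sum.inl (Sum.inl p)) ^ (i + 1) * X (Sum.inl (Sum.inl q)) ^ j : VertexPoly n) =
          X (Sum.inl (Sum.inl p)) * (X (Sum.inl (Sum.inl p)) ^ i * X (Sum.inl (Sum.inl q)) ^ j) := by
        ring
      rw [e1, e2, hm.act_mul_apply (X _), hm.act_mul_apply (X _), hm.act_X, hm.act_X]
      simp only [vop, LinearMap.mulLeft_apply]
      noncomm_ring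

/-- In a monomial only the variables at the upper vertices `p` and `q` interact with the bar. The
remaining factor `m'` is moved out in front. -/
theorem bar_mul_mem_regular {p q : Fin n} (hpq : p ≠ q) {e : ℕ} {x : A}
    (hx : x ∈ hm.regular e) : gen (.b (.bar p q hpq)) * x ∈ hm.regular e := by
  classical
  refine hm.regular_induction (f := LinearMap.mulLeft ℂ (gen (.b (.bar p q hpq))))
    (fun γ f hf => ?_) (fun x hx => ?_) hx
  · refine hf.map_mem ((LinearMap.mulLeft ℂ (gen (.b (.bar p q hpq)))).comp
      ((LinearMap.applyₗ (gen (.b γ))).comp hm.act.toLinearMap)) _ fun m hmd => ?_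
    simp only [LinearMap.comp_apply, LinearMap.mulLeft_apply, LinearMap.applyₗ_apply_apply,
      AlgHom.toLinearMap_apply]
    set P : (Fin n ⊕ Fin n) ⊕ ℕ := Sum.inl (Sum.inl p) with hP
    set Q : (Fin n ⊕ Fin n) ⊕ ℕ := Sum.inl (Sum.inl q) with hQ
    have hPQ : P ≠ Q := fun h => hpq (Sum.inl_injective (Sum.inl_injective h))
    set m' := (m.erase P).erase Q with hm'
    have hsplit : m = m' + (Finsupp.single P (m P) + Finsupp.single Q (m Q)) := by
      ext v
      by_cases h1 : v = Q
      · subst h1; simp [hm', hPQ]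
      by_cases h2 : v = P
      · subst h2; simp [hm', h1]
      · simp [hm', Finsupp.erase_ne h1, Finsupp.erase_ne h2, h1, h2]
    have hmon : (monomial m 1 : VertexPoly n) =
        monomial m' 1 * (X P ^ m P * X Q ^ m Q) := by
      conv_lhs => rw [hsplit]
      rw [X_pow_eq_monomial, X_pow_eq_monomial, monomial_mul, monomial_mul]; simp
    have hwt : e = (m P + m Q) + Finsupp.weight vwt m' := by
      rw [← hmd]
      conv_lhs => rw [hsplit]
      rw [map_add, map_add, Finsupp.weight_single, Finsupp.weight_single]
      simp [hP, hQ, vwt]; ring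
    rw [hmon, hm.act_mul_apply, hwt]
    have hpol : IsWeightedHomogeneous vwt (X P ^ m P * X Q ^ m Q : VertexPoly n) (m P + m Q) := by
      simpa [vwt, hP, hQ] using ((isWeightedHomogeneous_X ℂ vwt P).pow (m P)).mul
          ((isWeightedHomogeneous_X ℂ vwt Q).pow (m Q))
    have hx : hm.act (X P ^ m P * X Q ^ m Q) (gen (.b γ)) ∈ filt gen (m P + m Q + 1) := by
      rw [add_comm _ 1]; exact hm.act_mem hpol (b_mem_filt γ)
    refine hm.regular_of_sub_mem ?_ (hm.bar_mul_act_monomial hpq m' ?_ ?_ hx)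
    · exact hm.act_mem_regular (isWeightedHomogeneous_monomial _ _ _ rfl)
        (hm.bar_mul_two_pow hpq γ _ _)
    · change m' P = 0
      rw [hm', Finsupp.erase_ne hPQ, Finsupp.erase_same]
    · change m' Q = 0
      rw [hm', Finsupp.erase_same]
  · exact hm.filt_le_regular _ (mul_mem_filt_left (b_mem_filt _) hx)

theorem b_mul_mem_regular (γ : BrauerDiagram n) : ∀ {e : ℕ} {x : A},
    x ∈ hm.regular e → gen (.b γ) * x ∈ hm.regular e := by
  induction γ using BrauerDiagram.induction_bar with
  | perm s => exact fun hx => hm.b_perm_mul_mem_regular s hx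
  | step γ p q r t hpq hp hr ih =>
    intro e x hx
    rw [← hm.b_mul_of_loops (comp_bar_relabel hpq hp hr), mul_assoc]
    exact hm.bar_mul_mem_regular hpq (ih hx)

/-- By induction on the length of a word: each generator, put in front, preserves the `regular` form
and raises the degree by its weight. -/
theorem filt_succ_le_regular (e : ℕ) : filt gen (e + 1) ≤ hm.regular e := by
  refine Submodule.span_le.2 ?_
  have hword : ∀ l : List (AffineBrauerGen n), (l.map gen).prod ∈ hm.regular (l.map wt).sum := by
    intro l
    induction l with
    | nil =>
      have := hm.act_b_mem_regular (ofPerm 1) (isWeightedHomogeneous_one ℂ vwt)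
      simpa [hm.b_one] using this
    | cons g l ih =>
      rw [List.map_cons, List.map_cons, List.prod_cons, List.sum_cons, add_comm]
      rcases g with γ | k | i
      · exact hm.b_mul_mem_regular γ ih
      · have := hm.act_mem_regular (isWeightedHomogeneous_X ℂ vwt (Sum.inl (Sum.inl k))) ih
        rwa [hm.act_X] at this
      · exact hm.w_mul_mem_regular i ih
  rintro _ ⟨l, hl, rfl⟩
  rcases Nat.lt_succ_iff_lt_or_eq.1 hl with h | h
  · exact hm.filt_le_regular e (Submodule.subset_span ⟨l, h, rfl⟩)
  · rw [← h]; exact hword l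

/-- Modulo terms of lower degree, every element of degree `e` is a combination of diagrams with
polynomial coefficients. -/
theorem exists_sub_sum_mem {e : ℕ} {x : A} (hx : x ∈ filt gen (e + 1)) :
    ∃ p : BrauerDiagram n → VertexPoly n, (∀ γ, IsWeightedHomogeneous vwt (p γ) e) ∧
      x - ∑ γ, hm.act (p γ) (gen (.b γ)) ∈ filt gen e := by
  classical
  obtain ⟨u, hu, z, hz, rfl⟩ := Submodule.mem_sup.1 (hm.filt_succ_le_regular e hx)
  suffices H : ∃ p : BrauerDiagram n → VertexPoly n, (∀ γ, IsWeightedHomogeneous vwt (p γ) e) ∧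
      u = ∑ γ, hm.act (p γ) (gen (.b γ)) by
    obtain ⟨p, hp, rfl⟩ := H
    exact ⟨p, hp, by simpa using hz⟩
  clear hx
  induction hu using Submodule.span_induction with
  | mem u hu =>
    obtain ⟨γ, p, hp, rfl⟩ := hu
    refine ⟨fun γ' => if γ' = γ then p else 0, fun γ' => ?_, ?_⟩
    · dsimp only
      split_ifs
      · exact hp
      · exact isWeightedHomogeneous_zero ℂ vwt e
    · rw [Finset.sum_eq_single γ] <;> simp +contextual
  | zero => exact ⟨0, fun γ => isWeightedHomogeneous_zero ℂ vwt e, by simp⟩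
  | add u v _ _ hu hv =>
    obtain ⟨p, hp, rfl⟩ := hu
    obtain ⟨q, hq, rfl⟩ := hv
    exact ⟨p + q, fun γ => (hp γ).add (hq γ), by simp [Finset.sum_add_distrib]⟩
  | smul r u _ hu =>
    obtain ⟨p, hp, rfl⟩ := hu
    refine ⟨r • p, fun γ => ?_, by simp [Finset.smul_sum]⟩
    rw [Pi.smul_apply, smul_eq_C_mul]
    exact (hp γ).C_mul r

end IsAffineBrauerModel

/-! ### Brauer diagrams, matrices and Casimir operators on tensors -/

namespace TensorModel

open BrauerDiagram

variable {n : ℕ} {I : Type*} [Fintype I] [DecidableEq I] {M : Type*} [AddCommGroup M] [Module ℂ M]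

open Classical in
/-- The action of a Brauer diagram on tensors with entries in `M`. -/
noncomputable def brauerOp (γ : BrauerDiagram n) : Module.End ℂ ((Fin n → I) → M) where
  toFun φ f := ∑ g, if γ.Compat (Sum.elim f g) then φ g else 0
  map_add' φ ψ := by
    funext f
    simp only [Pi.add_apply, ← Finset.sum_add_distrib]
    exact Finset.sum_congr rfl fun g _ => by split_ifs <;> simp
  map_smul' r φ := by
    funext f
    simp only [Pi.smul_apply, Finset.smul_sum, RingHom.id_apply, smul_ite, smul_zero]

open Classical in
theorem brauerOp_apply (γ : BrauerDiagram n) (φ : (Fin n → I) → M) (f) :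
    brauerOp γ φ f = ∑ g, if γ.Compat (Sum.elim f g) then φ g else 0 := rfl

/-- The matrix product counts the colourings of the middle row, which `card_compat` evaluates. The
parameter is therefore the number of colours. -/
theorem brauerOp_mul (γ γ' : BrauerDiagram n) :
    (brauerOp γ * brauerOp γ' : Module.End ℂ ((Fin n → I) → M)) =
      (Fintype.card I : ℂ) ^ loops γ γ' • brauerOp (comp γ γ') := by
  classical
  refine LinearMap.ext fun φ => ?_
  funext f
  rw [Module.End.mul_apply, brauerOp_apply, LinearMap.smul_apply, Pi.smul_apply, brauerOp_apply,
    Finset.smul_sum]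
  simp only [brauerOp_apply]
  have h1 : ∀ g, (if γ.Compat (Sum.elim f g) then
      ∑ h, (if γ'.Compat (Sum.elim g h) then φ h else 0) else 0) =
      ∑ h, if γ.Compat (Sum.elim f g) ∧ γ'.Compat (Sum.elim g h) then φ h else 0 := by
    intro g
    by_cases h : γ.Compat (Sum.elim f g) <;> simp [h]
  rw [Finset.sum_congr rfl fun g _ => h1 g, Finset.sum_comm]
  refine Finset.sum_congr rfl fun h _ => ?_
  rw [← Finset.sum_filter, Finset.sum_const, ← Fintype.card_subtype, card_compat]
  split_ifs
  · rw [← Nat.cast_smul_eq_nsmul ℂ, Nat.cast_pow]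
  · simp

/-- The exchange of the slots `k` and `l`. -/
def permOp (s : Equiv.Perm (Fin n)) : Module.End ℂ ((Fin n → I) → M) where
  toFun φ f := φ (f ∘ s)
  map_add' _ _ := rfl
  map_smul' _ _ := rfl

theorem permOp_apply (s : Equiv.Perm (Fin n)) (φ : (Fin n → I) → M) (f) :
    permOp s φ f = φ (f ∘ s) := rfl

theorem permOp_mul (s t : Equiv.Perm (Fin n)) :
    (permOp s * permOp t : Module.End ℂ ((Fin n → I) → M)) = permOp (s * t) := rfl

theorem permOp_one : (permOp 1 : Module.End ℂ ((Fin n → I) → M)) = 1 := rfl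

theorem brauerOp_ofPerm (s : Equiv.Perm (Fin n)) :
    (brauerOp (ofPerm s) : Module.End ℂ ((Fin n → I) → M)) = permOp s := by
  classical
  refine LinearMap.ext fun φ => ?_
  funext f
  simp [brauerOp_apply, compat_ofPerm, permOp_apply]

/-- The tensor `f` with the entries `i` and `j` in the slots `k` and `l`. -/
def upd (f : Fin n → I) (k l : Fin n) (i j : I) : Fin n → I :=
  Function.update (Function.update f k i) l j

/-- The contraction of the slots `k` and `l`, followed by the insertion of the metric. -/
def contrOp (k l : Fin n) : Module.End ℂ ((Fin n → I) → M) where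
  toFun φ f := if f k = f l then ∑ i, φ (upd f k l i i) else 0
  map_add' φ ψ := by
    funext f
    simp only [Pi.add_apply, Finset.sum_add_distrib]
    split_ifs <;> simp
  map_smul' r φ := by
    funext f
    simp only [Pi.smul_apply, ← Finset.smul_sum]
    split_ifs <;> simp

theorem contrOp_apply (k l : Fin n) (φ : (Fin n → I) → M) (f) :
    contrOp k l φ f = if f k = f l then ∑ i, φ (upd f k l i i) else 0 := rfl

theorem brauerOp_bar {k l : Fin n} (h : k ≠ l) :
    (brauerOp (bar k l h) : Module.End ℂ ((Fin n → I) → M)) = contrOp k l := by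
  classical
  refine LinearMap.ext fun φ => ?_
  funext f
  simp only [brauerOp_apply, compat_bar, contrOp_apply]
  split_ifs with hf
  · rw [← Finset.sum_filter]
    symm
    refine Finset.sum_bij (fun i _ => upd f k l i i) (fun i _ => ?_) (fun i _ j _ hij => ?_)
      (fun g hg => ?_) (fun i _ => rfl)
    · simp only [Finset.mem_filter, Finset.mem_univ, true_and]
      refine ⟨hf, by simp [upd, h], fun m h1 h2 => by simp [upd, h1, h2]⟩
    · have := congrFun hij l
      simpa [upd] using this
    · simp only [Finset.mem_filter, Finset.mem_univ, true_and] at hg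
      refine ⟨g k, Finset.mem_univ _, ?_⟩
      funext m
      by_cases h2 : m = l
      · subst h2; simp [upd, hg.2.1]
      by_cases h1 : m = k
      · subst h1; simp [upd, h]
      · simp [upd, h1, h2, hg.2.2 m h1 h2]
  · exact Finset.sum_eq_zero fun g _ => if_neg fun h => hf h.1

/-- A matrix of operators on `M` acting in the slot `k`. -/
def slotOp (k : Fin n) (H : Matrix I I (Module.End ℂ M)) :
    Module.End ℂ ((Fin n → I) → M) where
  toFun φ f := ∑ i, H (f k) i (φ (Function.update f k i))
  map_add' φ ψ := by
    funext f
    simp only [Pi.add_apply, map_add, Finset.sum_add_distrib]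
  map_smul' r φ := by
    funext f
    simp only [Pi.smul_apply, map_smul, Finset.smul_sum, RingHom.id_apply]

theorem slotOp_apply (k : Fin n) (H : Matrix I I (Module.End ℂ M)) (φ : (Fin n → I) → M) (f) :
    slotOp k H φ f = ∑ i, H (f k) i (φ (Function.update f k i)) := rfl

theorem slotOp_mul (k : Fin n) (H H' : Matrix I I (Module.End ℂ M)) :
    slotOp k (H * H') = slotOp k H * slotOp k H' := by
  refine LinearMap.ext fun φ => ?_
  funext f
  simp only [slotOp_apply, Module.End.mul_apply, Matrix.mul_apply, LinearMap.sum_apply,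
    Function.update_self, Function.update_idem, map_sum]
  exact Finset.sum_comm

theorem slotOp_one (k : Fin n) : slotOp k (1 : Matrix I I (Module.End ℂ M)) = 1 := by
  refine LinearMap.ext fun φ => ?_
  funext f
  simp only [slotOp_apply, Matrix.one_apply]
  rw [Finset.sum_eq_single (f k)]
  · simp
  · intro i _ hi; simp [Ne.symm hi]
  · simp

theorem slotOp_add (k : Fin n) (H H' : Matrix I I (Module.End ℂ M)) :
    slotOp k (H + H') = slotOp k H + slotOp k H' := by
  refine LinearMap.ext fun φ => ?_
  funext f
  simp [slotOp_apply, Finset.sum_add_distrib]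

theorem slotOp_smul (k : Fin n) (r : ℂ) (H : Matrix I I (Module.End ℂ M)) :
    slotOp k (r • H) = r • slotOp k H := by
  refine LinearMap.ext fun φ => ?_
  funext f
  simp [slotOp_apply, Finset.smul_sum]

theorem slotOp_pow (k : Fin n) (H : Matrix I I (Module.End ℂ M)) (m : ℕ) :
    slotOp k (H ^ m) = slotOp k H ^ m := by
  induction m with
  | zero => simp [slotOp_one]
  | succ m ih => rw [pow_succ, pow_succ, slotOp_mul, ih]

/-- An operator on `M` acting on the entries of tensors. -/
def entryOp (T : Module.End ℂ M) : Module.End ℂ ((Fin n → I) → M) where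
  toFun φ f := T (φ f)
  map_add' φ ψ := by funext f; simp
  map_smul' r φ := by funext f; simp

theorem entryOp_apply (T : Module.End ℂ M) (φ : (Fin n → I) → M) (f) :
    entryOp T φ f = T (φ f) := rfl

theorem entryOp_mul_brauerOp (T : Module.End ℂ M) (γ : BrauerDiagram n) :
    (entryOp T * brauerOp γ : Module.End ℂ ((Fin n → I) → M)) = brauerOp γ * entryOp T := by
  refine LinearMap.ext fun φ => ?_
  funext f
  simp only [Module.End.mul_apply, entryOp_apply, brauerOp_apply, map_sum]
  exact Finset.sum_congr rfl fun g _ => by split_ifs <;> simp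

theorem entryOp_mul_slotOp (T : Module.End ℂ M) (k : Fin n) (H : Matrix I I (Module.End ℂ M))
    (h : ∀ i j, T * H i j = H i j * T) :
    (entryOp T * slotOp k H : Module.End ℂ ((Fin n → I) → M)) = slotOp k H * entryOp T := by
  refine LinearMap.ext fun φ => ?_
  funext f
  simp only [Module.End.mul_apply, entryOp_apply, slotOp_apply, map_sum]
  exact Finset.sum_congr rfl fun i _ => LinearMap.congr_fun (h _ _) _

/-- The matrix is enclosed between two contractions and closes up to a trace. This is why the `w i`
act as traces of powers. -/
theorem contr_slot_contr {k l : Fin n} (h : k ≠ l) (H : Matrix I I (Module.End ℂ M)) :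
    (contrOp k l * slotOp k H * contrOp k l : Module.End ℂ ((Fin n → I) → M)) =
      entryOp H.trace * contrOp k l := by
  refine LinearMap.ext fun φ => ?_
  funext f
  simp only [Module.End.mul_apply, entryOp_apply, slotOp_apply, contrOp_apply]
  split_ifs with hf
  · rw [Matrix.trace, LinearMap.sum_apply]
    refine Finset.sum_congr rfl fun i _ => ?_
    rw [Finset.sum_eq_single i]
    · simp only [upd, h, Function.update_self, ne_eq, not_false_eq_true,
        Function.update_of_ne, Ne.symm h, if_true, Matrix.diag]
      congr 1
      refine Finset.sum_congr rfl fun j _ => ?_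
      congr 1
      funext m
      by_cases h2 : m = l
      · subst h2; simp
      by_cases h1 : m = k
      · subst h1; simp [h]
      · simp [h1, h2]
    · intro j _ hj
      simp [upd, h, Ne.symm h, hj]
    · simp
  · simp

theorem permOp_mul_slotOp (s : Equiv.Perm (Fin n)) (k : Fin n)
    (H : Matrix I I (Module.End ℂ M)) :
    (permOp s * slotOp k H : Module.End ℂ ((Fin n → I) → M)) = slotOp (s k) H * permOp s := by
  refine LinearMap.ext fun φ => ?_
  funext f
  simp only [Module.End.mul_apply, slotOp_apply, permOp_apply, Function.comp_apply]
  refine Finset.sum_congr rfl fun i _ => ?_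
  rw [Function.update_comp_eq_of_injective _ s.injective]

theorem permOp_mul_contrOp (s : Equiv.Perm (Fin n)) (k l : Fin n) :
    (permOp s * contrOp k l : Module.End ℂ ((Fin n → I) → M)) =
      contrOp (s k) (s l) * permOp s := by
  refine LinearMap.ext fun φ => ?_
  funext f
  simp only [Module.End.mul_apply, contrOp_apply, permOp_apply, Function.comp_apply]
  congr 1
  refine Finset.sum_congr rfl fun i _ => ?_
  simp only [upd]
  rw [Function.update_comp_eq_of_injective _ s.injective,
    Function.update_comp_eq_of_injective _ s.injective]

theorem contrOp_symm (k l : Fin n) :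
    (contrOp k l : Module.End ℂ ((Fin n → I) → M)) = contrOp l k := by
  refine LinearMap.ext fun φ => ?_
  funext f
  simp only [contrOp_apply, eq_comm (a := f k)]
  congr 1
  refine Finset.sum_congr rfl fun i _ => ?_
  congr 1
  funext m
  simp only [upd, Function.update_apply]
  split_ifs <;> rfl

/-- Matrices of operators in different slots act independently of contractions. -/
theorem contrOp_mul_slotOp {k l m : Fin n} (h1 : m ≠ k) (h2 : m ≠ l)
    (H : Matrix I I (Module.End ℂ M)) :
    (contrOp k l * slotOp m H : Module.End ℂ ((Fin n → I) → M)) = slotOp m H * contrOp k l := by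
  refine LinearMap.ext fun φ => ?_
  funext f
  simp only [Module.End.mul_apply, contrOp_apply, slotOp_apply]
  simp only [Function.update_of_ne h1.symm, Function.update_of_ne h2.symm]
  split_ifs with hf
  · simp only [map_sum]
    rw [Finset.sum_comm]
    refine Finset.sum_congr rfl fun i _ => Finset.sum_congr rfl fun j _ => ?_
    have e1 : upd f k l j j m = f m := by simp [upd, h1, h2]
    have e2 : Function.update (upd f k l j j) m i = upd (Function.update f m i) k l j j := by
      funext x
      simp only [upd, Function.update_apply]
      split_ifs <;> simp_all
    rw [e1, e2]
  · simp

theorem contrOp_comm {k l m r : Fin n} (h1 : m ≠ k) (h2 : m ≠ l) (h3 : r ≠ k) (h4 : r ≠ l) :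
    (contrOp k l * contrOp m r : Module.End ℂ ((Fin n → I) → M)) =
      contrOp m r * contrOp k l := by
  refine LinearMap.ext fun φ => ?_
  funext f
  simp only [Module.End.mul_apply, contrOp_apply]
  have e1 : ∀ i, upd f k l i i m = f m := by simp [upd, h1, h2]
  have e2 : ∀ i, upd f k l i i r = f r := by simp [upd, h3, h4]
  have e3 : ∀ i, upd f m r i i k = f k := by simp [upd, h1.symm, h3.symm]
  have e4 : ∀ i, upd f m r i i l = f l := by simp [upd, h2.symm, h4.symm]
  have e5 : ∀ i j, upd (upd f k l i i) m r j j = upd (upd f m r j j) k l i i := by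
    intro i j
    funext x
    simp only [upd, Function.update_apply]
    split_ifs <;> simp_all
  simp only [e1, e2, e3, e4, e5]
  split_ifs
  · exact Finset.sum_comm
  · simp
  · simp
  · rfl

/-- In terms of diagrams: both products contain the bar on top and carry the slot `m` to the free
one of the slots below. -/
theorem contrOp_mul_swap {k l m : Fin n} (hkl : k ≠ l) (hkm : k ≠ m) (hlm : l ≠ m) :
    (contrOp k l * permOp (Equiv.swap k m) : Module.End ℂ ((Fin n → I) → M)) =
      contrOp k l * contrOp l m := by
  refine LinearMap.ext fun φ => ?_
  funext f
  simp only [Module.End.mul_apply, contrOp_apply, permOp_apply]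
  split_ifs with hf
  · have e1 : ∀ i, upd f k l i i l = i := by simp [upd]
    have e2 : ∀ i, upd f k l i i m = f m := by simp [upd, hkm.symm, hlm.symm]
    simp only [e1, e2, Finset.sum_ite_eq', Finset.mem_univ, if_true]
    refine Finset.sum_congr rfl fun i _ => ?_
    congr 1
    funext x
    simp only [upd, Function.update_apply, Function.comp_apply, Equiv.swap_apply_def]
    split_ifs <;> simp_all
  · rfl

theorem swap_mul_contrOp {k l m : Fin n} (hkl : k ≠ l) (hkm : k ≠ m) (hlm : l ≠ m) :
    (permOp (Equiv.swap k m) * contrOp k l : Module.End ℂ ((Fin n → I) → M)) =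
      contrOp l m * contrOp k l := by
  refine LinearMap.ext fun φ => ?_
  funext f
  simp only [Module.End.mul_apply, contrOp_apply, permOp_apply, Function.comp_apply,
    Equiv.swap_apply_left, Equiv.swap_apply_of_ne_of_ne hkl.symm hlm]
  by_cases hf : f l = f m
  · rw [if_pos hf, if_pos hf.symm]
    have e1 : ∀ i, upd f l m i i k = f k := by simp [upd, hkl, hkm]
    have e2 : ∀ i, upd f l m i i l = i := by simp [upd, hlm]
    simp only [e1, e2, Finset.sum_ite_eq, Finset.mem_univ, if_true]
    refine Finset.sum_congr rfl fun i _ => ?_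
    congr 1
    funext x
    simp only [upd, Function.update_apply, Function.comp_apply, Equiv.swap_apply_def]
    split_ifs <;> simp_all
  · rw [if_neg hf, if_neg (Ne.symm hf)]

theorem contrOp_mul_swap_self (k l : Fin n) :
    (contrOp k l * permOp (Equiv.swap k l) : Module.End ℂ ((Fin n → I) → M)) = contrOp k l := by
  refine LinearMap.ext fun φ => ?_
  funext f
  simp only [Module.End.mul_apply, contrOp_apply, permOp_apply]
  congr 1
  refine Finset.sum_congr rfl fun i _ => ?_
  congr 1
  funext x
  simp only [upd, Function.update_apply, Function.comp_apply, Equiv.swap_apply_def]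
  split_ifs <;> simp_all

theorem swap_mul_contrOp_self (k l : Fin n) :
    (permOp (Equiv.swap k l) * contrOp k l : Module.End ℂ ((Fin n → I) → M)) = contrOp k l := by
  rw [permOp_mul_contrOp, Equiv.swap_apply_left, Equiv.swap_apply_right, contrOp_symm,
    contrOp_mul_swap_self]

theorem contrOp_mul_self {k l : Fin n} (h : k ≠ l) :
    (contrOp k l * contrOp k l : Module.End ℂ ((Fin n → I) → M)) =
      (Fintype.card I : ℂ) • contrOp k l := by
  refine LinearMap.ext fun φ => ?_
  funext f
  simp only [Module.End.mul_apply, contrOp_apply, LinearMap.smul_apply, Pi.smul_apply]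
  split_ifs with hf
  · have e1 : ∀ i, upd f k l i i k = upd f k l i i l := by simp [upd, h]
    have e2 : ∀ i j, upd (upd f k l i i) k l j j = upd f k l j j := by
      intro i j
      funext x
      simp only [upd, Function.update_apply]
      split_ifs <;> simp_all
    simp only [e1, e2, if_true, Finset.sum_const, Finset.card_univ]
    rw [← Nat.cast_smul_eq_nsmul ℂ]
  · simp

/-- The Casimir operator of the slots `k` and `l`. -/
def omegaOp (k l : Fin n) : Module.End ℂ ((Fin n → I) → M) :=
  permOp (Equiv.swap k l) - contrOp k l

theorem omegaOp_symm (k l : Fin n) :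
    (omegaOp k l : Module.End ℂ ((Fin n → I) → M)) = omegaOp l k := by
  rw [omegaOp, omegaOp, Equiv.swap_comm, contrOp_symm]

theorem permOp_mul_omegaOp (s : Equiv.Perm (Fin n)) (k l : Fin n) :
    (permOp s * omegaOp k l : Module.End ℂ ((Fin n → I) → M)) =
      omegaOp (s k) (s l) * permOp s := by
  rw [omegaOp, omegaOp, mul_sub, sub_mul, permOp_mul_contrOp, permOp_mul, permOp_mul]
  congr 2
  rw [Equiv.mul_swap_eq_swap_mul]

/-- The exchange in either Casimir operator cancels against the contraction in the other one. -/
theorem contrOp_mul_omegaOp {k l m : Fin n} (hkl : k ≠ l) (hkm : k ≠ m) (hlm : l ≠ m) :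
    (contrOp k l * omegaOp k m + contrOp k l * omegaOp l m :
      Module.End ℂ ((Fin n → I) → M)) = 0 := by
  rw [omegaOp, omegaOp, mul_sub, mul_sub, contrOp_mul_swap hkl hkm hlm, contrOp_symm k l,
    contrOp_mul_swap hkl.symm hlm hkm]
  abel

theorem omegaOp_mul_contrOp {k l m : Fin n} (hkl : k ≠ l) (hkm : k ≠ m) (hlm : l ≠ m) :
    (omegaOp k m * contrOp k l + omegaOp l m * contrOp k l :
      Module.End ℂ ((Fin n → I) → M)) = 0 := by
  rw [omegaOp, omegaOp, sub_mul, sub_mul, swap_mul_contrOp hkl hkm hlm, contrOp_symm k l,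
    swap_mul_contrOp hkl.symm hlm hkm]
  abel

theorem swap_comm_slotOp {k l m : Fin n} (h1 : m ≠ k) (h2 : m ≠ l)
    (H : Matrix I I (Module.End ℂ M)) :
    (permOp (Equiv.swap k l) * slotOp m H : Module.End ℂ ((Fin n → I) → M)) =
      slotOp m H * permOp (Equiv.swap k l) := by
  rw [permOp_mul_slotOp, Equiv.swap_apply_of_ne_of_ne h1 h2]

theorem omegaOp_comm_slotOp {k l m : Fin n} (h1 : m ≠ k) (h2 : m ≠ l)
    (H : Matrix I I (Module.End ℂ M)) :
    (omegaOp k l * slotOp m H : Module.End ℂ ((Fin n → I) → M)) = slotOp m H * omegaOp k l := by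
  rw [omegaOp, sub_mul, mul_sub, contrOp_mul_slotOp h1 h2, swap_comm_slotOp h1 h2]

theorem permOp_comm_omegaOp {k l m r : Fin n} (h1 : m ≠ k) (h2 : m ≠ l) (h3 : r ≠ k)
    (h4 : r ≠ l) : (permOp (Equiv.swap k l) * omegaOp m r : Module.End ℂ ((Fin n → I) → M)) =
      omegaOp m r * permOp (Equiv.swap k l) := by
  rw [permOp_mul_omegaOp, Equiv.swap_apply_of_ne_of_ne h1 h2, Equiv.swap_apply_of_ne_of_ne h3 h4]

theorem contrOp_comm_omegaOp {k l m r : Fin n} (h1 : m ≠ k) (h2 : m ≠ l) (h3 : r ≠ k)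
    (h4 : r ≠ l) : (contrOp k l * omegaOp m r : Module.End ℂ ((Fin n → I) → M)) =
      omegaOp m r * contrOp k l := by
  rw [omegaOp, mul_sub, sub_mul, contrOp_comm h1 h2 h3 h4, permOp_mul_contrOp,
    Equiv.swap_apply_of_ne_of_ne h1.symm h3.symm, Equiv.swap_apply_of_ne_of_ne h2.symm h4.symm]

theorem omegaOp_comm {k l m r : Fin n} (h1 : m ≠ k) (h2 : m ≠ l) (h3 : r ≠ k) (h4 : r ≠ l) :
    (omegaOp k l * omegaOp m r : Module.End ℂ ((Fin n → I) → M)) =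
      omegaOp m r * omegaOp k l := by
  rw [omegaOp, sub_mul, mul_sub, permOp_comm_omegaOp h1 h2 h3 h4,
    contrOp_comm_omegaOp h1 h2 h3 h4]

/-- The infinitesimal braid relation between the Casimir operators of three slots. -/
theorem omegaOp_comm_add {k l m : Fin n} (hkl : k ≠ l) (hkm : k ≠ m) (hlm : l ≠ m) :
    (omegaOp k l * (omegaOp k m + omegaOp l m) : Module.End ℂ ((Fin n → I) → M)) =
      (omegaOp k m + omegaOp l m) * omegaOp k l := by
  have h1 := contrOp_mul_omegaOp (I := I) (M := M) hkl hkm hlm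
  have h2 := omegaOp_mul_contrOp (I := I) (M := M) hkl hkm hlm
  rw [← mul_add] at h1
  rw [← add_mul] at h2
  have h3 : (omegaOp k l : Module.End ℂ ((Fin n → I) → M)) =
      permOp (Equiv.swap k l) - contrOp k l := rfl
  rw [h3, sub_mul, mul_sub, h1, h2, sub_zero, sub_zero, mul_add, add_mul, permOp_mul_omegaOp, permOp_mul_omegaOp,
    Equiv.swap_apply_left, Equiv.swap_apply_right, Equiv.swap_apply_of_ne_of_ne hkm.symm hlm.symm,
    add_comm]

end TensorModel

/-! ### The recursion for the odd `w i`, derived from the other relations -/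

/-- The relation between the central elements `w_i` with odd `i` and the earlier ones, multiplied
by the element `e`. -/
theorem odd_relation_mul {A : Type*} [Ring A] {s e y z : A} {w : ℕ → A}
    (hs : s * y - z * s = e - 1) (hse : s * e = e) (hes : e * s = e) (hyz : y * z = z * y)
    (he : e * (y + z) = 0) (hw : ∀ i, e * y ^ i * e = w i * e)
    (hww : ∀ i j, w i * w j = w j * w i) {i : ℕ} (hi : Odd i) :
    2 * (w i * e) + (w (i - 1) +
      ∑ j ∈ Finset.Icc 1 i, (-1) ^ j * (w (i - j) * w (j - 1))) * e = 0 := by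
  -- Moving `s` through a power of `y` turns it into a power of `z` and leaves one correction `e -
  -- 1` for each factor passed.
  have h1 : ∀ m, s * y ^ m = z ^ m * s + ∑ j ∈ Finset.range m, z ^ j * (e - 1) * y ^ (m - 1 - j) := by
    intro m
    induction m with
    | zero => simp
    | succ m ih =>
      rw [pow_succ, ← mul_assoc, ih, add_mul, Finset.sum_mul, Finset.sum_range_succ,
        mul_assoc _ s y, sub_eq_iff_eq_add.1 hs]
      have : ∀ j ∈ Finset.range m, z ^ j * (e - 1) * y ^ (m - 1 - j) * y =
          z ^ j * (e - 1) * y ^ (m + 1 - 1 - j) := by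
        intro j hj
        rw [Finset.mem_range] at hj
        rw [mul_assoc, ← pow_succ]
        congr 2; omega
      rw [Finset.sum_congr rfl this, pow_succ]
      simp only [Nat.add_sub_cancel, Nat.sub_self, pow_zero]
      noncomm_ring
  have h2 : ∀ j, e * z ^ j = (-1) ^ j * (e * y ^ j) := by
    intro j
    induction j with
    | zero => simp
    | succ j ih =>
      have h3 : e * z = -(e * y) := by
        rw [mul_add] at he; rw [eq_neg_iff_add_eq_zero, add_comm, he]
      have h4 : y ^ j * z = z * y ^ j := ((Commute.pow_left (a := y) (b := z) hyz) j)
      rw [pow_succ, ← mul_assoc, ih, mul_assoc, mul_assoc, h4, ← mul_assoc e, h3, pow_succ, pow_succ']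
      noncomm_ring
  have h5 : ∀ j m, e * (z ^ j * (e - 1) * y ^ m) * e =
      (-1) ^ j * (w j * w m * e - w (j + m) * e) := by
    intro j m
    have e1 : e * (z ^ j * (e - 1) * y ^ m) * e =
        e * z ^ j * e * y ^ m * e - e * z ^ j * y ^ m * e := by noncomm_ring
    rw [e1, h2, mul_assoc ((-1) ^ j) (e * y ^ j) e, hw, mul_assoc ((-1) ^ j) _ (y ^ m),
      mul_assoc ((-1) ^ j), mul_assoc ((-1) ^ j) (e * y ^ j), mul_assoc ((-1) ^ j),
      mul_assoc e (y ^ j), ← pow_add, hw, mul_assoc (w j) e, mul_assoc (w j) (e * y ^ m), hw,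
      ← mul_assoc (w j), mul_sub]
  -- Between two factors `e` every power becomes some `w`. As `i` is odd, the main terms on the two
  -- sides are `w i * e` and `- w i * e`, whence the coefficient 2.
  have h6 := congrArg (fun x => e * x * e) (h1 i)
  simp only [mul_add, add_mul, Finset.mul_sum, Finset.sum_mul] at h6
  rw [← mul_assoc e s, hes, hw, ← mul_assoc e (z ^ i), h2, mul_assoc _ s e, hse,
    mul_assoc _ _ e, hw, hi.neg_one_pow, Finset.sum_congr rfl fun j _ => h5 j (i - 1 - j)] at h6
  have h7 : ∑ j ∈ Finset.range i, (-1) ^ j * (w j * w (i - 1 - j) * e - w (j + (i - 1 - j)) * e) =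
      -((∑ j ∈ Finset.Icc 1 i, (-1) ^ j * (w (i - j) * w (j - 1))) * e) - w (i - 1) * e := by
    have h8 : ∀ j ∈ Finset.range i, (-1) ^ j * (w j * w (i - 1 - j) * e - w (j + (i - 1 - j)) * e) =
        (-1) ^ j * (w j * w (i - 1 - j)) * e - (-1) ^ j * (w (i - 1) * e) := by
      intro j hj
      rw [Finset.mem_range] at hj
      rw [show j + (i - 1 - j) = i - 1 by omega, mul_sub]
      simp only [mul_assoc]
    rw [Finset.sum_congr rfl h8, Finset.sum_sub_distrib, ← Finset.sum_mul, ← Finset.sum_mul]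
    -- An alternating sum with an odd number of terms: the corrections coming from `-1` in `e - 1`
    -- leave a single `w (i - 1)`.
    have h9 : ∑ j ∈ Finset.range i, (-1 : A) ^ j = 1 := by
      obtain ⟨t, rfl⟩ := hi
      clear * -
      induction t with
      | zero => simp
      | succ t ih =>
        rw [show 2 * (t + 1) + 1 = 2 * t + 1 + 1 + 1 by ring, Finset.sum_range_succ,
          Finset.sum_range_succ, ih]
        simp [pow_succ]
    rw [h9, one_mul]
    congr 1
    rw [← neg_mul, ← Finset.sum_neg_distrib]
    congr 1
    have h10 : Finset.Icc 1 i = Finset.Ico (0 + 1) (i + 1) := by rw [zero_add]; rfl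
    rw [h10, Finset.range_eq_Ico, ← Finset.sum_Ico_add']
    refine Finset.sum_congr rfl fun j hj => ?_
    rw [hww, pow_succ, show i - (j + 1) = i - 1 - j by omega, Nat.add_sub_cancel]
    noncomm_ring
  rw [h7] at h6
  rw [add_mul, two_mul]
  conv_lhs => rw [show w i * e + w i * e = w i * e + w i * e from rfl]
  have h11 : w i * e = -(w i * e) + (-((∑ j ∈ Finset.Icc 1 i,
      (-1) ^ j * (w (i - j) * w (j - 1))) * e) - w (i - 1) * e) := by simpa using h6
  nth_rewrite 1 [h11]
  abel

/-! ### Matrices of generators of the orthogonal Lie algebra -/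

namespace TensorModel

open BrauerDiagram AffineBrauerGen

variable {n : ℕ} {I : Type*} [Fintype I] [DecidableEq I] {M : Type*} [AddCommGroup M] [Module ℂ M]

/-- A matrix of operators whose entries represent the standard generators of the orthogonal Lie
algebra. -/
structure IsOrthogonal (H : Matrix I I (Module.End ℂ M)) : Prop where
  anti : ∀ i j, H i j = -H j i
  comm : ∀ a b k l, H a b * H k l - H k l * H a b =
    -((if b = k then H a l else 0) - (if a = l then H k b else 0) -
      (if a = k then H b l else 0) + (if b = l then H k a else 0))

variable {H : Matrix I I (Module.End ℂ M)} (hH : IsOrthogonal H)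

include hH

/-- Contraction makes the matrix in one slot the transpose of the matrix in the other, and `H` is
antisymmetric. -/
theorem contrOp_mul_slotOp_add {k l : Fin n} (h : k ≠ l) :
    (contrOp k l * (slotOp k H + slotOp l H) : Module.End ℂ ((Fin n → I) → M)) = 0 := by
  refine LinearMap.ext fun φ => ?_
  funext f
  simp only [Module.End.mul_apply, LinearMap.add_apply, Pi.add_apply, contrOp_apply, slotOp_apply,
    LinearMap.zero_apply, Pi.zero_apply]
  split_ifs
  · have e1 : ∀ i j, Function.update (upd f k l i i) k j = upd f k l j i := by
      intro i j; funext x; simp only [upd, Function.update_apply]; split_ifs <;> simp_all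
    have e2 : ∀ i j, Function.update (upd f k l i i) l j = upd f k l i j := by
      intro i j; funext x; simp only [upd, Function.update_apply]; split_ifs <;> simp_all
    have e3 : ∀ i, upd f k l i i k = i := by simp [upd, h]
    have e4 : ∀ i, upd f k l i i l = i := by simp [upd]
    simp only [e1, e2, e3, e4, Finset.sum_add_distrib]
    rw [Finset.sum_comm, ← Finset.sum_add_distrib]
    refine Finset.sum_eq_zero fun i _ => ?_
    rw [← Finset.sum_add_distrib]
    refine Finset.sum_eq_zero fun j _ => ?_
    rw [hH.anti, LinearMap.neg_apply, neg_add_cancel]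
  · rfl

theorem slotOp_add_mul_contrOp {k l : Fin n} (h : k ≠ l) :
    ((slotOp k H + slotOp l H) * contrOp k l : Module.End ℂ ((Fin n → I) → M)) = 0 := by
  refine LinearMap.ext fun φ => ?_
  funext f
  simp only [Module.End.mul_apply, LinearMap.add_apply, Pi.add_apply, contrOp_apply, slotOp_apply,
    LinearMap.zero_apply, Pi.zero_apply]
  have e1 : ∀ i j, upd (Function.update f k i) k l j j = upd f k l j j := by
    intro i j; funext x; simp only [upd, Function.update_apply]; split_ifs <;> simp_all
  have e2 : ∀ i j, upd (Function.update f l i) k l j j = upd f k l j j := by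
    intro i j; funext x; simp only [upd, Function.update_apply]; split_ifs <;> simp_all
  simp only [e1, e2, Function.update_self, Function.update_of_ne h, Function.update_of_ne h.symm]
  have s1 : ∑ i, H (f k) i (if i = f l then ∑ j, φ (upd f k l j j) else 0) =
      H (f k) (f l) (∑ j, φ (upd f k l j j)) := by
    rw [Finset.sum_eq_single (f l)]
    · rw [if_pos rfl]
    · intro i _ hi; rw [if_neg hi, map_zero]
    · simp
  have s2 : ∑ i, H (f l) i (if f k = i then ∑ j, φ (upd f k l j j) else 0) =
      H (f l) (f k) (∑ j, φ (upd f k l j j)) := by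
    rw [Finset.sum_eq_single (f k)]
    · rw [if_pos rfl]
    · intro i _ hi; rw [if_neg (Ne.symm hi), map_zero]
    · simp
  rw [s1, s2, hH.anti, LinearMap.neg_apply, neg_add_cancel]

/-- Of the four terms in the commutator of two entries of `H`, two form the commutator with the
exchange of the slots and two the commutator with the contraction. -/
theorem slotOp_comm_add {k l : Fin n} (h : k ≠ l) :
    (slotOp k H * (slotOp l H + omegaOp k l) : Module.End ℂ ((Fin n → I) → M)) =
      (slotOp l H + omegaOp k l) * slotOp k H := by
  rw [← sub_eq_zero]
  refine LinearMap.ext fun φ => ?_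
  funext f
  have e1 : ∀ i j, Function.update (Function.update f k i) l j = upd f k l i j := fun _ _ => rfl
  have e2 : ∀ i j, Function.update (Function.update f l j) k i = upd f k l i j :=
    fun _ _ => Function.update_comm h.symm _ _ _
  have e3 : ∀ i, Function.update f k i ∘ (Equiv.swap k l) = upd f k l (f l) i := by
    intro i; funext x
    simp only [upd, Function.update_apply, Function.comp_apply, Equiv.swap_apply_def]
    split_ifs <;> simp_all
  have e4 : ∀ i, Function.update (f ∘ (Equiv.swap k l)) k i = upd f k l i (f k) := by
    intro i; funext x
    simp only [upd, Function.update_apply, Function.comp_apply, Equiv.swap_apply_def]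
    split_ifs <;> simp_all
  have e5 : ∀ i j, upd (Function.update f k i) k l j j = upd f k l j j := by
    intro i j; funext x; simp only [upd, Function.update_apply]; split_ifs <;> simp_all
  have e6 : ∀ i j, Function.update (upd f k l i i) k j = upd f k l j i := by
    intro i j; funext x; simp only [upd, Function.update_apply]; split_ifs <;> simp_all
  have e7 : ∀ i, upd f k l i i k = i := by simp [upd, h]
  have v1 : slotOp k H (slotOp l H φ) f = ∑ i, ∑ j, H (f k) i (H (f l) j (φ (upd f k l i j))) := by
    simp only [slotOp_apply, Function.update_of_ne h.symm, e1, map_sum]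
  have v2 : slotOp l H (slotOp k H φ) f = ∑ i, ∑ j, H (f l) j (H (f k) i (φ (upd f k l i j))) := by
    simp only [slotOp_apply, Function.update_of_ne h, e2, map_sum]
    exact Finset.sum_comm
  have v3 : slotOp k H (permOp (Equiv.swap k l) φ) f = ∑ i, H (f k) i (φ (upd f k l (f l) i)) := by
    simp only [slotOp_apply, permOp_apply, e3]
  have v4 : permOp (Equiv.swap k l) (slotOp k H φ) f = ∑ i, H (f l) i (φ (upd f k l i (f k))) := by
    simp only [slotOp_apply, permOp_apply, e4, Function.comp_apply, Equiv.swap_apply_left]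
  have v5 : slotOp k H (contrOp k l φ) f = ∑ j, H (f k) (f l) (φ (upd f k l j j)) := by
    simp only [slotOp_apply, contrOp_apply, Function.update_self, Function.update_of_ne h.symm, e5]
    rw [Finset.sum_eq_single (f l)]
    · rw [if_pos rfl, map_sum]
    · intro i _ hi; rw [if_neg hi, map_zero]
    · simp
  have v6 : contrOp k l (slotOp k H φ) f =
      if f k = f l then ∑ i, ∑ j, H j i (φ (upd f k l i j)) else 0 := by
    simp only [slotOp_apply, contrOp_apply, e6, e7]
    congr 1
    exact Finset.sum_comm
  have hc : ∀ i j, H (f k) i (H (f l) j (φ (upd f k l i j))) -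
      H (f l) j (H (f k) i (φ (upd f k l i j))) =
      -((if i = f l then H (f k) j (φ (upd f k l i j)) else 0) -
        (if f k = j then H (f l) i (φ (upd f k l i j)) else 0) -
        (if f k = f l then H i j (φ (upd f k l i j)) else 0) +
        (if i = j then H (f l) (f k) (φ (upd f k l i j)) else 0)) := by
    intro i j
    have := LinearMap.congr_fun (hH.comm (f k) i (f l) j) (φ (upd f k l i j))
    simp only [LinearMap.sub_apply, Module.End.mul_apply, LinearMap.neg_apply,
      LinearMap.add_apply] at this
    rw [this]
    congr 2
    · congr 2 <;> split_ifs <;> rfl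
    · split_ifs <;> rfl
  have hsum : ∑ i, ∑ j, (H (f k) i (H (f l) j (φ (upd f k l i j))) -
      H (f l) j (H (f k) i (φ (upd f k l i j)))) =
      -((∑ j, H (f k) j (φ (upd f k l (f l) j))) - (∑ i, H (f l) i (φ (upd f k l i (f k)))) -
        (if f k = f l then ∑ i, ∑ j, H i j (φ (upd f k l i j)) else 0) +
        ∑ i, H (f l) (f k) (φ (upd f k l i i))) := by
    simp only [hc, Finset.sum_neg_distrib, Finset.sum_add_distrib, Finset.sum_sub_distrib]
    congr 3
    · congr 1
      · rw [Finset.sum_comm]; simp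
      · simp
    · split_ifs <;> simp
    · simp
  have w6 : (if f k = f l then ∑ i, ∑ j, H i j (φ (upd f k l i j)) else 0) =
      -(if f k = f l then ∑ i, ∑ j, H j i (φ (upd f k l i j)) else 0) := by
    split_ifs
    · simp only [← Finset.sum_neg_distrib]
      refine Finset.sum_congr rfl fun i _ => Finset.sum_congr rfl fun j _ => ?_
      rw [hH.anti, LinearMap.neg_apply]
    · simp
  have w5 : ∑ i, H (f l) (f k) (φ (upd f k l i i)) = -∑ j, H (f k) (f l) (φ (upd f k l j j)) := by
    rw [← Finset.sum_neg_distrib]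
    refine Finset.sum_congr rfl fun i _ => ?_
    rw [hH.anti, LinearMap.neg_apply]
  rw [w6, w5] at hsum
  simp only [omegaOp, mul_add, add_mul, mul_sub, sub_mul, LinearMap.sub_apply, LinearMap.add_apply,
    Module.End.mul_apply, Pi.sub_apply, Pi.add_apply, v1, v2, v3, v4, v5, v6, LinearMap.zero_apply,
    Pi.zero_apply]
  simp only [Finset.sum_sub_distrib] at hsum
  rw [sub_eq_iff_eq_add] at hsum
  rw [hsum]
  abel

/-- The traces of powers of the matrix commute with its entries. -/
theorem trace_pow_comm (c : ℂ) (m : ℕ) (a b : I) :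
    ((H + c • 1) ^ m).trace * H a b = H a b * ((H + c • 1) ^ m).trace := by
  set S : Matrix I I (Module.End ℂ M) := Matrix.single b a 1 - Matrix.single a b 1 with hS
  set D : Matrix I I (Module.End ℂ M) := Matrix.diagonal fun _ => H a b with hD
  -- The commutation relations say that the operator `H a b`, acting on every entry by `D`, together
  -- with the corresponding constant matrix `S`, leaves `H` invariant.
  have h1 : Commute (D + S) H := by
    ext1 k l
    have := hH.comm a b k l
    simp only [hD, hS, add_mul, mul_add, sub_mul, mul_sub, Matrix.add_apply, Matrix.sub_apply,
      Matrix.diagonal_mul, Matrix.mul_diagonal]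
    have f1 : ∀ a b, (Matrix.single b a (1 : Module.End ℂ M) * H) k l =
        if b = k then H a l else 0 := by
      intro a b
      simp [Matrix.mul_apply, Matrix.single_apply, ite_and]
    have f2 : ∀ a b, (H * Matrix.single b a (1 : Module.End ℂ M)) k l =
        if a = l then H k b else 0 := by
      intro a b
      simp [Matrix.mul_apply, Matrix.single_apply, ite_and]
    rw [f1, f2, f1, f2]
    rw [sub_eq_iff_eq_add] at this
    rw [this]
    abel
  have h2 : Commute (D + S) ((H + c • 1) ^ m) :=
    (h1.add_right ((Commute.one_right _).smul_right c)).pow_right m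
  set W := (H + c • 1) ^ m
  -- The entries of `S` are integers, so the trace is cyclic for `S` and its two contributions
  -- cancel, leaving the commutator of `H a b` with the trace.
  have h3 := congrArg Matrix.trace h2.eq
  have t1 : (D * W).trace = H a b * W.trace := by
    simp [hD, Matrix.trace, Finset.mul_sum, Matrix.diagonal_mul]
  have t2 : (W * D).trace = W.trace * H a b := by
    simp [hD, Matrix.trace, Finset.sum_mul, Matrix.mul_diagonal]
  have t3 : ∀ a b, (Matrix.single b a (1 : Module.End ℂ M) * W).trace = W a b := by
    intro a b
    simp [Matrix.trace, Matrix.mul_apply, Matrix.single_apply, ite_and]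
  have t4 : ∀ a b, (W * Matrix.single b a (1 : Module.End ℂ M)).trace = W a b := by
    intro a b
    simp [Matrix.trace, Matrix.mul_apply, Matrix.single_apply, ite_and]
  rw [add_mul, mul_add, Matrix.trace_add, Matrix.trace_add, t1, t2, hS, sub_mul, mul_sub,
    Matrix.trace_sub, Matrix.trace_sub, t3, t3, t4, t4] at h3
  exact (add_right_cancel h3).symm

end TensorModel

/-! ### The tensor model of the affine Brauer algebra -/

namespace TensorModel

open BrauerDiagram AffineBrauerGen

variable {n : ℕ} {I : Type*} [Fintype I] [DecidableEq I] {M : Type*} [AddCommGroup M] [Module ℂ M]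

/-- Operators on `M` acting on the entries of tensors. -/
def entryHom (n : ℕ) (I M : Type*) [AddCommGroup M] [Module ℂ M] :
    Module.End ℂ M →+* Module.End ℂ ((Fin n → I) → M) where
  toFun := entryOp
  map_zero' := rfl
  map_one' := rfl
  map_add' _ _ := rfl
  map_mul' _ _ := rfl

theorem entryHom_apply (T : Module.End ℂ M) : entryHom n I M T = entryOp T := rfl

/-- The scalar by which the elements `y_k` are shifted. -/
noncomputable def shift (I : Type*) [Fintype I] : ℂ := ((Fintype.card I : ℂ) - 1) / 2

/-- A contraction of two slots times their Casimir operator is `1 - |I|` times the contraction. The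
scalar `shift I` is chosen so that its two copies, one in each of the two `y`, compensate this
factor. -/
theorem shift_smul_cancel (I : Type*) [Fintype I] {V : Type*} [AddCommGroup V] [Module ℂ V]
    (x : V) : shift I • x + shift I • x + x - (Fintype.card I : ℂ) • x = 0 := by
  have h : shift I + shift I + 1 - (Fintype.card I : ℂ) = 0 := by rw [shift]; ring
  have h' : (shift I + shift I + 1 - (Fintype.card I : ℂ)) • x = 0 := by rw [h, zero_smul]
  rwa [sub_smul, add_smul, add_smul, one_smul] at h'

variable (H : Matrix I I (Module.End ℂ M))

/-- The operator of `y_k`. -/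
noncomputable def yOp (k : Fin n) : Module.End ℂ ((Fin n → I) → M) :=
  slotOp k (H + shift I • 1) + ∑ m ∈ Finset.Iio k, omegaOp m k

/-- The trace of the `i`-th power of the shifted matrix. -/
noncomputable def powTrace (i : ℕ) : Module.End ℂ M := ((H + shift I • 1) ^ i).trace

/-- The operators of the generators of the affine Brauer algebra. -/
noncomputable def tensorGen : AffineBrauerGen n → Module.End ℂ ((Fin n → I) → M)
  | b γ => brauerOp γ
  | y k => yOp H k
  | w i => entryOp (powTrace H i)

variable {H}

theorem commute_slotOp_shift {k : Fin n} {X : Module.End ℂ ((Fin n → I) → M)}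
    (h : Commute X (slotOp k H)) : Commute X (slotOp k (H + shift I • 1)) := by
  rw [slotOp_add, slotOp_smul, slotOp_one]
  exact h.add_right ((Commute.one_right X).smul_right _)

/-- When `k` and `k'` lie on the same side of `l`, the operator `yOp H l` contains either both
Casimir operators joining them to `l`, in which case only their sum matters, or neither. -/
theorem commute_yOp {X : Module.End ℂ ((Fin n → I) → M)} {k k' l : Fin n} (hkk : k ≠ k')
    (hlt : k < l ↔ k' < l) (h1 : Commute X (slotOp l H))
    (h2 : ∀ m, m ≠ k → m ≠ k' → m ≠ l → Commute X (omegaOp m l))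
    (h3 : Commute X (omegaOp k l + omegaOp k' l)) : Commute X (yOp H l) := by
  refine (commute_slotOp_shift h1).add_right ?_
  by_cases hk : k < l
  · rw [← Finset.add_sum_erase _ _ (Finset.mem_Iio.2 hk), ← Finset.add_sum_erase _ _
      (Finset.mem_erase.2 ⟨hkk.symm, Finset.mem_Iio.2 (hlt.1 hk)⟩), ← add_assoc]
    refine h3.add_right (Commute.sum_right _ _ _ fun m hm => ?_)
    simp only [Finset.mem_erase, Finset.mem_Iio] at hm
    exact h2 m hm.2.1 hm.1 hm.2.2.ne
  · refine Commute.sum_right _ _ _ fun m hm => ?_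
    rw [Finset.mem_Iio] at hm
    exact h2 m (by rintro rfl; exact hk hm) (by rintro rfl; exact hk (hlt.2 hm)) hm.ne

theorem permOp_swap_comm_yOp {k k' l : Fin n} (hkk : k ≠ k') (hlt : k < l ↔ k' < l) (h1 : l ≠ k)
    (h2 : l ≠ k') : Commute (permOp (Equiv.swap k k')) (yOp H l) := by
  refine commute_yOp hkk hlt (swap_comm_slotOp h1 h2 H)
    (fun m hm hm' _ => permOp_comm_omegaOp hm hm' h1 h2) ?_
  show _ * _ = _ * _
  rw [mul_add, permOp_mul_omegaOp, permOp_mul_omegaOp, Equiv.swap_apply_left,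
    Equiv.swap_apply_right, Equiv.swap_apply_of_ne_of_ne h1 h2, add_mul, add_comm]

theorem contrOp_comm_yOp {k k' l : Fin n} (hkk : k ≠ k') (hlt : k < l ↔ k' < l) (h1 : l ≠ k)
    (h2 : l ≠ k') : Commute (contrOp k k') (yOp H l) := by
  refine commute_yOp hkk hlt (contrOp_mul_slotOp h1 h2 H)
    (fun m hm hm' _ => contrOp_comm_omegaOp hm hm' h1 h2) ?_
  show _ * _ = _ * _
  rw [mul_add, add_mul, contrOp_mul_omegaOp hkk h1.symm h2.symm,
    omegaOp_mul_contrOp hkk h1.symm h2.symm]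

theorem Iio_eq_insert {k k' : Fin n} (h : (k' : ℕ) = k + 1) :
    Finset.Iio k' = insert k (Finset.Iio k) := by
  ext m
  simp only [Finset.mem_Iio, Finset.mem_insert, Fin.lt_def, Fin.ext_iff]
  omega

theorem yOp_eq {k k' : Fin n} (h : (k' : ℕ) = k + 1) :
    yOp H k' = slotOp k' (H + shift I • 1) + ∑ m ∈ Finset.Iio k, omegaOp m k' + omegaOp k k' := by
  rw [yOp, Iio_eq_insert h, Finset.sum_insert (by simp)]
  abel

/-- Conjugation by the exchange carries `yOp H k` to `yOp H k'` without its last Casimir operator,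
and that operator times the exchange is one minus the contraction. -/
theorem permOp_mul_yOp {k k' : Fin n} (h : (k' : ℕ) = k + 1) :
    permOp (Equiv.swap k k') * yOp H k - yOp H k' * permOp (Equiv.swap k k') =
      contrOp k k' - 1 := by
  have h1 : (permOp (Equiv.swap k k') * permOp (Equiv.swap k k') :
      Module.End ℂ ((Fin n → I) → M)) = 1 := by
    rw [permOp_mul, Equiv.swap_mul_self, permOp_one]
  have h2 : ∀ m ∈ Finset.Iio k, (permOp (Equiv.swap k k') * omegaOp m k :
      Module.End ℂ ((Fin n → I) → M)) = omegaOp m k' * permOp (Equiv.swap k k') := by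
    intro m hm
    rw [Finset.mem_Iio, Fin.lt_def] at hm
    rw [permOp_mul_omegaOp, Equiv.swap_apply_left, Equiv.swap_apply_of_ne_of_ne]
    · exact fun h' => by rw [h'] at hm; omega
    · exact fun h' => by rw [h'] at hm; omega
  rw [yOp_eq h, yOp, mul_add, permOp_mul_slotOp, Equiv.swap_apply_left, Finset.mul_sum,
    Finset.sum_congr rfl h2, ← Finset.sum_mul, add_mul, add_mul, omegaOp, sub_mul, h1,
    contrOp_mul_swap_self]
  abel

theorem permOp_mul_yOp_succ {k k' : Fin n} (h : (k' : ℕ) = k + 1) :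
    permOp (Equiv.swap k k') * yOp H k' - yOp H k * permOp (Equiv.swap k k') =
      1 - contrOp k k' := by
  have h1 : (permOp (Equiv.swap k k') * permOp (Equiv.swap k k') :
      Module.End ℂ ((Fin n → I) → M)) = 1 := by
    rw [permOp_mul, Equiv.swap_mul_self, permOp_one]
  have h2 := congrArg (fun X => -(permOp (Equiv.swap k k') * X * permOp (Equiv.swap k k')))
    (permOp_mul_yOp (H := H) h)
  simp only [mul_sub, sub_mul, mul_one, h1, swap_mul_contrOp_self, contrOp_mul_swap_self] at h2
  rw [← mul_assoc, h1, one_mul, ← mul_assoc, mul_assoc _ (permOp _) (permOp _), h1, mul_one,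
    neg_sub, neg_sub] at h2
  exact h2

theorem entryOp_powTrace_zero :
    (entryOp (powTrace H 0) : Module.End ℂ ((Fin n → I) → M)) = (Fintype.card I : ℂ) • 1 := by
  refine LinearMap.ext fun φ => ?_
  funext f
  simp [powTrace, entryOp_apply, Matrix.trace_one, Nat.cast_smul_eq_nsmul]

variable (hH : IsOrthogonal H)

include hH

theorem slotOp_comm_yOp {k l : Fin n} (h : k < l) : Commute (slotOp k H) (yOp H l) := by
  rw [yOp, ← Finset.add_sum_erase _ _ (Finset.mem_Iio.2 h), slotOp_add, slotOp_smul, slotOp_one]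
  have h1 : Commute (slotOp k H) (slotOp l H + omegaOp k l) := slotOp_comm_add hH h.ne
  have h2 : Commute (slotOp k H) (∑ m ∈ (Finset.Iio l).erase k, omegaOp m l) := by
    refine Commute.sum_right _ _ _ fun m hm => ?_
    simp only [Finset.mem_erase, Finset.mem_Iio] at hm
    exact (omegaOp_comm_slotOp hm.1.symm h.ne H).symm
  have h3 : Commute (slotOp k H) (shift I • (1 : Module.End ℂ ((Fin n → I) → M))) :=
    (Commute.one_right _).smul_right _
  rw [show slotOp l H + shift I • 1 + (omegaOp k l + ∑ m ∈ (Finset.Iio l).erase k, omegaOp m l) =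
    slotOp l H + omegaOp k l + ∑ m ∈ (Finset.Iio l).erase k, omegaOp m l + shift I • 1 by abel]
  exact (h1.add_right h2).add_right h3

/-- Each summand of `yOp H k`, a matrix in slot `k` or a Casimir operator of slots up to `k`,
commutes with `yOp H l` by itself, because `yOp H l` is symmetric in the slots before `l`. -/
theorem yOp_comm_of_lt {k l : Fin n} (h : k < l) : Commute (yOp H k) (yOp H l) := by
  refine Commute.add_left ?_ (Commute.sum_left _ _ _ fun m hm => ?_)
  · rw [slotOp_add, slotOp_smul, slotOp_one]
    exact (slotOp_comm_yOp hH h).add_left ((Commute.one_left _).smul_left _)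
  · rw [Finset.mem_Iio] at hm
    have hml := hm.trans h
    exact commute_yOp hm.ne (by simp [hml, h]) (omegaOp_comm_slotOp hml.ne' h.ne' H)
      (fun r h1 h2 _ => omegaOp_comm h1 h2 hml.ne' h.ne') (omegaOp_comm_add hm.ne hml.ne h.ne)

theorem yOp_comm (k l : Fin n) : Commute (yOp H k) (yOp H l) := by
  rcases lt_trichotomy k l with h | rfl | h
  · exact yOp_comm_of_lt hH h
  · exact Commute.refl _
  · exact (yOp_comm_of_lt hH h).symm

/-- The matrices cancel by antisymmetry, the Casimir operators with earlier slots cancel in pairs,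
and the last Casimir operator is balanced by the shifts. -/
theorem contrOp_mul_yOp_add {k k' : Fin n} (h : (k' : ℕ) = k + 1) :
    contrOp k k' * (yOp H k + yOp H k') = 0 := by
  have hne : k ≠ k' := fun h' => by rw [h'] at h; omega
  have h1 : ∀ m ∈ Finset.Iio k, (contrOp k k' * omegaOp m k :
      Module.End ℂ ((Fin n → I) → M)) = -(contrOp k k' * omegaOp m k') := by
    intro m hm
    rw [Finset.mem_Iio, Fin.lt_def] at hm
    have h2 : k ≠ m := fun h' => by rw [h'] at hm; omega
    have h3 : k' ≠ m := fun h' => by rw [h'] at h; omega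
    rw [eq_neg_iff_add_eq_zero, omegaOp_symm m k, omegaOp_symm m k']
    exact contrOp_mul_omegaOp hne h2 h3
  have h4 := contrOp_mul_slotOp_add hH hne
  rw [mul_add] at h4
  rw [yOp_eq h, yOp, mul_add, mul_add, mul_add, mul_add, Finset.mul_sum, Finset.mul_sum,
    Finset.sum_congr rfl h1, Finset.sum_neg_distrib, slotOp_add, slotOp_add, slotOp_smul,
    slotOp_smul, slotOp_one, slotOp_one, mul_add, mul_add, omegaOp, mul_sub, contrOp_mul_swap_self,
    contrOp_mul_self hne, mul_smul_comm, mul_one]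
  have h5 := shift_smul_cancel I (contrOp k k' : Module.End ℂ ((Fin n → I) → M))
  calc _ = (contrOp k k' * slotOp k H + contrOp k k' * slotOp k' H) +
      (shift I • contrOp k k' + shift I • contrOp k k' + contrOp k k' -
        (Fintype.card I : ℂ) • contrOp k k') := by abel
    _ = 0 := by rw [h4, h5, add_zero]

theorem yOp_add_mul_contrOp {k k' : Fin n} (h : (k' : ℕ) = k + 1) :
    (yOp H k + yOp H k') * contrOp k k' = 0 := by
  have hne : k ≠ k' := fun h' => by rw [h'] at h; omega
  have h1 : ∀ m ∈ Finset.Iio k, (omegaOp m k * contrOp k k' :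
      Module.End ℂ ((Fin n → I) → M)) = -(omegaOp m k' * contrOp k k') := by
    intro m hm
    rw [Finset.mem_Iio, Fin.lt_def] at hm
    have h2 : k ≠ m := fun h' => by rw [h'] at hm; omega
    have h3 : k' ≠ m := fun h' => by rw [h'] at h; omega
    rw [eq_neg_iff_add_eq_zero, omegaOp_symm m k, omegaOp_symm m k']
    exact omegaOp_mul_contrOp hne h2 h3
  have h4 := slotOp_add_mul_contrOp hH hne
  rw [add_mul] at h4
  rw [yOp_eq h, yOp, add_mul, add_mul, add_mul, add_mul, Finset.sum_mul, Finset.sum_mul,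
    Finset.sum_congr rfl h1, Finset.sum_neg_distrib, slotOp_add, slotOp_add, slotOp_smul,
    slotOp_smul, slotOp_one, slotOp_one, add_mul, add_mul, omegaOp, sub_mul, swap_mul_contrOp_self,
    contrOp_mul_self hne, smul_mul_assoc, one_mul]
  have h5 := shift_smul_cancel I (contrOp k k' : Module.End ℂ ((Fin n → I) → M))
  calc _ = (slotOp k H * contrOp k k' + slotOp k' H * contrOp k k') +
      (shift I • contrOp k k' + shift I • contrOp k k' + contrOp k k' -
        (Fintype.card I : ℂ) • contrOp k k') := by abel
    _ = 0 := by rw [h4, h5, add_zero]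

theorem powTrace_comm_entry (m : ℕ) (a b : I) : Commute (powTrace H m) (H a b) :=
  trace_pow_comm hH _ m a b

theorem powTrace_comm_pow (m i : ℕ) (a b : I) :
    Commute (powTrace H m) (((H + shift I • 1) ^ i) a b) := by
  induction i generalizing b with
  | zero =>
    rw [pow_zero, Matrix.one_apply]
    split_ifs
    · exact Commute.one_right _
    · exact Commute.zero_right _
  | succ i ih =>
    rw [pow_succ, Matrix.mul_apply]
    refine Commute.sum_right _ _ _ fun j _ => (ih j).mul_right ?_
    rw [Matrix.add_apply, Matrix.smul_apply, Matrix.one_apply]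
    refine (powTrace_comm_entry hH m j b).add_right (Commute.smul_right ?_ _)
    split_ifs
    · exact Commute.one_right _
    · exact Commute.zero_right _

theorem powTrace_comm (m i : ℕ) : Commute (powTrace H m) (powTrace H i) :=
  Commute.sum_right _ _ _ fun a _ => powTrace_comm_pow hH m i a a

theorem entryOp_powTrace_comm (m : ℕ) (g : AffineBrauerGen n) :
    Commute (entryOp (powTrace H m)) (tensorGen H g) := by
  rcases g with γ | k | i
  · exact entryOp_mul_brauerOp _ γ
  · refine Commute.add_right ?_ (Commute.sum_right _ _ _ fun l hl => ?_)
    · exact commute_slotOp_shift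
        (entryOp_mul_slotOp _ k H fun a b => (powTrace_comm_entry hH m a b).eq)
    · rw [Finset.mem_Iio] at hl
      rw [omegaOp, ← brauerOp_bar hl.ne, ← brauerOp_ofPerm]
      exact Commute.sub_right (entryOp_mul_brauerOp _ _) (entryOp_mul_brauerOp _ _)
  · exact congrArg (entryHom n I M) (powTrace_comm hH m i).eq

theorem contrOp_yOp_pow {k k' : Fin n} (hk : (k : ℕ) = 0) (hkk : k ≠ k') (i : ℕ) :
    contrOp k k' * yOp H k ^ i * contrOp k k' = entryOp (powTrace H i) * contrOp k k' := by
  have h1 : Finset.Iio k = ∅ := by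
    ext m; simp only [Finset.mem_Iio, Fin.lt_def, hk]; simp
  rw [yOp, h1, Finset.sum_empty, add_zero, ← slotOp_pow, contr_slot_contr hkk, powTrace]

/-- The traces depend only on `M`, so the relation may be derived on tensors with two slots,
whatever `n` is. There it appears multiplied by a contraction, which must then be removed. -/
theorem powTrace_odd [Nonempty I] {i : ℕ} (hi : Odd i) : (-2 : ℂ) • powTrace H i =
    powTrace H (i - 1) +
      ∑ j ∈ Finset.Icc 1 i, (-1) ^ j * (powTrace H (i - j) * powTrace H (j - 1)) := by
  have h01 : (0 : Fin 2) ≠ 1 := by decide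
  have h := odd_relation_mul (A := Module.End ℂ ((Fin 2 → I) → M)) (s := permOp (Equiv.swap 0 1))
    (e := contrOp 0 1) (y := yOp H 0) (z := yOp H 1) (w := fun i => entryHom 2 I M (powTrace H i))
    (permOp_mul_yOp rfl) (swap_mul_contrOp_self 0 1) (contrOp_mul_swap_self 0 1) (yOp_comm hH 0 1)
    (contrOp_mul_yOp_add hH rfl) (contrOp_yOp_pow hH rfl h01)
    (fun i j => (entryOp_powTrace_comm (n := 2) hH i (.w j)).eq) hi
  have h' : entryHom 2 I M (2 * powTrace H i + (powTrace H (i - 1) +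
      ∑ j ∈ Finset.Icc 1 i, (-1) ^ j * (powTrace H (i - j) * powTrace H (j - 1)))) *
      contrOp 0 1 = 0 := by
    rw [← h]
    simp only [map_add, map_mul, map_sum, map_pow, map_neg, map_one, map_ofNat, add_mul, mul_assoc]
  set S := 2 * powTrace H i + (powTrace H (i - 1) +
      ∑ j ∈ Finset.Icc 1 i, (-1) ^ j * (powTrace H (i - j) * powTrace H (j - 1))) with hS
  have hS0 : S = 0 := by
    refine LinearMap.ext fun x => ?_
    obtain ⟨i0⟩ := ‹Nonempty I›
    -- A tensor with a single entry, at a constant index, is reproduced by the contraction at this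
    -- index.
    have h2 := congrFun (LinearMap.congr_fun h' (Pi.single (fun _ => i0) x)) (fun _ => i0)
    rw [Module.End.mul_apply, entryHom_apply, entryOp_apply, contrOp_apply, if_pos rfl,
      Finset.sum_eq_single i0] at h2
    · rw [show upd (fun _ => i0) (0 : Fin 2) 1 i0 i0 = fun _ => i0 by
        funext a; simp [upd, Function.update_apply]] at h2
      simpa using h2
    · intro j _ hj
      rw [Pi.single_apply, if_neg]
      intro h3
      have := congrFun h3 1
      simp [upd] at this
      exact hj this
    · simp
  rw [neg_smul, neg_eq_iff_add_eq_zero, ← hS0, hS]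
  congr 1
  rw [two_smul, two_mul]

/-- Tensors with entries in a module over the orthogonal Lie algebra carry the relations of the
affine Brauer algebra. -/
theorem isAffineBrauerModel [Nonempty I] :
    IsAffineBrauerModel (tensorGen H : AffineBrauerGen n → _) where
  b_one := by rw [tensorGen, brauerOp_ofPerm, permOp_one]
  b_mul γ γ' := by
    simp only [tensorGen]
    rw [brauerOp_mul, entryOp_powTrace_zero, smul_pow, one_pow, smul_mul_assoc, one_mul]
  y_comm k l := yOp_comm hH k l
  w_central i g := entryOp_powTrace_comm hH i g
  s_y k hk l h h' := by
    simp only [tensorGen]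
    rw [brauerOp_ofPerm]
    refine permOp_swap_comm_yOp (by simp) ?_ (fun h1 => h (congrArg Fin.val h1))
      (fun h1 => h' (congrArg Fin.val h1))
    simp only [Fin.lt_def]; omega
  sbar_y k hk l h h' := by
    simp only [tensorGen]
    rw [brauerOp_bar]
    refine contrOp_comm_yOp (by simp) ?_ (fun h1 => h (congrArg Fin.val h1))
      (fun h1 => h' (congrArg Fin.val h1))
    simp only [Fin.lt_def]; omega
  s_y_self k hk := by
    simp only [tensorGen]
    rw [brauerOp_ofPerm, brauerOp_bar]
    exact permOp_mul_yOp rfl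
  s_y_succ k hk := by
    simp only [tensorGen]
    rw [brauerOp_ofPerm, brauerOp_bar]
    exact permOp_mul_yOp_succ rfl
  sbar_mul_y_add k hk := by
    simp only [tensorGen]
    rw [brauerOp_bar]
    exact contrOp_mul_yOp_add hH rfl
  y_add_mul_sbar k hk := by
    simp only [tensorGen]
    rw [brauerOp_bar]
    exact yOp_add_mul_contrOp hH rfl
  sbar_y_pow_sbar h i hi := by
    simp only [tensorGen]
    rw [brauerOp_bar]
    exact contrOp_yOp_pow hH rfl (by simp) i
  w_odd i hi := by
    simp only [tensorGen]
    have h := congrArg (entryHom n I M) (powTrace_odd hH hi)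
    simp only [map_add, map_mul, map_sum, map_pow, map_neg, map_one] at h
    exact h

end TensorModel

/-! ### The orthogonal Lie algebra on polynomials, and symbols of operators -/

namespace TensorModel

open BrauerDiagram AffineBrauerGen MvPolynomial

section Operators

variable {I : Type*} [Fintype I] [DecidableEq I]

/-- The vector fields of the left action of the general linear group on square matrices. -/
noncomputable def glDer (i j : I) :
    Derivation ℂ (MvPolynomial (I × I) ℂ) (MvPolynomial (I × I) ℂ) :=
  mkDerivation ℂ fun p => if j = p.1 then X (i, p.2) else 0

theorem glDer_X (i j : I) (p : I × I) :
    glDer i j (X p) = if j = p.1 then X (i, p.2) else 0 := mkDerivation_X _ _ _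

theorem glDer_comm (i j k l : I) (p : MvPolynomial (I × I) ℂ) :
    glDer i j (glDer k l p) - glDer k l (glDer i j p) =
      (if j = k then glDer i l p else 0) - if i = l then glDer k j p else 0 := by
  have h : ⁅glDer i j, glDer k l⁆ = (if j = k then glDer i l else 0) -
      if i = l then glDer k j else 0 := by
    refine derivation_ext fun x => ?_
    rw [Derivation.commutator_apply, Derivation.sub_apply]
    by_cases h1 : j = k <;> by_cases h2 : i = l <;> simp only [h1, h2, if_true, if_false,
      glDer_X, Derivation.zero_apply, apply_ite (glDer _ _), map_zero] <;>
      split_ifs <;> simp_all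
  rw [← Derivation.commutator_apply, h, Derivation.sub_apply]
  congr 1 <;> split_ifs <;> rfl

/-- An action of the general linear Lie algebra on polynomials in the entries of a square matrix,
with first order term the vector fields and zero order term the coordinates. -/
noncomputable def glOp (i j : I) : Module.End ℂ (MvPolynomial (I × I) ℂ) :=
  LinearMap.mulLeft ℂ (X (i, j)) + (glDer i j : _ →ₗ[ℂ] _)

theorem glOp_apply (i j : I) (p : MvPolynomial (I × I) ℂ) :
    glOp i j p = X (i, j) * p + glDer i j p := rfl

/-- Formally, `glOp i j` is the vector field `glDer i j` conjugated by the exponential of the trace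
of the coordinate matrix, which explains why the same commutation relations hold. -/
theorem glOp_comm (i j k l : I) : glOp i j * glOp k l - glOp k l * glOp i j =
    (if j = k then glOp i l else 0) - if i = l then glOp k j else 0 := by
  refine LinearMap.ext fun p => ?_
  have h := glDer_comm i j k l p
  have e1 : (if j = k then glOp i l else 0 : Module.End ℂ _) p =
      (if j = k then X (i, l) else 0) * p + if j = k then glDer i l p else 0 := by
    split_ifs <;> simp [glOp_apply]
  have e2 : (if i = l then glOp k j else 0 : Module.End ℂ _) p =
      (if i = l then X (k, j) else 0) * p + if i = l then glDer k j p else 0 := by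
    split_ifs <;> simp [glOp_apply]
  rw [LinearMap.sub_apply, LinearMap.sub_apply, e1, e2, Module.End.mul_apply, Module.End.mul_apply]
  simp only [glOp_apply, map_add, Derivation.leibniz, smul_eq_mul, glDer_X]
  rw [sub_eq_iff_eq_add] at h
  rw [h]
  simp only [eq_comm (a := l)]
  ring

variable (I) in
/-- Operators representing the orthogonal Lie algebra on polynomials. -/
noncomputable def soMatrix : Matrix I I (Module.End ℂ (MvPolynomial (I × I) ℂ)) :=
  fun i j => glOp j i - glOp i j

theorem isOrthogonal_soMatrix : IsOrthogonal (soMatrix I) where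
  anti i j := by rw [soMatrix, soMatrix, neg_sub]
  comm a b k l := by
    have h1 := glOp_comm b a l k
    have h2 := glOp_comm b a k l
    have h3 := glOp_comm a b l k
    have h4 := glOp_comm a b k l
    simp only [soMatrix]
    rw [sub_mul, mul_sub, mul_sub, mul_sub, sub_mul, sub_mul]
    have h5 := congrArg₂ (· + ·) (congrArg₂ (· - ·) h1 h2) (congrArg₂ (· - ·) h4 h3)
    calc _ = _ := by abel
      _ = _ := h5
      _ = _ := by split_ifs <;> abel

end Operators

section Degree

variable {σ : Type*}

/-- The polynomials of degree at most `e`. -/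
noncomputable def degLE (σ : Type*) (e : ℕ) : Submodule ℂ (MvPolynomial σ ℂ) :=
  Submodule.span ℂ {u | ∃ l : List σ, l.length ≤ e ∧ u = (l.map X).prod}

theorem degLE_mono {d e : ℕ} (h : d ≤ e) : degLE σ d ≤ degLE σ e :=
  Submodule.span_mono fun _ ⟨l, hl, hu⟩ => ⟨l, hl.trans h, hu⟩

theorem C_mem_degLE (r : ℂ) : (C r : MvPolynomial σ ℂ) ∈ degLE σ 0 := by
  rw [← mul_one (C r), ← smul_eq_C_mul]
  exact Submodule.smul_mem _ _ (Submodule.subset_span ⟨[], by simp, by simp⟩)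

theorem X_mul_mem_degLE (i : σ) {e : ℕ} {p : MvPolynomial σ ℂ} (hp : p ∈ degLE σ e) :
    X i * p ∈ degLE σ (e + 1) := by
  induction hp using Submodule.span_induction with
  | mem x hx =>
    obtain ⟨l, hl, rfl⟩ := hx
    exact Submodule.subset_span ⟨i :: l, by simpa using hl, by simp⟩
  | zero => simp
  | add x y _ _ hx hy => rw [mul_add]; exact add_mem hx hy
  | smul r x _ hx => rw [mul_smul_comm]; exact Submodule.smul_mem _ _ hx

theorem glDer_mem_degLE {I : Type*} [Fintype I] [DecidableEq I] (i j : I) {e : ℕ}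
    {p : MvPolynomial (I × I) ℂ} (hp : p ∈ degLE (I × I) e) : glDer i j p ∈ degLE (I × I) e := by
  induction hp using Submodule.span_induction with
  | mem x hx =>
    obtain ⟨l, hl, rfl⟩ := hx
    induction l generalizing e with
    | nil => simp
    | cons a l ih =>
      obtain ⟨e, rfl⟩ : ∃ d, e = d + 1 := ⟨e - 1, by simp at hl; omega⟩
      have hl' : l.length ≤ e := by simpa using hl
      rw [List.map_cons, List.prod_cons, Derivation.leibniz, smul_eq_mul, smul_eq_mul, glDer_X]
      refine add_mem (X_mul_mem_degLE _ (ih hl')) ?_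
      split_ifs
      · rw [mul_comm]
        exact X_mul_mem_degLE _ (Submodule.subset_span ⟨l, hl', rfl⟩)
      · simp
  | zero => simp
  | add x y _ _ hx hy => rw [map_add]; exact add_mem hx hy
  | smul r x _ hx => rw [Derivation.map_smul]; exact Submodule.smul_mem _ _ hx

/-- The value of the homogeneous component of degree `e` at a point. -/
noncomputable def topCoeff (x : σ → ℂ) (e : ℕ) : MvPolynomial σ ℂ →ₗ[ℂ] ℂ :=
  (Polynomial.lcoeff ℂ e).comp
    (aeval (R := ℂ) fun i => x i • (Polynomial.X : Polynomial ℂ)).toLinearMap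

theorem topCoeff_C (x : σ → ℂ) (r : ℂ) : topCoeff x 0 (C r) = r := by
  simp [topCoeff]

theorem topCoeff_X_mul (x : σ → ℂ) (e : ℕ) (i : σ) (p : MvPolynomial σ ℂ) :
    topCoeff x (e + 1) (X i * p) = x i * topCoeff x e p := by
  simp [topCoeff, Polynomial.coeff_X_mul]

theorem topCoeff_eq_zero (x : σ → ℂ) {d e : ℕ} (h : d < e) {p : MvPolynomial σ ℂ}
    (hp : p ∈ degLE σ d) : topCoeff x e p = 0 := by
  induction hp using Submodule.span_induction with
  | mem u hu =>
    obtain ⟨l, hl, rfl⟩ := hu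
    induction l generalizing d e with
    | nil => obtain ⟨e, rfl⟩ : ∃ d, e = d + 1 := ⟨e - 1, by omega⟩
             simp [topCoeff, Polynomial.coeff_one]
    | cons a l ih =>
      obtain ⟨e, rfl⟩ : ∃ d, e = d + 1 := ⟨e - 1, by omega⟩
      rw [List.length_cons] at hl
      rw [List.map_cons, List.prod_cons, topCoeff_X_mul, ih (d := d - 1) (by omega) (by omega), mul_zero]
  | zero => simp
  | add x y _ _ hx hy => rw [map_add, hx, hy, add_zero]
  | smul r x _ hx => rw [map_smul, hx, smul_zero]

end Degree

section Symbol

variable {I : Type*} [Fintype I] [DecidableEq I] (x : I × I → ℂ)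

/-- An operator of order at most `e` whose homogeneous part of order `e` multiplies by `c` at the
point `x`. -/
def HasScalarSymbol (e : ℕ) (T : Module.End ℂ (MvPolynomial (I × I) ℂ)) (c : ℂ) : Prop :=
  ∀ d, ∀ p ∈ degLE (I × I) d, T p ∈ degLE (I × I) (d + e) ∧
    topCoeff x (d + e) (T p) = c * topCoeff x d p

variable {x}

theorem HasScalarSymbol.add {e : ℕ} {T T' : Module.End ℂ (MvPolynomial (I × I) ℂ)} {c c' : ℂ}
    (h : HasScalarSymbol x e T c) (h' : HasScalarSymbol x e T' c') :
    HasScalarSymbol x e (T + T') (c + c') := fun d p hp => by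
  obtain ⟨h1, h2⟩ := h d p hp
  obtain ⟨h3, h4⟩ := h' d p hp
  rw [LinearMap.add_apply, map_add, h2, h4, add_mul]
  exact ⟨add_mem h1 h3, rfl⟩

theorem HasScalarSymbol.sub {e : ℕ} {T T' : Module.End ℂ (MvPolynomial (I × I) ℂ)} {c c' : ℂ}
    (h : HasScalarSymbol x e T c) (h' : HasScalarSymbol x e T' c') :
    HasScalarSymbol x e (T - T') (c - c') := fun d p hp => by
  obtain ⟨h1, h2⟩ := h d p hp
  obtain ⟨h3, h4⟩ := h' d p hp
  rw [LinearMap.sub_apply, map_sub, h2, h4, sub_mul]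
  exact ⟨sub_mem h1 h3, rfl⟩

theorem HasScalarSymbol.smul {e : ℕ} {T : Module.End ℂ (MvPolynomial (I × I) ℂ)} {c : ℂ}
    (h : HasScalarSymbol x e T c) (r : ℂ) : HasScalarSymbol x e (r • T) (r * c) := fun d p hp => by
  obtain ⟨h1, h2⟩ := h d p hp
  rw [LinearMap.smul_apply, map_smul, h2, smul_eq_mul, mul_assoc]
  exact ⟨Submodule.smul_mem _ _ h1, rfl⟩

theorem HasScalarSymbol.zero {e : ℕ} : HasScalarSymbol x e 0 0 := fun d p _ => by
  simp

theorem HasScalarSymbol.sum {ι : Type*} {s : Finset ι} {e : ℕ}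
    {T : ι → Module.End ℂ (MvPolynomial (I × I) ℂ)} {c : ι → ℂ}
    (h : ∀ i ∈ s, HasScalarSymbol x e (T i) (c i)) :
    HasScalarSymbol x e (∑ i ∈ s, T i) (∑ i ∈ s, c i) := by
  classical
  induction s using Finset.induction_on with
  | empty => exact HasScalarSymbol.zero
  | insert a s ha ih =>
    rw [Finset.sum_insert ha, Finset.sum_insert ha]
    exact (h a (by simp)).add (ih fun i hi => h i (by simp [hi]))

theorem HasScalarSymbol.mul {e e' : ℕ} {T T' : Module.End ℂ (MvPolynomial (I × I) ℂ)} {c c' : ℂ}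
    (h : HasScalarSymbol x e T c) (h' : HasScalarSymbol x e' T' c') :
    HasScalarSymbol x (e + e') (T * T') (c * c') := fun d p hp => by
  obtain ⟨h3, h4⟩ := h' d p hp
  obtain ⟨h1, h2⟩ := h _ _ h3
  rw [Module.End.mul_apply, add_comm e, ← add_assoc, h2, h4, mul_assoc]
  exact ⟨h1, rfl⟩

theorem HasScalarSymbol.one : HasScalarSymbol x 0 1 1 := fun d p hp => ⟨hp, by simp⟩

theorem HasScalarSymbol.of_lt {e e' : ℕ} {T : Module.End ℂ (MvPolynomial (I × I) ℂ)} {c : ℂ}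
    (h : HasScalarSymbol x e T c) (he : e < e') : HasScalarSymbol x e' T 0 := fun d p hp => by
  obtain ⟨h1, h2⟩ := h d p hp
  rw [zero_mul]
  exact ⟨degLE_mono (by omega) h1, topCoeff_eq_zero x (by omega) h1⟩

/-- The vector field preserves degrees, so the part that raises the degree is multiplication by a
coordinate. Evaluated at a point, symbols thus become numbers. -/
theorem hasScalarSymbol_glOp (i j : I) : HasScalarSymbol x 1 (glOp i j) (x (i, j)) :=
  fun d p hp => by
    rw [glOp_apply, map_add, topCoeff_X_mul, topCoeff_eq_zero x (Nat.lt_succ_self d)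
      (glDer_mem_degLE i j hp), add_zero]
    exact ⟨add_mem (X_mul_mem_degLE _ hp) (degLE_mono (by omega) (glDer_mem_degLE i j hp)), rfl⟩

variable (x) in
/-- The matrix of symbols of `soMatrix`. -/
def symbolMatrix : Matrix I I ℂ := fun i j => x (j, i) - x (i, j)

theorem hasScalarSymbol_soMatrix (i j : I) :
    HasScalarSymbol x 1 (soMatrix I i j) (symbolMatrix x i j) :=
  (hasScalarSymbol_glOp j i).sub (hasScalarSymbol_glOp i j)

theorem hasScalarSymbol_scalar {R : ℂ} (i j : I) : HasScalarSymbol x 1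
    ((R • (1 : Matrix I I (Module.End ℂ (MvPolynomial (I × I) ℂ)))) i j) 0 := by
  rw [Matrix.smul_apply, Matrix.one_apply]
  split_ifs
  · exact (HasScalarSymbol.one.smul R).of_lt one_pos
  · rw [smul_zero]; exact HasScalarSymbol.zero

theorem hasScalarSymbol_shifted (i j : I) :
    HasScalarSymbol x 1 ((soMatrix I + shift I • 1) i j) (symbolMatrix x i j) := by
  rw [Matrix.add_apply, ← add_zero (symbolMatrix x i j)]
  exact (hasScalarSymbol_soMatrix i j).add (hasScalarSymbol_scalar i j)

theorem hasScalarSymbol_pow (m : ℕ) (i j : I) :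
    HasScalarSymbol x m (((soMatrix I + shift I • 1) ^ m) i j) ((symbolMatrix x ^ m) i j) := by
  induction m generalizing j with
  | zero =>
    rw [pow_zero, pow_zero, Matrix.one_apply, Matrix.one_apply]
    split_ifs
    · exact HasScalarSymbol.one
    · exact HasScalarSymbol.zero
  | succ m ih =>
    rw [pow_succ, pow_succ, Matrix.mul_apply, Matrix.mul_apply]
    exact HasScalarSymbol.sum fun k _ => (ih k).mul (hasScalarSymbol_shifted k j)

theorem hasScalarSymbol_powTrace (m : ℕ) :
    HasScalarSymbol x m (powTrace (soMatrix I) m) ((symbolMatrix x ^ m).trace) :=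
  HasScalarSymbol.sum fun i _ => hasScalarSymbol_pow m i i

variable {n : ℕ}

variable (x) in
/-- An operator of order at most `e` on tensors with polynomial entries, with the given operator
as its homogeneous part of order `e` at the point `x`. -/
def HasSymbol (e : ℕ) (T : Module.End ℂ ((Fin n → I) → MvPolynomial (I × I) ℂ))
    (T₀ : Module.End ℂ ((Fin n → I) → ℂ)) : Prop :=
  ∀ d φ, (∀ f, φ f ∈ degLE (I × I) d) → ∀ f, T φ f ∈ degLE (I × I) (d + e) ∧
    topCoeff x (d + e) (T φ f) = T₀ (fun g => topCoeff x d (φ g)) f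

variable {e e' : ℕ} {T T' : Module.End ℂ ((Fin n → I) → MvPolynomial (I × I) ℂ)}
  {T₀ T₀' : Module.End ℂ ((Fin n → I) → ℂ)}

theorem HasSymbol.add (h : HasSymbol x e T T₀) (h' : HasSymbol x e T' T₀') :
    HasSymbol x e (T + T') (T₀ + T₀') := fun d φ hφ f => by
  obtain ⟨h1, h2⟩ := h d φ hφ f
  obtain ⟨h3, h4⟩ := h' d φ hφ f
  rw [LinearMap.add_apply, Pi.add_apply, map_add, h2, h4]
  exact ⟨add_mem h1 h3, rfl⟩

theorem HasSymbol.sub (h : HasSymbol x e T T₀) (h' : HasSymbol x e T' T₀') :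
    HasSymbol x e (T - T') (T₀ - T₀') := fun d φ hφ f => by
  obtain ⟨h1, h2⟩ := h d φ hφ f
  obtain ⟨h3, h4⟩ := h' d φ hφ f
  rw [LinearMap.sub_apply, Pi.sub_apply, map_sub, h2, h4]
  exact ⟨sub_mem h1 h3, rfl⟩

theorem HasSymbol.smul (h : HasSymbol x e T T₀) (r : ℂ) : HasSymbol x e (r • T) (r • T₀) :=
  fun d φ hφ f => by
    obtain ⟨h1, h2⟩ := h d φ hφ f
    rw [LinearMap.smul_apply, Pi.smul_apply, map_smul, h2]
    exact ⟨Submodule.smul_mem _ _ h1, rfl⟩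

theorem HasSymbol.zero : HasSymbol (n := n) x e 0 0 := fun d φ _ f => by simp

theorem HasSymbol.mul (h : HasSymbol x e T T₀) (h' : HasSymbol x e' T' T₀') :
    HasSymbol x (e + e') (T * T') (T₀ * T₀') := fun d φ hφ f => by
  obtain ⟨h1, h2⟩ := h _ _ (fun f => (h' d φ hφ f).1) f
  rw [Module.End.mul_apply, add_comm e, ← add_assoc, h2, Module.End.mul_apply]
  exact ⟨h1, by rw [funext fun g => (h' d φ hφ g).2]⟩

theorem HasSymbol.of_lt (h : HasSymbol x e T T₀) (he : e < e') : HasSymbol x e' T 0 :=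
  fun d φ hφ f => by
    obtain ⟨h1, h2⟩ := h d φ hφ f
    exact ⟨degLE_mono (by omega) h1, topCoeff_eq_zero x (by omega) h1⟩

theorem hasSymbol_brauerOp (γ : BrauerDiagram n) : HasSymbol x 0 (brauerOp γ) (brauerOp γ) :=
  fun d φ hφ f => by
    classical
    simp only [brauerOp_apply, add_zero, map_sum]
    refine ⟨Submodule.sum_mem _ fun g _ => ?_, Finset.sum_congr rfl fun g _ => ?_⟩
    · split_ifs
      · exact hφ g
      · exact zero_mem _
    · split_ifs
      · rfl
      · exact map_zero _

/-- A scalar matrix acting in a slot of complex tensors. -/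
noncomputable def scalarSlot (k : Fin n) (A : Matrix I I ℂ) : Module.End ℂ ((Fin n → I) → ℂ) :=
  slotOp k (A.map (algebraMap ℂ (Module.End ℂ ℂ)))

theorem scalarSlot_apply (k : Fin n) (A : Matrix I I ℂ) (φ : (Fin n → I) → ℂ) (f) :
    scalarSlot k A φ f = ∑ i, A (f k) i * φ (Function.update f k i) := rfl

theorem hasSymbol_slotOp (k : Fin n) {H : Matrix I I (Module.End ℂ (MvPolynomial (I × I) ℂ))}
    {A : Matrix I I ℂ} (h : ∀ i j, HasScalarSymbol x e (H i j) (A i j)) :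
    HasSymbol x e (slotOp k H) (scalarSlot k A) := fun d φ hφ f => by
  simp only [slotOp_apply, scalarSlot_apply, map_sum]
  exact ⟨Submodule.sum_mem _ fun i _ => (h _ _ _ _ (hφ _)).1,
    Finset.sum_congr rfl fun i _ => (h _ _ _ _ (hφ _)).2⟩

theorem hasSymbol_entryOp {S : Module.End ℂ (MvPolynomial (I × I) ℂ)} {c : ℂ}
    (h : HasScalarSymbol x e S c) : HasSymbol (n := n) x e (entryOp S) (c • 1) :=
  fun d φ hφ f => by
    obtain ⟨h1, h2⟩ := h d _ (hφ f)
    exact ⟨h1, h2⟩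

theorem hasSymbol_omegaOp {k l : Fin n} (h : k ≠ l) : HasSymbol x 1 (omegaOp k l) 0 := by
  have h1 := ((hasSymbol_brauerOp (x := x) (ofPerm (Equiv.swap k l))).sub
    (hasSymbol_brauerOp (bar k l h))).of_lt one_pos
  rwa [brauerOp_ofPerm, brauerOp_bar] at h1

/-- The Casimir operators and the shift have order zero and disappear from the symbol of order one.
-/
theorem hasSymbol_yOp (k : Fin n) :
    HasSymbol x 1 (yOp (soMatrix I) k) (scalarSlot k (symbolMatrix x)) := by
  rw [yOp, ← add_zero (scalarSlot k (symbolMatrix x))]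
  refine (hasSymbol_slotOp k hasScalarSymbol_shifted).add ?_
  have : ∀ s : Finset (Fin n), k ∉ s → HasSymbol x 1
      (∑ m ∈ s, omegaOp m k : Module.End ℂ ((Fin n → I) → MvPolynomial (I × I) ℂ)) 0 := by
    intro s
    induction s using Finset.induction_on with
    | empty => intro _; exact HasSymbol.zero
    | insert a s ha ih =>
      intro hk
      rw [Finset.mem_insert, not_or] at hk
      rw [Finset.sum_insert ha, ← add_zero (0 : Module.End ℂ ((Fin n → I) → ℂ))]
      exact (hasSymbol_omegaOp (Ne.symm hk.1)).add (ih hk.2)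
  exact this _ (by simp)

variable (x) in
/-- The symbols of the operators of the generators. -/
noncomputable def symbolGen : AffineBrauerGen n → Module.End ℂ ((Fin n → I) → ℂ)
  | b γ => brauerOp γ
  | y k => scalarSlot k (symbolMatrix x)
  | w i => (symbolMatrix x ^ i).trace • 1

theorem hasSymbol_tensorGen (g : AffineBrauerGen n) :
    HasSymbol x (wt g) (tensorGen (soMatrix I) g) (symbolGen x g) := by
  rcases g with γ | k | i
  · exact hasSymbol_brauerOp γ
  · exact hasSymbol_yOp k
  · exact hasSymbol_entryOp (hasScalarSymbol_powTrace i)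

/-- The order of an operator is bounded by its degree in the generators. Membership in `filt` can
thus be refuted by a nonzero symbol. -/
theorem hasSymbol_of_mem_filt (hT : T ∈ filt (tensorGen (soMatrix I)) e) : HasSymbol x e T 0 := by
  induction hT using Submodule.span_induction with
  | mem u hu =>
    obtain ⟨l, hl, rfl⟩ := hu
    refine HasSymbol.of_lt (T₀ := (l.map (symbolGen x)).prod) ?_ hl
    clear hl
    induction l with
    | nil => exact fun d φ hφ f => ⟨hφ f, rfl⟩
    | cons g l ih =>
      simp only [List.map_cons, List.prod_cons, List.sum_cons]
      exact (hasSymbol_tensorGen g).mul ih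
  | zero => exact HasSymbol.zero
  | add a c _ _ ha hc => simpa using ha.add hc
  | smul r a _ ha => simpa using ha.smul r

end Symbol

end TensorModel

/-! ### Prescribing power sums -/

/-- Power sums with positive exponents up to a bound can be prescribed. -/
theorem Complex.exists_sum_pow_eq (P : ℕ → ℂ) (r : ℕ) : ∃ (K : Type) (_ : Fintype K) (s : K → ℂ),
    ∀ i, 1 ≤ i → i ≤ r → ∑ k, s k ^ i = P i := by
  induction r with
  | zero => exact ⟨Empty, inferInstance, Empty.elim, fun i h1 h2 => by omega⟩
  | succ r ih =>
    obtain ⟨K, hK, s, hs⟩ := ih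
    have h0 : ((r + 1 : ℕ) : ℂ) ≠ 0 := by exact_mod_cast Nat.succ_ne_zero r
    obtain ⟨c, hc⟩ := IsAlgClosed.exists_pow_nat_eq
      ((P (r + 1) - ∑ k, s k ^ (r + 1)) / (r + 1 : ℕ)) (Nat.succ_pos r)
    have hζ := Complex.isPrimitiveRoot_exp (r + 1) (Nat.succ_ne_zero r)
    set ζ := Complex.exp (2 * Real.pi * Complex.I / (r + 1 : ℕ))
    -- The multiples of all `(r + 1)`-th roots of unity by `c` do not contribute to the power sums
    -- with exponents from 1 to `r`, and `c` corrects the next one.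
    refine ⟨K ⊕ Fin (r + 1), inferInstance, Sum.elim s fun a => c * ζ ^ (a : ℕ), fun i h1 h2 => ?_⟩
    simp only [Fintype.sum_sum_type, Sum.elim_inl, Sum.elim_inr, mul_pow, ← Finset.mul_sum]
    have e1 : ∀ a : Fin (r + 1), (ζ ^ (a : ℕ)) ^ i = (ζ ^ i) ^ (a : ℕ) := fun a => by
      rw [← pow_mul, ← pow_mul, mul_comm]
    rw [Finset.sum_congr rfl fun a _ => e1 a, Fin.sum_univ_eq_sum_range (fun a => (ζ ^ i) ^ a)]
    rcases Nat.lt_or_ge i (r + 1) with h | h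
    · have h3 : ζ ^ i ≠ 1 := hζ.pow_ne_one_of_pos_of_lt (by omega) h
      have h4 : ∑ a ∈ Finset.range (r + 1), (ζ ^ i) ^ a = 0 := by
        have := geom_sum_mul (ζ ^ i) (r + 1)
        rw [← pow_mul, mul_comm i, pow_mul, hζ.pow_eq_one, one_pow, sub_self] at this
        exact (mul_eq_zero.1 this).resolve_right (sub_ne_zero.2 h3)
      rw [h4, mul_zero, add_zero, hs i h1 (by omega)]
    · obtain rfl : i = r + 1 := by omega
      rw [hζ.pow_eq_one, hc]
      simp only [one_pow, Finset.sum_const, Finset.card_range, nsmul_eq_mul, mul_one]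
      rw [div_mul_cancel₀ _ h0]
      ring

/-! ### Matrix coefficients of symbols -/

namespace TensorModel

open BrauerDiagram AffineBrauerGen MvPolynomial

variable {n : ℕ} {I : Type*} [Fintype I] [DecidableEq I]

/-- The bilinear form on complex tensors. -/
noncomputable def pairing (φ ψ : (Fin n → I) → ℂ) : ℂ := ∑ f, φ f * ψ f

theorem pairing_smul (r : ℂ) (φ ψ : (Fin n → I) → ℂ) :
    pairing φ (r • ψ) = r * pairing φ ψ := by
  simp only [pairing, Finset.mul_sum, Pi.smul_apply, smul_eq_mul, mul_left_comm]

theorem smul_pairing (r : ℂ) (φ ψ : (Fin n → I) → ℂ) :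
    pairing (r • φ) ψ = r * pairing φ ψ := by
  simp only [pairing, Finset.mul_sum, Pi.smul_apply, smul_eq_mul, mul_assoc]

theorem pairing_scalarSlot (k : Fin n) (A : Matrix I I ℂ) (φ ψ : (Fin n → I) → ℂ) :
    pairing φ (scalarSlot k A ψ) = pairing (scalarSlot k A.transpose φ) ψ := by
  simp only [pairing, scalarSlot_apply, Finset.mul_sum, Finset.sum_mul]
  rw [← Fintype.sum_prod_type', ← Fintype.sum_prod_type']
  let F : (Fin n → I) × I → (Fin n → I) × I := fun q => (Function.update q.1 k q.2, q.1 k)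
  have hF : Function.Involutive F := fun q => by simp [F]
  refine Fintype.sum_equiv hF.toPerm _ _ fun q => ?_
  simp only [Function.Involutive.coe_toPerm, F, Function.update_self, Function.update_idem,
    Function.update_eq_self, Matrix.transpose_apply]
  ring

/-- The tensor product of vectors. -/
noncomputable def prodVec (v : Fin n → I → ℂ) : (Fin n → I) → ℂ := fun f => ∏ k, v k (f k)

theorem scalarSlot_prodVec (k : Fin n) {A : Matrix I I ℂ} {v : Fin n → I → ℂ} {μ : ℂ}
    (h : A.mulVec (v k) = μ • v k) : scalarSlot k A (prodVec v) = μ • prodVec v := by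
  funext f
  rw [scalarSlot_apply, Pi.smul_apply]
  have e1 : ∀ i, prodVec v (Function.update f k i) =
      v k i * ∏ l ∈ Finset.univ.erase k, v l (f l) := fun i => by
    rw [prodVec, ← Finset.mul_prod_erase _ _ (Finset.mem_univ k), Function.update_self]
    congr 1
    refine Finset.prod_congr rfl fun l hl => ?_
    rw [Function.update_of_ne (Finset.ne_of_mem_erase hl)]
  have e2 := e1 (f k)
  rw [Function.update_eq_self] at e2
  rw [e2]
  simp only [e1, ← mul_assoc, ← Finset.sum_mul]
  have := congrFun h (f k)
  rw [Matrix.mulVec, dotProduct, Pi.smul_apply] at this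
  rw [this, smul_eq_mul, smul_eq_mul, mul_assoc]

/-- The pairing is a sum over colourings that are constant on edges, one free colour for each edge,
so it factors into dot products along the edges. -/
theorem pairing_brauerOp (γ : BrauerDiagram n) (v : Fin n ⊕ Fin n → I → ℂ) :
    pairing (prodVec fun k => v (Sum.inl k)) (brauerOp γ (prodVec fun k => v (Sum.inr k))) =
      ∏ u : {u // vertexRank u < vertexRank (γ.mate u)}, dotProduct (v u) (v (γ.mate u)) := by
  classical
  have hne : ∀ u, vertexRank u ≠ vertexRank (γ.mate u) := fun u h =>
    γ.mate_ne u (vertexRank_injective h).symm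
  have h1 : pairing (prodVec fun k => v (Sum.inl k)) (brauerOp γ (prodVec fun k => v (Sum.inr k)))
      = ∑ c : {c : Fin n ⊕ Fin n → I // γ.Compat c}, ∏ u, v u (c.1 u) := by
    rw [← Finset.sum_subtype (Finset.univ.filter fun c : Fin n ⊕ Fin n → I => γ.Compat c)
      (by simp) (fun c => ∏ u, v u (c u)), Finset.sum_filter,
      ← (Equiv.sumArrowEquivProdArrow (Fin n) (Fin n) I).symm.sum_comp, Fintype.sum_prod_type]
    refine Finset.sum_congr rfl fun f _ => ?_
    rw [brauerOp_apply, Finset.mul_sum]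
    refine Finset.sum_congr rfl fun g _ => ?_
    have e : (Equiv.sumArrowEquivProdArrow (Fin n) (Fin n) I).symm (f, g) = Sum.elim f g := rfl
    rw [e, Fintype.prod_sum_type, mul_ite, mul_zero]
    rfl
  let E : {c : Fin n ⊕ Fin n → I // γ.Compat c} ≃
      ({u // vertexRank u < vertexRank (γ.mate u)} → I) :=
    { toFun c u := c.1 u
      invFun d := ⟨fun u => if h : vertexRank u < vertexRank (γ.mate u) then d ⟨u, h⟩ else
        d ⟨γ.mate u, by rw [γ.mate_mate]; exact lt_of_le_of_ne (not_lt.1 h) (hne u).symm⟩, by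
          intro u
          dsimp only
          by_cases h : vertexRank u < vertexRank (γ.mate u)
          · have h' : ¬ vertexRank (γ.mate u) < vertexRank (γ.mate (γ.mate u)) := by
              rw [γ.mate_mate]; exact h.not_gt
            rw [dif_pos h, dif_neg h']
            congr 2
            exact γ.mate_mate u
          · have h' : vertexRank (γ.mate u) < vertexRank (γ.mate (γ.mate u)) := by
              rw [γ.mate_mate]; exact lt_of_le_of_ne (not_lt.1 h) (hne u).symm
            rw [dif_neg h, dif_pos h']⟩
      left_inv c := by
        refine Subtype.ext (funext fun u => ?_)
        dsimp only
        split_ifs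
        · rfl
        · exact c.2 u
      right_inv d := by
        funext u
        dsimp only
        rw [dif_pos u.2] }
  have h2 : ∀ c : {c : Fin n ⊕ Fin n → I // γ.Compat c}, ∏ u, v u (c.1 u) =
      ∏ u : {u // vertexRank u < vertexRank (γ.mate u)}, (v u (E c u) * v (γ.mate u) (E c u)) := by
    intro c
    rw [Finset.prod_mul_distrib, ← Fintype.prod_subtype_mul_prod_subtype
      (fun u => vertexRank u < vertexRank (γ.mate u))]
    congr 1
    refine Fintype.prod_equiv
      { toFun u := ⟨γ.mate u, by
          rw [γ.mate_mate]; exact lt_of_le_of_ne (not_lt.1 u.2) (hne u).symm⟩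
        invFun u := ⟨γ.mate u, by rw [γ.mate_mate]; exact u.2.not_gt⟩
        left_inv u := Subtype.ext (γ.mate_mate u)
        right_inv u := Subtype.ext (γ.mate_mate u) } _ _ fun u => ?_
    show v u (c.1 u) = v (γ.mate (γ.mate u)) (c.1 (γ.mate u))
    rw [γ.mate_mate, c.2]
  rw [h1, Finset.sum_congr rfl fun c _ => h2 c, E.sum_comp fun d =>
    ∏ u : {u // vertexRank u < vertexRank (γ.mate u)}, (v u (d u) * v (γ.mate u) (d u))]
  simp only [dotProduct]
  rw [Finset.prod_univ_sum, Fintype.piFinset_univ]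

section Evaluation

variable {x : I × I → ℂ} {ξ η : (Fin n → I) → ℂ} {θ : (Fin n ⊕ Fin n) ⊕ ℕ → ℂ}

/-- `T` has order at most `e`, and `v` is the matrix coefficient of its symbol of order `e`. -/
def HasCoeff (x : I × I → ℂ) (ξ η : (Fin n → I) → ℂ) (e : ℕ)
    (T : Module.End ℂ ((Fin n → I) → MvPolynomial (I × I) ℂ)) (v : ℂ) : Prop :=
  ∃ T₀, HasSymbol x e T T₀ ∧ pairing ξ (T₀ η) = v

theorem HasCoeff.vop (h1 : ∀ k φ, pairing ξ (scalarSlot k (symbolMatrix x) φ) =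
      θ (Sum.inl (Sum.inl k)) * pairing ξ φ)
    (h2 : ∀ k, scalarSlot k (symbolMatrix x) η = θ (Sum.inl (Sum.inr k)) • η)
    (h3 : ∀ i, (symbolMatrix x ^ (2 * i)).trace = θ (Sum.inr i)) (u) {e : ℕ}
    {T : Module.End ℂ ((Fin n → I) → MvPolynomial (I × I) ℂ)} {v : ℂ}
    (h : HasCoeff x ξ η e T v) :
    HasCoeff x ξ η (e + vwt u) (vop (tensorGen (soMatrix I)) u T) (θ u * v) := by
  obtain ⟨T₀, hT, rfl⟩ := h
  rcases u with (k | k) | i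
  · refine ⟨scalarSlot k (symbolMatrix x) * T₀, ?_, h1 k _⟩
    rw [add_comm]
    exact (hasSymbol_tensorGen (.y k)).mul hT
  · refine ⟨T₀ * scalarSlot k (symbolMatrix x), hT.mul (hasSymbol_tensorGen (.y k)), ?_⟩
    rw [Module.End.mul_apply, h2, map_smul, pairing_smul]
  · refine ⟨((symbolMatrix x ^ (2 * i)).trace • 1) * T₀, ?_, ?_⟩
    · rw [add_comm]
      exact (hasSymbol_tensorGen (.w (2 * i))).mul hT
    · rw [smul_mul_assoc, one_mul, LinearMap.smul_apply, pairing_smul, h3]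

/-- Between eigenvectors of the symbols, left and right multiplications by `y k` become numbers. The
polynomial is then simply evaluated at the eigenvalues and traces. -/
theorem HasCoeff.act [Nonempty I] (h1 : ∀ k φ, pairing ξ (scalarSlot k (symbolMatrix x) φ) =
      θ (Sum.inl (Sum.inl k)) * pairing ξ φ)
    (h2 : ∀ k, scalarSlot k (symbolMatrix x) η = θ (Sum.inl (Sum.inr k)) • η)
    (h3 : ∀ i, (symbolMatrix x ^ (2 * i)).trace = θ (Sum.inr i)) {p : VertexPoly n} {e : ℕ}
    (hp : IsWeightedHomogeneous vwt p e) (γ : BrauerDiagram n) :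
    HasCoeff x ξ η e ((isAffineBrauerModel isOrthogonal_soMatrix).act p (brauerOp γ))
      (aeval θ p * pairing ξ (brauerOp γ η)) := by
  set hm := isAffineBrauerModel (n := n) (isOrthogonal_soMatrix (I := I))
  have key : ∀ m {d : ℕ} {T : Module.End ℂ ((Fin n → I) → MvPolynomial (I × I) ℂ)} {v : ℂ},
      HasCoeff x ξ η d T v → HasCoeff x ξ η (d + Finsupp.weight vwt m)
        (hm.act (monomial m 1) T) (aeval θ (monomial m (1 : ℂ)) * v) := by
    intro m
    induction m using Finsupp.induction_linear with
    | zero => intro d T v h; simpa using h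
    | add f g hf hg =>
      intro d T v h
      have : (monomial (f + g) (1 : ℂ) : VertexPoly n) = monomial g 1 * monomial f 1 := by
        rw [monomial_mul, one_mul, add_comm]
      rw [this, map_mul, map_mul, Module.End.mul_apply, map_add, ← add_assoc, mul_assoc]
      exact hg (hf h)
    | single u k =>
      rw [Finsupp.weight_single, ← X_pow_eq_monomial, map_pow, map_pow, hm.act_X, aeval_X]
      induction k with
      | zero => intro d T v h; simpa using h
      | succ k ih =>
        intro d T v h
        rw [pow_succ, pow_succ, Module.End.mul_apply, add_smul, one_smul, add_comm (k • _),
          ← add_assoc, mul_assoc]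
        exact ih (HasCoeff.vop h1 h2 h3 u h)
  -- Pairs of an operator and its coefficient form a subspace, which allows the passage from
  -- monomials to homogeneous polynomials by linearity.
  let W : Submodule ℂ (Module.End ℂ ((Fin n → I) → MvPolynomial (I × I) ℂ) × ℂ) :=
    { carrier := {q | HasCoeff x ξ η e q.1 q.2}
      add_mem' := by
        rintro a c ⟨A, hA, hA'⟩ ⟨B, hB, hB'⟩
        refine ⟨A + B, hA.add hB, ?_⟩
        rw [Prod.snd_add, ← hA', ← hB', LinearMap.add_apply]
        simp [pairing, mul_add, Finset.sum_add_distrib]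
      zero_mem' := ⟨0, HasSymbol.zero, by simp [pairing]⟩
      smul_mem' := by
        rintro r a ⟨A, hA, hA'⟩
        refine ⟨r • A, hA.smul r, ?_⟩
        rw [Prod.smul_snd, ← hA', LinearMap.smul_apply, pairing_smul, smul_eq_mul] }
  refine hp.map_mem (((LinearMap.applyₗ (brauerOp γ)).comp hm.act.toLinearMap).prod
    ((LinearMap.mulRight ℂ (pairing ξ (brauerOp γ η))).comp (aeval θ).toLinearMap)) W
    fun m hmd => ?_
  have := key m ⟨brauerOp γ, hasSymbol_brauerOp γ, rfl⟩
  rw [zero_add, hmd] at this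
  exact this

/-- An operator in `filt e` has zero symbol of order `e`. The two computations of the symbol of the
sum are compared on the tensor `η`. -/
theorem sum_aeval_mul_pairing [Nonempty I]
    (h1 : ∀ k φ, pairing ξ (scalarSlot k (symbolMatrix x) φ) =
      θ (Sum.inl (Sum.inl k)) * pairing ξ φ)
    (h2 : ∀ k, scalarSlot k (symbolMatrix x) η = θ (Sum.inl (Sum.inr k)) • η)
    (h3 : ∀ i, (symbolMatrix x ^ (2 * i)).trace = θ (Sum.inr i)) {p : BrauerDiagram n → VertexPoly n}
    {e : ℕ} (hp : ∀ γ, IsWeightedHomogeneous vwt (p γ) e)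
    (h : ∑ γ, (isAffineBrauerModel isOrthogonal_soMatrix).act (p γ) (brauerOp γ) ∈
      filt (tensorGen (soMatrix I)) e) :
    ∑ γ, aeval θ (p γ) * pairing ξ (brauerOp γ η) = 0 := by
  classical
  choose T₀ hT hv using fun γ => HasCoeff.act h1 h2 h3 (hp γ) γ
  have h4 : ∀ s : Finset (BrauerDiagram n), HasSymbol x e
      (∑ γ ∈ s, (isAffineBrauerModel isOrthogonal_soMatrix).act (p γ) (brauerOp γ))
      (∑ γ ∈ s, T₀ γ) := by
    intro s
    induction s using Finset.induction_on with
    | empty => exact HasSymbol.zero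
    | insert a s ha ih => rw [Finset.sum_insert ha, Finset.sum_insert ha]; exact (hT a).add ih
  -- Tensors of constants have degree zero and are their own top part, so they read off the symbol
  -- at `η`.
  have h5 := fun f => ((h4 Finset.univ 0 (fun f => C (η f)) fun f => C_mem_degLE _) f).2
  have h6 := fun f => ((hasSymbol_of_mem_filt (x := x) h 0 (fun f => C (η f))
    fun f => C_mem_degLE _) f).2
  simp only [topCoeff_C] at h5 h6
  have h7 : (∑ γ, T₀ γ) η = 0 := funext fun f => (h5 f).symm.trans (h6 f)
  rw [← Finset.sum_congr rfl fun γ _ => hv γ]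
  have h8 : ∑ γ, pairing ξ (T₀ γ η) = pairing ξ ((∑ γ, T₀ γ) η) := by
    simp only [pairing, LinearMap.sum_apply, Finset.sum_apply, Finset.mul_sum]
    exact Finset.sum_comm
  rw [h8, h7]
  simp [pairing]

end Evaluation

end TensorModel

/-! ### Eigenvectors adapted to a diagram, and independence in the tensor models -/

namespace TensorModel

open BrauerDiagram AffineBrauerGen MvPolynomial

section Eigenvectors

variable {J : Type*} [Fintype J] [DecidableEq J] (t : J → ℂ)

/-- An antisymmetric matrix with eigenvalues `± t j`. -/
noncomputable def skewMatrix : Matrix (J ⊕ J) (J ⊕ J) ℂ :=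
  Matrix.fromBlocks 0 (Matrix.diagonal fun j => -(Complex.I * t j))
    (Matrix.diagonal fun j => Complex.I * t j) 0

/-- The coordinates at which `soMatrix` has the symbol `skewMatrix`. -/
noncomputable def skewPoint (p : (J ⊕ J) × (J ⊕ J)) : ℂ := -skewMatrix t p.1 p.2 / 2

theorem skewMatrix_transpose : (skewMatrix t).transpose = -skewMatrix t := by
  rw [skewMatrix, Matrix.fromBlocks_transpose, Matrix.fromBlocks_neg]
  simp [Matrix.diagonal_transpose, Matrix.diagonal_neg]

theorem symbolMatrix_skewPoint : symbolMatrix (skewPoint t) = skewMatrix t := by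
  ext a c
  have h : skewMatrix t c a = -skewMatrix t a c := congrFun (congrFun (skewMatrix_transpose t) a) c
  rw [symbolMatrix, skewPoint, skewPoint]
  simp only [h]
  ring

theorem trace_skewMatrix_pow (i : ℕ) : (skewMatrix t ^ (2 * i)).trace = 2 * ∑ j, t j ^ (2 * i) := by
  have h : skewMatrix t ^ 2 = Matrix.fromBlocks (Matrix.diagonal fun j => t j ^ 2) 0 0
      (Matrix.diagonal fun j => t j ^ 2) := by
    rw [pow_two, skewMatrix, Matrix.fromBlocks_multiply]
    simp only [zero_mul, mul_zero, zero_add, add_zero, Matrix.diagonal_mul_diagonal]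
    congr 2 <;> funext j <;> ring_nf <;> simp
  rw [pow_mul, h, Matrix.fromBlocks_diagonal_pow, Matrix.trace, Fintype.sum_sum_type]
  simp [Matrix.diagonal_pow, ← pow_mul, two_mul]

/-- Eigenvectors of `skewMatrix`. -/
noncomputable def skewVec (s : ℂ) (j : J) : J ⊕ J → ℂ :=
  Sum.elim (Pi.single j 1) (Pi.single j (s * Complex.I))

theorem skewMatrix_mulVec {s : ℂ} (hs : s * s = 1) (j : J) :
    (skewMatrix t).mulVec (skewVec s j) = (s * t j) • skewVec s j := by
  rw [skewMatrix, skewVec, Matrix.fromBlocks_mulVec]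
  simp only [Sum.elim_comp_inl, Sum.elim_comp_inr, Matrix.zero_mulVec, zero_add, add_zero]
  funext a
  rcases a with a | a <;> simp only [Sum.elim_inl, Sum.elim_inr, Pi.smul_apply,
    Matrix.mulVec_diagonal, Pi.single_apply, smul_eq_mul] <;> split_ifs with h
  · subst h; ring_nf; simp [mul_comm]
  · simp
  · subst h; linear_combination (-(Complex.I * t a)) * hs
  · simp

theorem skewVec_dot (s s' : ℂ) (j j' : J) :
    dotProduct (skewVec s j) (skewVec s' j') = if j = j' then 1 - s * s' else 0 := by
  simp only [dotProduct, Fintype.sum_sum_type, skewVec, Sum.elim_inl, Sum.elim_inr]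
  split_ifs with h
  · subst h
    simp [Pi.single_apply]
    linear_combination s * s' * Complex.I_mul_I
  · simp [Pi.single_apply, Ne.symm h]

end Eigenvectors

variable {n : ℕ}

/-- The eigenvectors at the vertices of a diagram that pair to zero except along its edges. -/
noncomputable def edgeVec {J : Type*} [DecidableEq J] (γ : BrauerDiagram n) (u : Fin n ⊕ Fin n) :
    ((Fin n ⊕ Fin n) ⊕ J) ⊕ ((Fin n ⊕ Fin n) ⊕ J) → ℂ :=
  skewVec (if vertexRank u < vertexRank (γ.mate u) then 1 else -1) (Sum.inl (edgeRep γ u))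

theorem edgeRep_eq_iff (γ : BrauerDiagram n) (u v : Fin n ⊕ Fin n) :
    edgeRep γ u = edgeRep γ v ↔ u = v ∨ v = γ.mate u := by
  have h1 := γ.mate_mate u
  have h2 := γ.mate_mate v
  have hne : ∀ u, vertexRank u ≠ vertexRank (γ.mate u) := fun u h =>
    γ.mate_ne u (vertexRank_injective h).symm
  constructor
  · simp only [edgeRep]
    split_ifs with h3 h4 h4
    · exact Or.inl
    · rintro rfl; rw [h2]; exact Or.inr rfl
    · rintro rfl; exact Or.inr rfl
    · intro h; left; rw [← h1, h, h2]
  · rintro (rfl | rfl)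
    · rfl
    · simp only [edgeRep, h1]
      have := hne u
      split_ifs with h3 h4 h4
      · omega
      · rfl
      · rfl
      · omega

/-- The two ends of an edge carry the eigenvectors with signs `1` and `-1` for the same index. Each
is isotropic, the two pair to 2, and different edges use different coordinates. -/
theorem edgeVec_dot {J : Type*} [Fintype J] [DecidableEq J] (γ : BrauerDiagram n)
    (u v : Fin n ⊕ Fin n) :
    dotProduct (edgeVec (J := J) γ u) (edgeVec γ v) = if v = γ.mate u then 2 else 0 := by
  have hne : ∀ u, vertexRank u ≠ vertexRank (γ.mate u) := fun u h =>
    γ.mate_ne u (vertexRank_injective h).symm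
  rw [edgeVec, edgeVec, skewVec_dot]
  simp only [Sum.inl.injEq, edgeRep_eq_iff]
  by_cases h1 : v = γ.mate u
  · subst h1
    have := hne u
    rw [if_pos (Or.inr rfl), if_pos rfl, γ.mate_mate]
    split_ifs <;> first | omega | norm_num
  · rw [if_neg h1]
    by_cases h2 : u = v
    · subst h2
      rw [if_pos (Or.inl rfl)]
      split_ifs <;> norm_num
    · rw [if_neg (by tauto)]

/-- The product over the edges of `γ` survives only if each of them is an edge of `γ'`. -/
theorem pairing_edgeVec {J : Type*} [Fintype J] [DecidableEq J] (γ γ' : BrauerDiagram n) :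
    pairing (prodVec fun k => edgeVec (J := J) γ' (Sum.inl k))
      (brauerOp γ (prodVec fun k => edgeVec γ' (Sum.inr k))) ≠ 0 ↔ γ = γ' := by
  rw [pairing_brauerOp, Finset.prod_ne_zero_iff]
  simp only [edgeVec_dot, Finset.mem_univ, true_implies, Subtype.forall]
  constructor
  · intro h
    have key : ∀ u, vertexRank u < vertexRank (γ.mate u) → γ.mate u = γ'.mate u := by
      intro u hu
      have := h u hu
      by_contra h'
      rw [if_neg h'] at this
      exact this rfl
    refine BrauerDiagram.ext (funext fun u => ?_)
    rcases lt_trichotomy (vertexRank u) (vertexRank (γ.mate u)) with h1 | h1 | h1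
    · exact key u h1
    · exact absurd (vertexRank_injective h1).symm (γ.mate_ne u)
    · have h2 := key (γ.mate u) (by rwa [γ.mate_mate])
      rw [γ.mate_mate] at h2
      conv_rhs => rw [h2]
      rw [γ'.mate_mate]
  · rintro rfl u _
    rw [if_pos rfl]
    norm_num

/-- If a combination of diagrams with homogeneous polynomial coefficients has lower order in the
tensor models, then its coefficients vanish modulo the relations along the edges. -/
theorem reduce_eq_zero (hn : 0 < n) {p : BrauerDiagram n → VertexPoly n} {e : ℕ}
    (hp : ∀ γ, IsWeightedHomogeneous vwt (p γ) e)
    (h : ∀ (I : Type) [Fintype I] [DecidableEq I] [Nonempty I],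
      ∑ γ, (isAffineBrauerModel (n := n) (isOrthogonal_soMatrix (I := I))).act (p γ) (brauerOp γ) ∈
        filt (tensorGen (soMatrix I)) e) (γ : BrauerDiagram n) : reduce γ (p γ) = 0 := by
  classical
  refine MvPolynomial.funext fun x => ?_
  rw [map_zero]
  -- The values at all vertices determined by `x`: free on the first vertex of each edge, forced on
  -- the second.
  set θ : (Fin n ⊕ Fin n) ⊕ ℕ → ℂ := Sum.elim
    (fun u => repSign γ u * x (Sum.inl (edgeRep γ u))) (fun i => x (Sum.inr i)) with hθ
  have h1 : eval x (reduce γ (p γ)) = aeval θ (p γ) := by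
    have : (aeval x).comp (reduce γ) = (aeval θ : VertexPoly n →ₐ[ℂ] ℂ) := by
      refine algHom_ext fun v => ?_
      rcases v with u | i <;> simp [reduce, hθ]
    rw [← this]; rfl
  rw [h1]
  -- At upper vertices the matrix acts through its transpose, which reverses the sign. In terms of
  -- `ν` every edge joins opposite eigenvalues, whether or not it changes rows.
  set ν : Fin n ⊕ Fin n → ℂ := fun u => (if u.isLeft then -1 else 1) * θ (Sum.inl u) with hν
  have hνm : ∀ u, ν (γ.mate u) = -ν u := by
    intro u
    have hr := (edgeRep_eq_iff γ u (γ.mate u)).2 (Or.inr rfl)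
    have hs : repSign γ (γ.mate u) = edgeSign u (γ.mate u) * repSign γ u := by
      have hne : vertexRank u ≠ vertexRank (γ.mate u) := fun h =>
        γ.mate_ne u (vertexRank_injective h).symm
      simp only [repSign, γ.mate_mate]
      have := edgeSign_mul_self u (γ.mate u)
      have := edgeSign_comm u (γ.mate u)
      split_ifs <;> first | omega | simp_all
    simp only [hν, hθ, Sum.elim_inl, ← hr, hs, edgeSign]
    rcases hu : u with a | a <;> rcases hv : γ.mate (Sum.inl a) with c | c <;>
      rcases hw : γ.mate (Sum.inr a) with d | d <;> simp_all
  obtain ⟨r, hr⟩ : ∃ r : ℕ, ∀ i, Sum.inr i ∈ (p γ).vars → i ≤ r := by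
    refine ⟨(p γ).vars.sup (Sum.elim (fun _ => 0) id), fun i hi => ?_⟩
    exact Finset.le_sup (f := Sum.elim (fun _ => 0) id) hi
  -- The edge eigenvalues already contribute to the traces. The additional squared eigenvalues `s`
  -- correct the finitely many traces that occur in `p γ`.
  obtain ⟨K, _, s, hs⟩ := Complex.exists_sum_pow_eq
    (fun i => x (Sum.inr i) / 2 - ∑ u, ν u ^ (2 * i)) r
  choose z hz using fun k => IsAlgClosed.exists_pow_nat_eq (s k) two_pos
  -- The size of the index set cannot be prescribed freely, so the variable of `w 0` is kept and
  -- treated as an unknown.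
  set P : Polynomial ℂ := aeval (fun v => if v = Sum.inr 0 then Polynomial.X else
    Polynomial.C (θ v)) (p γ) with hP
  have hPeval : ∀ a, P.eval a = aeval (Function.update θ (Sum.inr 0) a) (p γ) := by
    intro a
    rw [hP, ← Polynomial.coe_aeval_eq_eval, ← AlgHom.comp_apply]
    congr 1
    refine algHom_ext fun v => ?_
    by_cases hv : v = Sum.inr 0 <;> simp [hv]
  have hroot : ∀ N : ℕ, P.eval ((2 * (2 * n + Fintype.card K + N) : ℕ) : ℂ) = 0 := by
    intro N
    -- The `N` zero eigenvalues change none of the traces with positive exponent, but since `0 ^ 0 =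
    -- 1` they enlarge the trace for exponent zero.
    let t : (Fin n ⊕ Fin n) ⊕ (K ⊕ Fin N) → ℂ := Sum.elim ν (Sum.elim z 0)
    set θ' : (Fin n ⊕ Fin n) ⊕ ℕ → ℂ := Sum.elim (fun u => θ (Sum.inl u))
      (fun i => 2 * ∑ j, t j ^ (2 * i)) with hθ'
    have hvec : ∀ u, (skewMatrix t).mulVec (edgeVec γ u) = ν u • edgeVec γ u := by
      intro u
      rw [edgeVec, skewMatrix_mulVec]
      · congr 1
        by_cases hu : vertexRank u < vertexRank (γ.mate u)
        · simp [t, hu, edgeRep]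
        · simp [t, hu, edgeRep, hνm]
      · split_ifs <;> norm_num
    have : Nonempty (((Fin n ⊕ Fin n) ⊕ (K ⊕ Fin N)) ⊕ ((Fin n ⊕ Fin n) ⊕ (K ⊕ Fin N))) :=
      ⟨Sum.inl (Sum.inl (Sum.inl ⟨0, hn⟩))⟩
    have hsum := sum_aeval_mul_pairing (x := skewPoint t) (θ := θ')
      (ξ := prodVec fun k => edgeVec γ (Sum.inl k)) (η := prodVec fun k => edgeVec γ (Sum.inr k))
      (fun k φ => by
        rw [symbolMatrix_skewPoint, pairing_scalarSlot, scalarSlot_prodVec (μ := -ν (Sum.inl k)),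
          smul_pairing]
        · simp [hν, hθ']
        · rw [skewMatrix_transpose, Matrix.neg_mulVec, hvec, neg_smul])
      (fun k => by
        rw [symbolMatrix_skewPoint, scalarSlot_prodVec k (hvec _)]
        simp [hν, hθ'])
      (fun i => by rw [symbolMatrix_skewPoint, trace_skewMatrix_pow]; rfl) hp (h _)
    rw [Finset.sum_eq_single γ] at hsum
    · have h2 := (mul_eq_zero.1 hsum).resolve_right ((pairing_edgeVec γ γ).2 rfl)
      rw [hPeval, ← h2]
      refine eval₂Hom_congr' rfl (fun v hv _ => ?_) rfl
      rcases v with u | i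
      · simp [hθ']
      · rcases Nat.eq_zero_or_pos i with rfl | hi
        · simp [hθ']
          ring
        · rw [Function.update_of_ne (by simpa using hi.ne')]
          have h3 := hs i hi (hr i hv)
          simp only [hθ', Sum.elim_inr, Fintype.sum_sum_type, t, Sum.elim_inl, Pi.zero_apply] at h3 ⊢
          simp only [pow_mul, hz, h3]
          simp [hθ, hi.ne']
          ring
    · intro δ _ hδ
      rw [not_not.1 (mt (pairing_edgeVec δ γ).1 hδ), mul_zero]
    · simp
  have hP0 : P = 0 := by
    refine Polynomial.eq_zero_of_infinite_isRoot P (Set.Infinite.mono ?_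
      (Set.infinite_range_of_injective (f := fun N : ℕ =>
        ((2 * (2 * n + Fintype.card K + N) : ℕ) : ℂ)) fun a c hac => by
          have : (2 * (2 * n + Fintype.card K + a) : ℕ) = 2 * (2 * n + Fintype.card K + c) := by
            simpa only [Nat.cast_inj] using hac
          omega))
    rintro _ ⟨N, rfl⟩
    exact hroot N
  have h4 := hPeval (θ (Sum.inr 0))
  rw [Function.update_eq_self, hP0, Polynomial.eval_zero] at h4
  exact h4.symm

end TensorModel

/-! ### Transport of models and the universal property -/

namespace IsAffineBrauerModel

open AffineBrauerGen BrauerDiagram MvPolynomial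

variable {n : ℕ} {A B : Type*} [Ring A] [Algebra ℂ A] [Ring B] [Algebra ℂ B]
  {gen : AffineBrauerGen n → A}

theorem map (hm : IsAffineBrauerModel gen) (f : A →ₐ[ℂ] B) :
    IsAffineBrauerModel fun g => f (gen g) where
  b_one := by simpa only [map_one] using congrArg f hm.b_one
  b_mul γ γ' := by simpa only [map_mul, map_pow] using congrArg f (hm.b_mul γ γ')
  y_comm k l := by simpa only [map_mul] using congrArg f (hm.y_comm k l)
  w_central i g := by simpa only [map_mul] using congrArg f (hm.w_central i g)
  s_y k hk l h h' := by simpa only [map_mul] using congrArg f (hm.s_y k hk l h h')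
  sbar_y k hk l h h' := by simpa only [map_mul] using congrArg f (hm.sbar_y k hk l h h')
  s_y_self k hk := by simpa only [map_mul, map_sub, map_one] using congrArg f (hm.s_y_self k hk)
  s_y_succ k hk := by simpa only [map_mul, map_sub, map_one] using congrArg f (hm.s_y_succ k hk)
  sbar_mul_y_add k hk := by
    simpa only [map_mul, map_add, map_zero] using congrArg f (hm.sbar_mul_y_add k hk)
  y_add_mul_sbar k hk := by
    simpa only [map_mul, map_add, map_zero] using congrArg f (hm.y_add_mul_sbar k hk)
  sbar_y_pow_sbar h i hi := by
    simpa only [map_mul, map_pow] using congrArg f (hm.sbar_y_pow_sbar h i hi)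
  w_odd i hi := by
    simpa only [map_mul, map_pow, map_add, map_sum, map_neg, map_one, map_smul] using
      congrArg f (hm.w_odd i hi)

theorem of_map {f : A →ₐ[ℂ] B} (hf : Function.Injective f)
    (hm : IsAffineBrauerModel fun g => f (gen g)) : IsAffineBrauerModel gen where
  b_one := hf (by simpa only [map_one] using hm.b_one)
  b_mul γ γ' := hf (by simpa only [map_mul, map_pow] using hm.b_mul γ γ')
  y_comm k l := hf (by simpa only [map_mul] using hm.y_comm k l)
  w_central i g := hf (by simpa only [map_mul] using hm.w_central i g)
  s_y k hk l h h' := hf (by simpa only [map_mul] using hm.s_y k hk l h h')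
  sbar_y k hk l h h' := hf (by simpa only [map_mul] using hm.sbar_y k hk l h h')
  s_y_self k hk := hf (by simpa only [map_mul, map_sub, map_one] using hm.s_y_self k hk)
  s_y_succ k hk := hf (by simpa only [map_mul, map_sub, map_one] using hm.s_y_succ k hk)
  sbar_mul_y_add k hk := hf (by
    simpa only [map_mul, map_add, map_zero] using hm.sbar_mul_y_add k hk)
  y_add_mul_sbar k hk := hf (by
    simpa only [map_mul, map_add, map_zero] using hm.y_add_mul_sbar k hk)
  sbar_y_pow_sbar h i hi := hf (by
    simpa only [map_mul, map_pow] using hm.sbar_y_pow_sbar h i hi)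
  w_odd i hi := hf (by
    simpa only [map_mul, map_pow, map_add, map_sum, map_neg, map_one, map_smul] using hm.w_odd i hi)

theorem map_act (hm : IsAffineBrauerModel gen) (f : A →ₐ[ℂ] B)
    (hm' : IsAffineBrauerModel fun g => f (gen g)) (p : VertexPoly n) (x : A) :
    f (hm.act p x) = hm'.act p (f x) := by
  induction p using MvPolynomial.induction_on generalizing x with
  | C r =>
    rw [← algebraMap_eq, AlgHom.commutes, AlgHom.commutes, Module.algebraMap_end_apply,
      Module.algebraMap_end_apply, map_smul]
  | add p q hp hq => rw [map_add, map_add, LinearMap.add_apply, LinearMap.add_apply, map_add, hp, hq]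
  | mul_X p v hp =>
    rw [hm.act_mul_apply, hm'.act_mul_apply, hp, hm.act_X, hm'.act_X]
    congr 1
    rcases v with (k | k) | i <;> simp [vop]

end IsAffineBrauerModel

namespace AffineBrauer

open AffineBrauerGen BrauerDiagram MvPolynomial

variable {n : ℕ} {N : ℂ}

variable (n N) in
/-- The generators of the affine Brauer algebra. -/
noncomputable def gen (g : AffineBrauerGen n) : AffineBrauer n N :=
  RingQuot.mkAlgHom ℂ (AffineBrauerRel n N) (of g)

theorem gen_w_zero : gen n N (.w 0) = algebraMap ℂ _ N := by
  have := RingQuot.mkAlgHom_rel ℂ (AffineBrauerRel.w_zero (n := n) (N := N))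
  rwa [AlgHom.commutes] at this

theorem adjoin_range_gen : Algebra.adjoin ℂ (Set.range (gen n N)) = ⊤ := by
  have h : Set.range (gen n N) = RingQuot.mkAlgHom ℂ (AffineBrauerRel n N) ''
      Set.range (FreeAlgebra.ι ℂ) := by
    rw [← Set.range_comp]; rfl
  rw [h, ← AlgHom.map_adjoin, FreeAlgebra.adjoin_range_ι, Algebra.map_top,
    AlgHom.range_eq_top]
  exact RingQuot.mkAlgHom_surjective ℂ _

theorem isAffineBrauerModel_gen : IsAffineBrauerModel (gen n N) where
  b_one := by
    have h₀ := RingQuot.mkAlgHom_rel ℂ (AffineBrauerRel.b_one (n := n) (N := N))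
    simp only [map_one] at h₀
    exact h₀
  b_mul γ γ' := by
    have := RingQuot.mkAlgHom_rel ℂ (AffineBrauerRel.b_mul (N := N) γ γ')
    rw [map_mul, map_smul, Algebra.smul_def, map_pow] at this
    rw [gen_w_zero]
    exact this
  y_comm k l := by
    have h₀ := RingQuot.mkAlgHom_rel ℂ (AffineBrauerRel.y_comm (N := N) k l)
    simp only [map_mul] at h₀
    exact h₀
  w_central i g := by
    have h₀ := RingQuot.mkAlgHom_rel ℂ (AffineBrauerRel.w_central (N := N) i g)
    simp only [map_mul] at h₀
    exact h₀
  s_y k hk l h h' := by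
    have h₀ := RingQuot.mkAlgHom_rel ℂ (AffineBrauerRel.s_y (N := N) k hk l h h')
    simp only [map_mul] at h₀
    exact h₀
  sbar_y k hk l h h' := by
    have h₀ := RingQuot.mkAlgHom_rel ℂ (AffineBrauerRel.sbar_y (N := N) k hk l h h')
    simp only [map_mul] at h₀
    exact h₀
  s_y_self k hk := by
    have h₀ := RingQuot.mkAlgHom_rel ℂ (AffineBrauerRel.s_y_self (N := N) k hk)
    simp only [map_mul, map_sub, map_one] at h₀
    exact h₀
  s_y_succ k hk := by
    have h₀ := RingQuot.mkAlgHom_rel ℂ (AffineBrauerRel.s_y_succ (N := N) k hk)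
    simp only [map_mul, map_sub, map_one] at h₀
    exact h₀
  sbar_mul_y_add k hk := by
    have h₀ := RingQuot.mkAlgHom_rel ℂ (AffineBrauerRel.sbar_mul_y_add (N := N) k hk)
    simp only [map_mul, map_add, map_zero] at h₀
    exact h₀
  y_add_mul_sbar k hk := by
    have h₀ := RingQuot.mkAlgHom_rel ℂ (AffineBrauerRel.y_add_mul_sbar (N := N) k hk)
    simp only [map_mul, map_add, map_zero] at h₀
    exact h₀
  sbar_y_pow_sbar h i hi := by
    have h₀ := RingQuot.mkAlgHom_rel ℂ (AffineBrauerRel.sbar_y_pow_sbar (N := N) h i hi)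
    simp only [map_mul, map_pow] at h₀
    exact h₀
  w_odd i hi := by
    have h₀ := RingQuot.mkAlgHom_rel ℂ (AffineBrauerRel.w_odd (n := n) (N := N) i hi)
    simp only [map_mul, map_pow, map_add, map_sum, map_neg, map_one, map_smul] at h₀
    exact h₀

/-- A model in which `w 0` is the scalar `N` is an image of the affine Brauer algebra. -/
theorem exists_algHom {B : Type*} [Ring B] [Algebra ℂ B] {genB : AffineBrauerGen n → B}
    (hm : IsAffineBrauerModel genB) (h0 : genB (.w 0) = algebraMap ℂ B N) :
    ∃ F : AffineBrauer n N →ₐ[ℂ] B, ∀ g, F (gen n N g) = genB g := by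
  have key : ∀ ⦃x z⦄, AffineBrauerRel n N x z →
      FreeAlgebra.lift ℂ genB x = FreeAlgebra.lift ℂ genB z := by
    intro x z h
    induction h with
    | b_one => simpa [of] using hm.b_one
    | b_mul γ γ' => simpa [of, h0, Algebra.smul_def] using hm.b_mul γ γ'
    | w_zero => simpa [of] using h0
    | y_comm k l => simpa [of] using hm.y_comm k l
    | w_central i g => simpa [of] using hm.w_central i g
    | s_y k hk l h h' => simpa [of, s] using hm.s_y k hk l h h'
    | sbar_y k hk l h h' => simpa [of, sbar] using hm.sbar_y k hk l h h'
    | s_y_self k hk => simpa [of, s, sbar] using hm.s_y_self k hk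
    | s_y_succ k hk => simpa [of, s, sbar] using hm.s_y_succ k hk
    | sbar_mul_y_add k hk => simpa [of, sbar] using hm.sbar_mul_y_add k hk
    | y_add_mul_sbar k hk => simpa [of, sbar] using hm.y_add_mul_sbar k hk
    | sbar_y_pow_sbar h i hi => simpa [of, sbar] using hm.sbar_y_pow_sbar h i hi
    | w_odd i hi => simpa [of] using hm.w_odd i hi
  refine ⟨RingQuot.liftAlgHom ℂ ⟨FreeAlgebra.lift ℂ genB, key⟩, fun g => ?_⟩
  rw [gen, RingQuot.liftAlgHom_mkAlgHom_apply, of, FreeAlgebra.lift_ι_apply]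

end AffineBrauer

/-! ### Generic models and the specialization of `w 0` -/

namespace IsAffineBrauerModel

open AffineBrauerGen BrauerDiagram MvPolynomial

variable {n : ℕ}

/-- A model in which combinations of diagrams with homogeneous polynomial coefficients have lower
order only if this is forced by the relations along the edges. -/
def IsGeneric {A : Type*} [Ring A] [Algebra ℂ A] {gen : AffineBrauerGen n → A}
    (hm : IsAffineBrauerModel gen) : Prop :=
  ∀ (e : ℕ) (p : BrauerDiagram n → VertexPoly n), (∀ γ, IsWeightedHomogeneous vwt (p γ) e) →
    ∑ γ, hm.act (p γ) (gen (.b γ)) ∈ filt gen e → ∀ γ, reduce γ (p γ) = 0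

theorem IsGeneric.of_map {A B : Type*} [Ring A] [Algebra ℂ A] [Ring B] [Algebra ℂ B]
    {gen : AffineBrauerGen n → A} (hm : IsAffineBrauerModel gen) (f : A →ₐ[ℂ] B)
    {hm' : IsAffineBrauerModel fun g => f (gen g)} (h : hm'.IsGeneric) : hm.IsGeneric := by
  intro e p hp hs
  refine h e p hp ?_
  have h1 := Submodule.mem_map_of_mem (f := f.toLinearMap) hs
  rw [map_filt] at h1
  convert h1 using 1
  rw [AlgHom.toLinearMap_apply, map_sum]
  exact Finset.sum_congr rfl fun γ _ => (hm.map_act f hm' _ _).symm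

/-- A finite index set for tensors. -/
structure TensorIndex where
  carrier : Type
  [fintype : Fintype carrier]
  [decidableEq : DecidableEq carrier]
  [nonempty : Nonempty carrier]

attribute [instance] TensorIndex.fintype TensorIndex.decidableEq TensorIndex.nonempty

/-- The generators of the affine Brauer algebra acting on all tensor models. -/
noncomputable def allGen (g : AffineBrauerGen n) (I : TensorIndex) :
    Module.End ℂ ((Fin n → I.carrier) → MvPolynomial (I.carrier × I.carrier) ℂ) :=
  TensorModel.tensorGen (TensorModel.soMatrix I.carrier) g

theorem isAffineBrauerModel_allGen : IsAffineBrauerModel (allGen (n := n)) := by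
  have h := fun I : TensorIndex => TensorModel.isAffineBrauerModel (n := n)
    (TensorModel.isOrthogonal_soMatrix (I := I.carrier))
  exact
  { b_one := funext fun I => (h I).b_one
    b_mul := fun γ γ' => funext fun I => (h I).b_mul γ γ'
    y_comm := fun k l => funext fun I => (h I).y_comm k l
    w_central := fun i g => funext fun I => (h I).w_central i g
    s_y := fun k hk l h1 h2 => funext fun I => (h I).s_y k hk l h1 h2
    sbar_y := fun k hk l h1 h2 => funext fun I => (h I).sbar_y k hk l h1 h2
    s_y_self := fun k hk => funext fun I => (h I).s_y_self k hk
    s_y_succ := fun k hk => funext fun I => (h I).s_y_succ k hk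
    sbar_mul_y_add := fun k hk => funext fun I => (h I).sbar_mul_y_add k hk
    y_add_mul_sbar := fun k hk => funext fun I => (h I).y_add_mul_sbar k hk
    sbar_y_pow_sbar := fun h1 i hi => funext fun I => (h I).sbar_y_pow_sbar h1 i hi
    w_odd := fun i hi => funext fun I => by
      rw [Pi.add_apply, Finset.sum_apply]
      exact (h I).w_odd i hi }

/-- In a single tensor model `w 0` is a fixed scalar, so `w 0` minus that scalar acts as zero.
Genericity holds only in the product over all index sets. -/
theorem isGeneric_allGen (hn : 0 < n) : (isAffineBrauerModel_allGen (n := n)).IsGeneric := by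
  intro e p hp hs
  refine TensorModel.reduce_eq_zero hn hp fun I _ _ _ => ?_
  let f := Pi.evalAlgHom ℂ (fun I : TensorIndex =>
    Module.End ℂ ((Fin n → I.carrier) → MvPolynomial (I.carrier × I.carrier) ℂ)) ⟨I⟩
  have h1 := Submodule.mem_map_of_mem (f := f.toLinearMap) hs
  have h2 : f.toLinearMap
      (∑ γ, (isAffineBrauerModel_allGen (n := n)).act (p γ) (allGen (.b γ))) =
      ∑ γ, (TensorModel.isAffineBrauerModel (n := n)
        (TensorModel.isOrthogonal_soMatrix (I := I))).act (p γ) (TensorModel.brauerOp γ) := by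
    rw [AlgHom.toLinearMap_apply, map_sum]
    exact Finset.sum_congr rfl fun γ _ => isAffineBrauerModel_allGen.map_act f
      (TensorModel.isAffineBrauerModel TensorModel.isOrthogonal_soMatrix) _ _
  rw [map_filt, h2] at h1
  exact h1

/-- The substitution of a scalar for the variable of `w 0`. -/
noncomputable def specialize (N : ℂ) : VertexPoly n →ₐ[ℂ] VertexPoly n :=
  aeval fun v => if v = Sum.inr 0 then C N else X v

section

variable {A : Type*} [Ring A] [Algebra ℂ A] {gen : AffineBrauerGen n → A}
  {hm : IsAffineBrauerModel gen}

theorem act_X_sub_C (N : ℂ) (x : A) : hm.act (X (Sum.inr 0) - C N) x =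
    (gen (.w 0) - algebraMap ℂ A N) * x := by
  rw [map_sub, LinearMap.sub_apply, hm.act_X, ← algebraMap_eq, AlgHom.commutes,
    Module.algebraMap_end_apply, sub_mul, ← Algebra.smul_def]
  rfl

theorem isWeightedHomogeneous_X_sub_C (N : ℂ) :
    IsWeightedHomogeneous (vwt (n := n)) (X (Sum.inr 0) - C N) 0 :=
  (weightedHomogeneousSubmodule ℂ vwt 0).sub_mem (isWeightedHomogeneous_X ℂ vwt (Sum.inr 0))
    (isWeightedHomogeneous_C vwt N)

/-- Multiplication by `w 0 - N` multiplies the leading coefficients by a polynomial whose reduction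
is nonzero in an integral domain. It therefore cannot annihilate a leading part. -/
theorem IsGeneric.mem_filt_of_mul_mem (h : hm.IsGeneric) (N : ℂ) {e : ℕ} {x : A}
    (hx : x ∈ filt gen (e + 1)) (h1 : (gen (.w 0) - algebraMap ℂ A N) * x ∈ filt gen e) :
    x ∈ filt gen e := by
  obtain ⟨q, hq, hxq⟩ := hm.exists_sub_sum_mem hx
  have h2 : (gen (.w 0) - algebraMap ℂ A N) * (x - ∑ γ, hm.act (q γ) (gen (.b γ))) ∈
      filt gen e := by
    rw [← act_X_sub_C (hm := hm)]
    exact hm.act_mem (isWeightedHomogeneous_X_sub_C N) hxq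
  have h3 := sub_mem h1 h2
  rw [← mul_sub, sub_sub_cancel, Finset.mul_sum] at h3
  have h4 : ∀ γ ∈ Finset.univ, (gen (.w 0) - algebraMap ℂ A N) * hm.act (q γ) (gen (.b γ)) =
      hm.act ((X (Sum.inr 0) - C N) * q γ) (gen (.b γ)) := fun γ _ => by
    rw [hm.act_mul_apply, act_X_sub_C]
  rw [Finset.sum_congr rfl h4] at h3
  have h5 := h e _ (fun γ => by
    simpa using (isWeightedHomogeneous_X_sub_C N).mul (hq γ)) h3
  have h6 : ∀ γ, reduce γ (q γ) = 0 := by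
    intro γ
    have h7 := h5 γ
    rw [map_mul] at h7
    refine (mul_eq_zero.1 h7).resolve_left fun h8 => ?_
    have h9 := congrArg (eval fun _ => N + 1) h8
    simp [reduce] at h9
  rw [← sub_add_cancel x (∑ γ, hm.act (q γ) (gen (.b γ)))]
  refine add_mem hxq (Submodule.sum_mem _ fun γ _ => ?_)
  have := hm.act_sub_reduce (hq γ) γ
  rwa [h6, map_zero, LinearMap.zero_apply, sub_zero] at this

theorem IsGeneric.mem_filt_of_mul_mem_of_le (h : hm.IsGeneric) (N : ℂ) {e : ℕ} {x : A} {d : ℕ}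
    (hx : x ∈ filt gen (e + d)) (h1 : (gen (.w 0) - algebraMap ℂ A N) * x ∈ filt gen e) :
    x ∈ filt gen e := by
  induction d with
  | zero => exact hx
  | succ d ih => exact ih (h.mem_filt_of_mul_mem N hx (filt_mono (by omega) h1))

/-- The affine Brauer algebra maps to the quotient of `A` by the central element `w 0 - N`. A
relation there lifts to `A` up to a multiple of this element, and the multiple can be absorbed into
the coefficients, where `specialize N` kills it. -/
theorem specialize_reduce_eq_zero (h : hm.IsGeneric) (N : ℂ)
    (hgen : Algebra.adjoin ℂ (Set.range gen) = ⊤) {e : ℕ} {p : BrauerDiagram n → VertexPoly n}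
    (hp : ∀ γ, IsWeightedHomogeneous vwt (p γ) e)
    (hs : ∑ γ, AffineBrauer.isAffineBrauerModel_gen.act (p γ) (AffineBrauer.gen n N (.b γ)) ∈
      filt (AffineBrauer.gen n N) e) (γ : BrauerDiagram n) : specialize N (reduce γ (p γ)) = 0 := by
  set c := gen (.w 0) - algebraMap ℂ A N with hc
  have hcent : ∀ x, c * x = x * c := by
    intro x
    have hx : x ∈ Algebra.adjoin ℂ (Set.range gen) := by rw [hgen]; trivial
    induction hx using Algebra.adjoin_induction with
    | mem x hx =>
      obtain ⟨g, rfl⟩ := hx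
      rw [hc, sub_mul, mul_sub, hm.w_central, Algebra.commutes]
    | algebraMap r => exact (Algebra.commutes r c).symm
    | add x z _ _ hx hz => rw [mul_add, add_mul, hx, hz]
    | mul x z _ _ hx hz => rw [← mul_assoc, hx, mul_assoc, hz, mul_assoc]
  let K : Ideal A :=
    { carrier := {z | ∃ x, z = c * x}
      add_mem' := by rintro _ _ ⟨x, rfl⟩ ⟨z, rfl⟩; exact ⟨x + z, (mul_add _ _ _).symm⟩
      zero_mem' := ⟨0, (mul_zero _).symm⟩
      smul_mem' := by
        rintro a _ ⟨x, rfl⟩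
        exact ⟨a * x, by rw [smul_eq_mul, ← mul_assoc, ← hcent, mul_assoc]⟩ }
  have hK : K.IsTwoSided := ⟨by rintro _ b ⟨x, rfl⟩; exact ⟨x * b, mul_assoc _ _ _⟩⟩
  let π : A →ₐ[ℂ] A ⧸ K := Ideal.Quotient.mkₐ ℂ K
  have h0 : π (gen (.w 0)) = algebraMap ℂ _ N := by
    rw [← π.commutes, ← sub_eq_zero, ← map_sub]
    exact Ideal.Quotient.eq_zero_iff_mem.2 ⟨1, (mul_one _).symm⟩
  obtain ⟨F, hF⟩ := AffineBrauer.exists_algHom (hm.map π) h0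
  have hF' : (fun g => F (AffineBrauer.gen n N g)) = fun g => π (gen g) := funext hF
  have h1 := Submodule.mem_map_of_mem (f := F.toLinearMap) hs
  rw [map_filt, hF', ← map_filt π] at h1
  obtain ⟨u, hu, hu'⟩ := h1
  have h2 : π u = π (∑ γ, hm.act (p γ) (gen (.b γ))) := by
    refine hu'.trans ?_
    rw [AlgHom.toLinearMap_apply, map_sum, map_sum]
    refine Finset.sum_congr rfl fun γ _ => ?_
    have hmF : IsAffineBrauerModel fun g => F (AffineBrauer.gen n N g) := by
      rw [hF']; exact hm.map π
    rw [AffineBrauer.isAffineBrauerModel_gen.map_act F hmF, hm.map_act π (hm.map π), hF]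
    congr 1
    congr 1
    simp only [hF']
  rw [eq_comm, ← sub_eq_zero, ← map_sub] at h2
  obtain ⟨x, hx⟩ := Ideal.Quotient.eq_zero_iff_mem.1 h2
  have hx' : x ∈ Algebra.adjoin ℂ (Set.range gen) := by rw [hgen]; trivial
  obtain ⟨d, hd⟩ := exists_mem_filt hx'
  have hxe : x ∈ filt gen (e + 1) := by
    -- Division by `w 0 - N` does not raise the degree: this is where genericity makes the quotient
    -- strict for the filtrations.
    refine h.mem_filt_of_mul_mem_of_le N (d := d) (filt_mono (by omega) hd) ?_
    rw [← hc, ← hx]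
    refine sub_mem (Submodule.sum_mem _ fun γ _ => ?_) (filt_mono (by omega) hu)
    rw [add_comm]
    exact hm.act_mem (hp γ) (b_mem_filt γ)
  obtain ⟨q, hq, hxq⟩ := hm.exists_sub_sum_mem hxe
  have h3 : c * (x - ∑ γ, hm.act (q γ) (gen (.b γ))) ∈ filt gen e := by
    rw [hc, ← act_X_sub_C (hm := hm)]
    exact hm.act_mem (isWeightedHomogeneous_X_sub_C N) hxq
  -- The leading part of the multiple is moved into the coefficients, so that genericity of `A`
  -- applies.
  have h4 : ∑ γ, hm.act (p γ - (X (Sum.inr 0) - C N) * q γ) (gen (.b γ)) ∈ filt gen e := by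
    convert add_mem hu h3 using 1
    have h5 : ∀ γ, hm.act (p γ - (X (Sum.inr 0) - C N) * q γ) (gen (.b γ)) =
        hm.act (p γ) (gen (.b γ)) - c * hm.act (q γ) (gen (.b γ)) := fun γ => by
      rw [map_sub, LinearMap.sub_apply, hm.act_mul_apply, act_X_sub_C]
    rw [mul_sub, ← hx, Finset.mul_sum, Finset.sum_congr rfl fun γ _ => h5 γ,
      Finset.sum_sub_distrib]
    abel
  have h5 := h e _ (fun γ => (weightedHomogeneousSubmodule ℂ vwt e).sub_mem (hp γ) (by
    simpa using (isWeightedHomogeneous_X_sub_C N).mul (hq γ))) h4 γ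
  rw [map_sub, sub_eq_zero] at h5
  rw [h5, map_mul, map_mul]
  have h6 : specialize N (reduce γ (X (Sum.inr 0) - C N)) = 0 := by
    simp [reduce, specialize]
  rw [h6, zero_mul]

end

end IsAffineBrauerModel

namespace AffineBrauer

open AffineBrauerGen BrauerDiagram MvPolynomial IsAffineBrauerModel

variable {n : ℕ} {N : ℂ}

/-- In the affine Brauer algebra, combinations of diagrams with homogeneous polynomial coefficients
have lower order only if this is forced by the relations along the edges. -/
theorem specialize_reduce (hn : 0 < n) {e : ℕ} {p : BrauerDiagram n → VertexPoly n}
    (hp : ∀ γ, IsWeightedHomogeneous vwt (p γ) e)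
    (hs : ∑ γ, isAffineBrauerModel_gen.act (p γ) (gen n N (.b γ)) ∈ filt (gen n N) e)
    (γ : BrauerDiagram n) : specialize N (reduce γ (p γ)) = 0 := by
  let S := Algebra.adjoin ℂ (Set.range (allGen (n := n)))
  let genS : AffineBrauerGen n → S := fun g => ⟨allGen g, Algebra.subset_adjoin ⟨g, rfl⟩⟩
  have hm : IsAffineBrauerModel genS := IsAffineBrauerModel.of_map (f := S.val)
    Subtype.val_injective isAffineBrauerModel_allGen
  have hg : hm.IsGeneric := IsGeneric.of_map hm S.val (isGeneric_allGen hn)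
  refine specialize_reduce_eq_zero hg N ?_ hp hs γ
  have h1 : Set.range genS = Subtype.val ⁻¹' Set.range (allGen (n := n)) := by
    ext x
    constructor
    · rintro ⟨g, rfl⟩; exact ⟨g, rfl⟩
    · rintro ⟨g, hg⟩; exact ⟨g, Subtype.ext hg⟩
  rw [h1]
  exact Algebra.adjoin_adjoin_coe_preimage

end AffineBrauer

/-! ### The series `(1 + a X) / (1 - a X)` and partial fractions -/

/-- The series `(1 + a X) / (1 - a X)`. -/
noncomputable def PowerSeries.cayley {R : Type*} [CommRing R] (a : R) : PowerSeries R :=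
  PowerSeries.mk fun k => if k = 0 then 1 else 2 * a ^ k

namespace PowerSeries

theorem one_sub_mul_cayley {R : Type*} [CommRing R] (a : R) :
    (1 - C a * X) * cayley a = 1 + C a * X := by
  ext k
  rw [sub_mul, one_mul, mul_assoc, map_sub, coeff_C_mul, map_add, coeff_C_mul]
  rcases k with _ | k
  · simp [cayley]
  · rw [coeff_succ_X_mul, cayley, coeff_mk, coeff_mk, coeff_X, coeff_one]
    rcases k with _ | k
    · simp; ring
    · simp; ring

/-- The logarithmic derivative of `(1 + a X) / (1 - a X)`. -/
noncomputable def logCayley {R : Type*} [CommRing R] (a : R) : PowerSeries R :=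
  PowerSeries.mk fun k => if Even k then 2 * a ^ (k + 1) else 0

theorem mul_logCayley {R : Type*} [CommRing R] (a : R) :
    (1 - C a * X) * (1 + C a * X) * logCayley a = C (2 * a) := by
  have h : (1 - C a * X) * (1 + C a * X) * logCayley a =
      logCayley a - C (a ^ 2) * (X * (X * logCayley a)) := by rw [map_pow]; ring
  rw [h]
  ext k
  rw [map_sub, coeff_C_mul, coeff_C]
  rcases k with _ | _ | k
  · simp [logCayley]
  · rw [coeff_succ_X_mul, coeff_zero_X_mul]
    simp [logCayley]
  · rw [coeff_succ_X_mul, coeff_succ_X_mul, logCayley, coeff_mk, coeff_mk]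
    have : Even (k + 1 + 1) ↔ Even k := by rw [Nat.even_add_one, Nat.even_add_one, not_not]
    simp only [this]
    split_ifs <;> first | omega | ring1 | simp_all

theorem one_sub_ne_zero {R : Type*} [CommRing R] [Nontrivial R] (a : R) :
    (1 - C a * X : PowerSeries R) ≠ 0 := fun h => by
  have := congrArg (coeff 0) h
  simp at this

theorem derivative_cayley {R : Type*} [CommRing R] [IsDomain R] (a : R) :
    derivative R (cayley a) = cayley a * logCayley a := by
  have h1 := one_sub_mul_cayley a
  have h2 := congrArg (derivative R) h1
  simp only [Derivation.leibniz, map_sub, map_add, derivative_one, derivative_C, derivative_X,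
    smul_eq_mul, mul_zero, add_zero, mul_one, zero_sub, zero_add] at h2
  have h3 := mul_logCayley a
  have h4 : (1 - C a * X) * ((1 - C a * X) * (derivative R (cayley a) - cayley a * logCayley a))
      = 0 := by
    have h5 : (C (2 * a) : PowerSeries R) = 2 * C a := by rw [map_mul, map_ofNat]
    linear_combination (1 - C a * X) * h2 + (C a - (1 - C a * X) * logCayley a) * h1 - h3 - h5
  have h6 := (mul_eq_zero.1 h4).resolve_left (one_sub_ne_zero a)
  exact sub_eq_zero.1 ((mul_eq_zero.1 h6).resolve_left (one_sub_ne_zero a))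

theorem derivative_prod_cayley {R ι : Type*} [CommRing R] [IsDomain R] (s : Finset ι) (a : ι → R) :
    derivative R (∏ i ∈ s, cayley (a i)) =
      (∏ i ∈ s, cayley (a i)) * ∑ i ∈ s, logCayley (a i) := by
  classical
  induction s using Finset.induction_on with
  | empty => simp
  | insert i s hi ih =>
    rw [Finset.prod_insert hi, Finset.sum_insert hi, Derivation.leibniz, ih, derivative_cayley,
      smul_eq_mul, smul_eq_mul]
    ring

end PowerSeries

namespace Polynomial

/-- The difference of `∏ (z + x j)` and `∏ (z - x j)` has degree below `n`, so it equals its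
Lagrange interpolation at the points `x i`. The statement is this identity at `z = 1 / u`, with
denominators cleared. -/
theorem prod_one_add_eq {n : ℕ} {x : Fin n → ℂ} (hx : Function.Injective x) :
    ∏ j, (1 + C (x j) * X : Polynomial ℂ) = ∏ j, (1 - C (x j) * X) +
      ∑ i, C (2 * x i * ∏ j ∈ Finset.univ.erase i, (x i + x j) / (x i - x j)) * X *
        ∏ j ∈ Finset.univ.erase i, (1 - C (x j) * X) := by
  have h1 : ∀ z : ℂ, ∏ j, (z + x j) = ∏ j, (z - x j) +
      ∑ i, (2 * x i * ∏ j ∈ Finset.univ.erase i, (x i + x j) / (x i - x j)) *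
        ∏ j ∈ Finset.univ.erase i, (z - x j) := by
    have hm : ∀ y : Fin n → ℂ, (∏ j, (X + C (y j))).Monic := fun y =>
      monic_prod_of_monic _ _ fun j _ => monic_X_add_C _
    have hd : ∀ y : Fin n → ℂ, (∏ j, (X + C (y j))).degree = (n : WithBot ℕ) := fun y => by
      rw [degree_prod]; simp [degree_X_add_C]
    have hdeg : (∏ j, (X + C (x j)) - ∏ j, (X + C (-x j))).degree <
        ((Finset.univ : Finset (Fin n)).card : WithBot ℕ) := by
      rw [Finset.card_univ, Fintype.card_fin, ← hd x]
      exact degree_sub_lt_left (by rw [hd, hd]) (hm x).ne_zero (by rw [hm x, hm fun j => -x j])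
    have h2 := Lagrange.eq_interpolate (v := x) (Function.Injective.injOn hx) hdeg
    intro z
    have h3 := congrArg (eval z) h2
    rw [Lagrange.interpolate_apply] at h3
    simp only [eval_sub, eval_prod, eval_add, eval_X, eval_C, eval_finsetSum, eval_mul,
      Lagrange.basis, Lagrange.basisDivisor, ← sub_eq_add_neg] at h3
    rw [← sub_eq_iff_eq_add', h3]
    refine Finset.sum_congr rfl fun i _ => ?_
    rw [Finset.prod_eq_zero (f := fun j => x i - x j) (Finset.mem_univ i) (sub_self _), sub_zero,
      ← Finset.mul_prod_erase _ _ (Finset.mem_univ i), Finset.prod_mul_distrib, ← two_mul]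
    simp only [div_eq_mul_inv, Finset.prod_mul_distrib]
    ring
  refine eq_of_infinite_eval_eq _ _ (Set.Infinite.mono (s := {u : ℂ | u ≠ 0}) ?_
    (Set.Finite.infinite_compl (Set.finite_singleton (0 : ℂ))))
  intro u hu
  have hu' : u ≠ 0 := hu
  have e1 : ∀ (s : Finset (Fin n)) (y : Fin n → ℂ),
      ∏ j ∈ s, (1 + y j * u) = u ^ s.card * ∏ j ∈ s, (u⁻¹ + y j) := fun s y => by
    rw [← Finset.prod_const, ← Finset.prod_mul_distrib]
    refine Finset.prod_congr rfl fun j _ => ?_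
    rw [mul_add, mul_inv_cancel₀ hu', mul_comm u]
  have e2 : ∀ s : Finset (Fin n),
      ∏ j ∈ s, (1 - x j * u) = u ^ s.card * ∏ j ∈ s, (u⁻¹ - x j) := fun s => by
    simpa only [neg_mul, ← sub_eq_add_neg] using e1 s fun j => -x j
  have h2 := congrArg (fun w => u ^ n * w) (h1 u⁻¹)
  simp only [Set.mem_ofPred_eq, eval_prod, eval_add, eval_sub, eval_one, eval_mul, eval_C, eval_X,
    eval_finsetSum, e1, e2, Finset.card_univ, Fintype.card_fin] at h2 ⊢
  rw [h2, mul_add, Finset.mul_sum]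
  congr 1
  refine Finset.sum_congr rfl fun i _ => ?_
  have hn : u ^ n = u * u ^ (Finset.univ.erase i).card := by
    rw [Finset.card_erase_of_mem (Finset.mem_univ i), Finset.card_univ, Fintype.card_fin,
      ← pow_succ', Nat.sub_add_cancel (Nat.one_le_of_lt i.2)]
  rw [hn]
  ring

end Polynomial

namespace MvPolynomial

/-- The subalgebra generated by the power sums with odd exponents. -/
noncomputable def oddPowerSums (n : ℕ) : Subalgebra ℂ (MvPolynomial (Fin n) ℂ) :=
  Algebra.adjoin ℂ {p | ∃ k, Odd k ∧ p = ∑ i, X i ^ k}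

theorem psum_mem_oddPowerSums {n k : ℕ} (hk : Odd k) :
    (∑ i, X i ^ k : MvPolynomial (Fin n) ℂ) ∈ oddPowerSums n :=
  Algebra.subset_adjoin ⟨k, hk, rfl⟩

/-- The coefficients of the product of the series `(1 + x i t) / (1 - x i t)`. -/
noncomputable def cayleyCoeff (n k : ℕ) : MvPolynomial (Fin n) ℂ :=
  PowerSeries.coeff k (∏ i, PowerSeries.cayley (X i))

/-- The logarithmic derivative of the product contains only odd power sums. Comparing coefficients
gives a recursion of Newton type. -/
theorem cayleyCoeff_mem (n k : ℕ) : cayleyCoeff n k ∈ oddPowerSums n := by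
  induction k using Nat.strong_induction_on with
  | _ k ih =>
    rcases k with _ | k
    · have : cayleyCoeff n 0 = 1 := by
        rw [cayleyCoeff, PowerSeries.coeff_zero_eq_constantCoeff_apply, map_prod]
        exact Finset.prod_eq_one fun i _ => by simp [PowerSeries.cayley]
      rw [this]; exact one_mem _
    · have h1 := congrArg (PowerSeries.coeff k)
        (PowerSeries.derivative_prod_cayley Finset.univ (X : Fin n → MvPolynomial (Fin n) ℂ))
      rw [PowerSeries.coeff_derivative, PowerSeries.coeff_mul] at h1
      have h2 : cayleyCoeff n (k + 1) * (k + 1) ∈ oddPowerSums n := by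
        rw [cayleyCoeff, h1]
        refine sum_mem fun q hq => mul_mem (ih q.1 ?_) ?_
        · have := Finset.HasAntidiagonal.mem_antidiagonal.1 hq; omega
        · rw [map_sum]
          simp only [PowerSeries.logCayley, PowerSeries.coeff_mk]
          split_ifs with he
          · rw [← Finset.mul_sum]
            exact mul_mem (ofNat_mem _ 2) (psum_mem_oddPowerSums he.add_one)
          · simp
      have h3 : cayleyCoeff n (k + 1) = ((k + 1 : ℂ)⁻¹) • (cayleyCoeff n (k + 1) * (k + 1)) := by
        have h4 : (k + 1 : ℂ) ≠ 0 := Nat.cast_add_one_ne_zero k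
        have h5 : (k + 1 : MvPolynomial (Fin n) ℂ) = C (k + 1 : ℂ) := by simp
        rw [h5, mul_comm, ← smul_eq_C_mul, smul_smul, inv_mul_cancel₀ h4, one_smul]
      rw [h3]
      exact Subalgebra.smul_mem _ h2 _

/-- Dividing the partial fraction identity by `∏ (1 - x j t)` turns the product into a sum of
geometric series. -/
theorem eval_cayleyCoeff {n : ℕ} {x : Fin n → ℂ} (hx : Function.Injective x) (k : ℕ) :
    eval x (cayleyCoeff n (k + 1)) = ∑ i, x i ^ (k + 1) *
      (2 * ∏ j ∈ Finset.univ.erase i, (x i + x j) / (x i - x j)) := by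
  set c : Fin n → ℂ := fun i => ∏ j ∈ Finset.univ.erase i, (x i + x j) / (x i - x j) with hc
  let G : ℂ → PowerSeries ℂ := fun a => PowerSeries.mk fun k => a ^ k
  have hG : ∀ a, (1 - PowerSeries.C a * PowerSeries.X) * G a = 1 := by
    intro a
    ext k
    rw [sub_mul, one_mul, mul_assoc, map_sub, PowerSeries.coeff_C_mul]
    rcases k with _ | k
    · simp [G]
    · rw [PowerSeries.coeff_succ_X_mul]
      simp [G, PowerSeries.coeff_one, pow_succ']
  have h1 := congrArg (Polynomial.coeToPowerSeries.ringHom (R := ℂ)) (Polynomial.prod_one_add_eq hx)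
  simp only [map_prod, map_add, map_sub, map_mul, map_sum, map_one,
    Polynomial.coeToPowerSeries.ringHom_apply, Polynomial.coe_C, Polynomial.coe_X] at h1
  have h2 : (PowerSeries.map (eval x)) (∏ i, PowerSeries.cayley (X i)) =
      ∏ i, PowerSeries.cayley (x i) := by
    rw [map_prod]
    refine Finset.prod_congr rfl fun i _ => ?_
    ext k
    rw [PowerSeries.coeff_map]
    simp only [PowerSeries.cayley, PowerSeries.coeff_mk]
    split_ifs <;> simp
  have h3 : ∏ i, PowerSeries.cayley (x i) =
      1 + ∑ i, PowerSeries.C (2 * x i * c i) * (PowerSeries.X * G (x i)) := by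
    have h4 : ∏ j, (1 - PowerSeries.C (x j) * PowerSeries.X) ≠ 0 :=
      Finset.prod_ne_zero_iff.2 fun j _ => PowerSeries.one_sub_ne_zero _
    refine mul_left_cancel₀ h4 ?_
    rw [← Finset.prod_mul_distrib, Finset.prod_congr rfl fun j _ =>
      PowerSeries.one_sub_mul_cayley (x j)]
    refine h1.trans ?_
    rw [mul_add, mul_one, Finset.mul_sum]
    congr 1
    refine Finset.sum_congr rfl fun i _ => ?_
    rw [← Finset.mul_prod_erase Finset.univ (fun j => 1 - PowerSeries.C (x j) * PowerSeries.X)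
      (Finset.mem_univ i)]
    have h5 := hG (x i)
    simp only [hc, map_mul, map_prod]
    linear_combination (-(PowerSeries.C 2 * PowerSeries.C (x i) * (∏ j ∈ Finset.univ.erase i,
      PowerSeries.C ((x i + x j) / (x i - x j))) * PowerSeries.X * ∏ j ∈ Finset.univ.erase i,
      (1 - PowerSeries.C (x j) * PowerSeries.X))) * h5
  rw [cayleyCoeff, ← PowerSeries.coeff_map, h2, h3, map_add, map_sum, PowerSeries.coeff_one,
    if_neg (Nat.succ_ne_zero k), zero_add]
  refine Finset.sum_congr rfl fun i _ => ?_
  rw [PowerSeries.coeff_C_mul, PowerSeries.coeff_succ_X_mul, PowerSeries.coeff_mk]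
  ring

end MvPolynomial

/-! ### Supersymmetric polynomials are polynomials in odd power sums -/

namespace MvPolynomial

/-- Symmetric polynomials that do not change if two opposite values are replaced by zero. -/
def IsSupersymmetric {n : ℕ} (f : MvPolynomial (Fin n) ℂ) : Prop :=
  (∀ (s : Equiv.Perm (Fin n)) (x : Fin n → ℂ), eval (x ∘ s) f = eval x f) ∧
    ∀ k l, k ≠ l → ∀ x : Fin n → ℂ, x k + x l = 0 →
      eval x f = eval (Function.update (Function.update x k 0) l 0) f

theorem isSupersymmetric_of_mem {n : ℕ} {f : MvPolynomial (Fin n) ℂ} (hf : f ∈ oddPowerSums n) :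
    f.IsSupersymmetric := by
  induction hf using Algebra.adjoin_induction with
  | mem f hf =>
    obtain ⟨m, hm, rfl⟩ := hf
    simp only [IsSupersymmetric, map_sum, map_pow, eval_X]
    refine ⟨fun s x => Equiv.sum_comp s fun i => x i ^ m, fun k l hkl x hx => ?_⟩
    rw [← sub_eq_zero, ← Finset.sum_sub_distrib, Finset.sum_eq_add k l hkl]
    · rw [eq_neg_of_add_eq_zero_left hx, hm.neg_pow]
      simp [Function.update_of_ne hkl, hm.pos.ne']
    · intro i _ hi
      rw [Function.update_of_ne hi.2, Function.update_of_ne hi.1, sub_self]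
    · simp
    · simp
  | algebraMap r => exact ⟨fun s x => by simp [algebraMap_eq], fun k l _ x _ => by simp [algebraMap_eq]⟩
  | add f g _ _ hf hg =>
    exact ⟨fun s x => by rw [map_add, map_add, hf.1, hg.1],
      fun k l h x hx => by rw [map_add, map_add, hf.2 k l h x hx, hg.2 k l h x hx]⟩
  | mul f g _ _ hf hg =>
    exact ⟨fun s x => by rw [map_mul, map_mul, hf.1, hg.1],
      fun k l h x hx => by rw [map_mul, map_mul, hf.2 k l h x hx, hg.2 k l h x hx]⟩

theorem exists_eval_cons_zero {n : ℕ} {g : MvPolynomial (Fin n) ℂ} (hg : g ∈ oddPowerSums n) :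
    ∃ G ∈ oddPowerSums (n + 1), ∀ x, eval (Fin.cons 0 x) G = eval x g := by
  induction hg using Algebra.adjoin_induction with
  | mem g hg =>
    obtain ⟨m, hm, rfl⟩ := hg
    exact ⟨_, psum_mem_oddPowerSums hm, fun x => by simp [Fin.sum_univ_succ, hm.pos.ne']⟩
  | algebraMap r => exact ⟨_, Subalgebra.algebraMap_mem _ r, fun x => by simp [algebraMap_eq]⟩
  | add f g _ _ hf hg =>
    obtain ⟨F, hF, hF'⟩ := hf
    obtain ⟨G, hG, hG'⟩ := hg
    exact ⟨F + G, add_mem hF hG, fun x => by rw [map_add, map_add, hF', hG']⟩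
  | mul f g _ _ hf hg =>
    obtain ⟨F, hF, hF'⟩ := hf
    obtain ⟨G, hG, hG'⟩ := hg
    exact ⟨F * G, mul_mem hF hG, fun x => by rw [map_mul, map_mul, hF', hG']⟩

/-- Evaluation of polynomials with coefficients in the subalgebra of odd power sums. -/
noncomputable def evalOdd {n : ℕ} (x : Fin n → ℂ) : oddPowerSums n →+* ℂ :=
  (eval x).comp (oddPowerSums n).val.toRingHom

theorem evalOdd_apply {n : ℕ} (x : Fin n → ℂ) (p : oddPowerSums n) : evalOdd x p = eval x p.1 := rfl

/-- A power sum without the `i`-th variable is the full power sum minus a power of `x i`. -/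
theorem exists_eval_removeNth {n : ℕ} {g : MvPolynomial (Fin n) ℂ} (hg : g ∈ oddPowerSums n) :
    ∃ T : Polynomial (oddPowerSums (n + 1)), ∀ (x : Fin (n + 1) → ℂ) (i : Fin (n + 1)),
      eval (i.removeNth x) g = T.eval₂ (evalOdd x) (x i) := by
  induction hg using Algebra.adjoin_induction with
  | mem g hg =>
    obtain ⟨m, hm, rfl⟩ := hg
    refine ⟨Polynomial.C ⟨_, psum_mem_oddPowerSums hm⟩ - Polynomial.X ^ m, fun x i => ?_⟩
    rw [Polynomial.eval₂_sub, Polynomial.eval₂_C, Polynomial.eval₂_X_pow, evalOdd_apply]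
    simp only [map_sum, map_pow, eval_X]
    rw [i.sum_univ_succAbove, add_sub_cancel_left]
    rfl
  | algebraMap r =>
    exact ⟨Polynomial.C (algebraMap ℂ _ r), fun x i => by
      rw [Polynomial.eval₂_C, evalOdd_apply]; simp [algebraMap_eq]⟩
  | add f g _ _ hf hg =>
    obtain ⟨F, hF⟩ := hf
    obtain ⟨G, hG⟩ := hg
    exact ⟨F + G, fun x i => by rw [map_add, hF, hG, Polynomial.eval₂_add]⟩
  | mul f g _ _ hf hg =>
    obtain ⟨F, hF⟩ := hf
    obtain ⟨G, hG⟩ := hg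
    exact ⟨F * G, fun x i => by rw [map_mul, hF, hG, Polynomial.eval₂_mul]⟩

/-- The symmetrization with kernel `∏ (x i + x j) / (x i - x j)` is linear over the odd power sums
and sends powers to multiples of `cayleyCoeff`. -/
theorem exists_eval_eq_sum {n : ℕ} (T : Polynomial (oddPowerSums n)) :
    ∃ h ∈ oddPowerSums n, ∀ x : Fin n → ℂ, Function.Injective x → eval x h =
      ∑ i, (∏ j ∈ Finset.univ.erase i, (x i + x j) / (x i - x j)) *
        (x i * T.eval₂ (evalOdd x) (x i)) := by
  refine ⟨∑ a ∈ T.support, (T.coeff a).1 * ((2⁻¹ : ℂ) • cayleyCoeff n (a + 1)),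
    sum_mem fun a _ => mul_mem (T.coeff a).2 (Subalgebra.smul_mem _ (cayleyCoeff_mem n _) _),
    fun x hx => ?_⟩
  simp only [map_sum, map_mul, smul_eval, eval_cayleyCoeff hx, Polynomial.eval₂_eq_sum,
    Polynomial.sum, Finset.mul_sum]
  rw [Finset.sum_comm]
  refine Finset.sum_congr rfl fun i _ => Finset.sum_congr rfl fun a _ => ?_
  rw [evalOdd_apply]
  ring

/-- Multiplication by the differences of the variables makes the identity trivial wherever two
values coincide. -/
theorem eq_of_eval_eq {n : ℕ} {f g : MvPolynomial (Fin n) ℂ}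
    (h : ∀ x, Function.Injective x → eval x f = eval x g) : f = g := by
  have h1 : (f - g) * ∏ i : Fin n, ∏ j ∈ Finset.univ.erase i, (X i - X j) = 0 := by
    refine MvPolynomial.funext fun x => ?_
    rw [map_zero, map_mul, map_sub]
    by_cases hx : Function.Injective x
    · rw [h x hx, sub_self, zero_mul]
    · obtain ⟨i, j, hij, hne⟩ : ∃ i j, x i = x j ∧ i ≠ j := by
        simpa [Function.Injective] using hx
      rw [map_prod, Finset.prod_eq_zero (Finset.mem_univ i), mul_zero]
      rw [map_prod, Finset.prod_eq_zero (i := j) (by simpa using hne.symm)]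
      simp [hij]
  rw [← sub_eq_zero]
  refine (mul_eq_zero.1 h1).resolve_right (Finset.prod_ne_zero_iff.2 fun i _ =>
    Finset.prod_ne_zero_iff.2 fun j hj h2 => ?_)
  exact (Finset.ne_of_mem_erase hj) (X_injective (R := ℂ) (sub_eq_zero.1 h2)).symm

/-- This is the leading coefficient of `X ^ n`, computed by interpolation at `n + 1` points. -/
theorem eq_sum_div {n : ℕ} {x : Fin (n + 1) → ℂ} (hx : Function.Injective x) :
    ∑ i, x i ^ n / ∏ j ∈ Finset.univ.erase i, (x i - x j) = 1 := by
  have h := Lagrange.leadingCoeff_eq_sum (s := Finset.univ) (v := x) hx.injOn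
    (P := Polynomial.X ^ n) (by simp)
  simpa using h.symm

theorem X_mul_prod_dvd {n : ℕ} {P : Polynomial (MvPolynomial (Fin n) ℂ)} (h0 : P.eval 0 = 0)
    (h1 : ∀ j, P.eval (-X j) = 0) : Polynomial.X * ∏ j, (Polynomial.X + Polynomial.C (X j)) ∣ P := by
  by_cases hP0 : P = 0
  · rw [hP0]; exact dvd_zero _
  have h2 := (Multiset.prod_X_sub_C_dvd_iff_le_roots hP0
    ((0 : MvPolynomial (Fin n) ℂ) ::ₘ (Finset.univ.val.map fun j => -X j))).2 (by
      rw [Multiset.le_iff_subset]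
      · intro a ha
        rw [Polynomial.mem_roots hP0, Polynomial.IsRoot]
        rw [Multiset.mem_cons, Multiset.mem_map] at ha
        rcases ha with rfl | ⟨j, -, rfl⟩
        · exact h0
        · exact h1 j
      · rw [Multiset.nodup_cons]
        refine ⟨fun h => ?_, Finset.univ.nodup.map fun i j hij => ?_⟩
        · obtain ⟨j, -, hj⟩ := Multiset.mem_map.1 h
          exact X_ne_zero (R := ℂ) j (neg_eq_zero.1 hj)
        · exact X_injective (R := ℂ) (neg_injective hij))
  rw [Multiset.map_cons, Multiset.prod_cons, Multiset.map_map, map_zero, sub_zero] at h2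
  convert h2 using 2
  refine Finset.prod_congr rfl fun j _ => ?_
  rw [Function.comp_apply, map_neg, sub_neg_eq_add]

set_option maxHeartbeats 1000000 in
/-- A supersymmetric polynomial is a polynomial in the power sums with odd exponents. -/
theorem mem_oddPowerSums : ∀ {n : ℕ} {f : MvPolynomial (Fin n) ℂ}, f.IsSupersymmetric →
    f ∈ oddPowerSums n := by
  intro n
  induction n with
  | zero =>
    intro f _
    rw [eq_C_of_isEmpty f]
    exact Subalgebra.algebraMap_mem _ _
  | succ n ih =>
    intro f hf
    have hf0 : (aeval (Fin.cons 0 X : Fin (n + 1) → MvPolynomial (Fin n) ℂ) f) ∈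
        oddPowerSums n := by
      have he : ∀ x, eval x (aeval (Fin.cons 0 X : Fin (n + 1) → MvPolynomial (Fin n) ℂ) f) =
          eval (Fin.cons 0 x) f := fun x => by
        have : (aeval x).comp (aeval (Fin.cons 0 X : Fin (n + 1) → MvPolynomial (Fin n) ℂ)) =
            aeval (Fin.cons 0 x : Fin (n + 1) → ℂ) := by
          refine algHom_ext fun i => ?_
          refine Fin.cases ?_ (fun j => ?_) i <;> simp
        exact DFunLike.congr_fun this f
      refine ih ⟨fun s x => ?_, fun k l hkl x hx => ?_⟩
      · rw [he, he, ← hf.1 (Equiv.Perm.decomposeFin.symm (0, s)) (Fin.cons 0 x)]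
        congr 2
        funext i
        refine Fin.cases ?_ (fun j => ?_) i <;> simp
      · rw [he, he, hf.2 k.succ l.succ (fun h => hkl (Fin.succ_injective _ h)) (Fin.cons 0 x)
          (by simpa using hx), Fin.cons_update, Fin.cons_update]
    -- The restriction to `x 0 = 0` is known by induction. Subtracting a lift leaves `f1`, which
    -- vanishes when a variable is zero, hence also when two variables are opposite.
    obtain ⟨G, hG, hG'⟩ := exists_eval_cons_zero hf0
    have hGs := isSupersymmetric_of_mem hG
    obtain ⟨f1, hf1⟩ : ∃ g, g = f - G := ⟨_, rfl⟩
    suffices h : f1 ∈ oddPowerSums (n + 1) by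
      rw [← sub_add_cancel f G, ← hf1]; exact add_mem h hG
    have hsym : ∀ (s : Equiv.Perm (Fin (n + 1))) x, eval (x ∘ s) f1 = eval x f1 := fun s x => by
      rw [hf1, map_sub, map_sub, hf.1, hGs.1]
    have hcons : ∀ (x : Fin (n + 1) → ℂ) i, eval (Fin.cons (x i) (i.removeNth x)) f1 = eval x f1 :=
      fun x i => by rw [Fin.cons_removeNth_eq_comp_cycleRange_symm, hsym]
    have hz : ∀ (x : Fin (n + 1) → ℂ) i, x i = 0 → eval x f1 = 0 := fun x i hi => by
      rw [← hcons x i, hi, hf1, map_sub, hG', sub_eq_zero]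
      have : (aeval (i.removeNth x)).comp
          (aeval (Fin.cons 0 X : Fin (n + 1) → MvPolynomial (Fin n) ℂ)) =
            aeval (Fin.cons 0 (i.removeNth x) : Fin (n + 1) → ℂ) := by
        refine algHom_ext fun i => ?_
        refine Fin.cases ?_ (fun j => ?_) i <;> simp
      exact (DFunLike.congr_fun this f).symm
    have hv : ∀ (x : Fin (n + 1) → ℂ) k l, k ≠ l → x k + x l = 0 → eval x f1 = 0 :=
      fun x k l hkl hx => by
        have h1 : eval x f1 = eval (Function.update (Function.update x k 0) l 0) f1 := by
          rw [hf1, map_sub, map_sub, hf.2 k l hkl x hx, hGs.2 k l hkl x hx]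
        rw [h1]
        exact hz _ l (Function.update_self _ _ _)
    obtain ⟨P, hP⟩ : ∃ P, P = finSuccEquiv ℂ n f1 := ⟨_, rfl⟩
    have hPe : ∀ a (x : Fin n → ℂ), eval (Fin.cons a x) f1 = (P.map (eval x)).eval a :=
      fun a x => by
        rw [hP]; exact eval_eq_eval_mv_eval' x a f1
    have hPz : ∀ a x, eval x (P.eval a) = eval (Fin.cons (eval x a) x) f1 := fun a x => by
      rw [hPe, ← Polynomial.eval₂_at_apply, ← Polynomial.eval_map]
    have hdvd := X_mul_prod_dvd (P := P)
      (MvPolynomial.funext fun x => by rw [hPz, map_zero]; exact hz _ 0 (by simp))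
      (fun j => MvPolynomial.funext fun x => by
        rw [hPz, map_zero, hv _ 0 j.succ (Fin.succ_ne_zero j).symm (by simp)])
    -- As a polynomial in the first variable, `f1` has the roots `0` and `- x j`.
    obtain ⟨F, hF⟩ := hdvd
    have hFx : ∀ x : Fin n → ℂ, P.map (eval x) =
        (Polynomial.X * ∏ j, (Polynomial.X + Polynomial.C (x j))) * F.map (eval x) := fun x => by
      rw [hF, Polynomial.map_mul, Polynomial.map_mul, Polynomial.map_X, Polynomial.map_prod]
      simp
    have hD : ∀ x : Fin n → ℂ, Polynomial.X * ∏ j, (Polynomial.X + Polynomial.C (x j)) ≠ 0 :=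
      fun x => mul_ne_zero Polynomial.X_ne_zero
        (Finset.prod_ne_zero_iff.2 fun j _ => Polynomial.X_add_C_ne_zero _)
    have hFv : ∀ (x : Fin n → ℂ) k l, k ≠ l → x k + x l = 0 → F.map (eval x) = 0 :=
      fun x k l hkl hx => by
        have h1 : P.map (eval x) = 0 := Polynomial.funext fun a => by
          rw [← hPe, Polynomial.eval_zero]
          exact hv _ k.succ l.succ (fun h => hkl (Fin.succ_injective _ h)) (by simpa using hx)
        rw [hFx] at h1
        exact (mul_eq_zero.1 h1).resolve_left (hD x)
    have hFs : ∀ (s : Equiv.Perm (Fin n)) (x : Fin n → ℂ),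
        F.map (eval (x ∘ s)) = F.map (eval x) := fun s x => by
      have h1 : P.map (eval (x ∘ s)) = P.map (eval x) := Polynomial.funext fun a => by
        rw [← hPe, ← hPe, ← hsym (Equiv.Perm.decomposeFin.symm (0, s)) (Fin.cons a x)]
        congr 2
        funext i
        refine Fin.cases ?_ (fun j => ?_) i <;> simp
      rw [hFx, hFx, Finset.prod_congr rfl fun j _ => by rw [Function.comp_apply],
        Equiv.prod_comp s fun j => Polynomial.X + Polynomial.C (x j)] at h1
      exact mul_left_cancel₀ (hD x) h1
    -- The quotient inherits symmetry in the other variables and vanishes when two of them are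
    -- opposite, so the induction hypothesis applies to its coefficients.
    have hg : ∀ m, F.coeff m ∈ oddPowerSums n := fun m => by
      refine ih ⟨fun s x => ?_, fun k l hkl x hx => ?_⟩
      · rw [← Polynomial.coeff_map, ← Polynomial.coeff_map, hFs]
      · rw [← Polynomial.coeff_map, ← Polynomial.coeff_map, hFv x k l hkl hx,
          hFv _ k l hkl (by simp [Function.update_of_ne hkl])]
    choose T hT using fun m => exists_eval_removeNth (hg m)
    obtain ⟨h, hh, hh'⟩ := exists_eval_eq_sum
      (∑ m ∈ Finset.range (F.natDegree + 1), Polynomial.X ^ (m + n) * T m)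
    suffices h1 : f1 = h by rw [h1]; exact hh
    refine eq_of_eval_eq fun x hx => ?_
    -- Writing `1` as a sum over `i` and factoring `f1` with `x i` as distinguished variable
    -- produces exactly the kernel of `exists_eval_eq_sum`; the exponent `n` in `m + n` comes from
    -- this partition of `1`.
    rw [hh' x hx, ← mul_one (eval x f1), ← eq_sum_div hx, Finset.mul_sum]
    refine Finset.sum_congr rfl fun i _ => ?_
    have h2 : (F.map (eval (i.removeNth x))).eval (x i) =
        ∑ m ∈ Finset.range (F.natDegree + 1), (T m).eval₂ (evalOdd x) (x i) * x i ^ m := by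
      rw [Polynomial.eval_eq_sum_range' (Nat.lt_succ_of_le Polynomial.natDegree_map_le)]
      refine Finset.sum_congr rfl fun m _ => ?_
      rw [Polynomial.coeff_map, hT]
    have h3 : ∏ j, (x i + i.removeNth x j) = ∏ j ∈ Finset.univ.erase i, (x i + x j) := by
      have h4 : Finset.univ.erase i = Finset.univ.image i.succAbove := by
        rw [Fin.image_succAbove_univ]; ext; simp
      rw [h4, Finset.prod_image fun a _ b _ hab => Fin.succAbove_right_injective hab]
      rfl
    rw [← hcons x i, hPe, hFx, Polynomial.eval_mul, Polynomial.eval_mul, Polynomial.eval_X,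
      Polynomial.eval_prod, h2]
    simp only [Polynomial.eval_add, Polynomial.eval_X, Polynomial.eval_C, h3,
      Polynomial.eval₂_finsetSum, Polynomial.eval₂_mul, Polynomial.eval₂_X_pow,
      Finset.prod_div_distrib]
    simp only [Finset.mul_sum, Finset.sum_mul]
    refine Finset.sum_congr rfl fun m _ => ?_
    rw [pow_add]
    ring

end MvPolynomial

/-! ### The odd power sums are central -/

theorem mul_pow_eq_add_sum {A : Type*} [Ring A] {s a b c : A} (h : s * a = b * s + c) (m : ℕ) :
    s * a ^ m = b ^ m * s + ∑ i ∈ Finset.range m, b ^ i * c * a ^ (m - 1 - i) := by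
  induction m with
  | zero => simp
  | succ m ih =>
    rw [pow_succ, ← mul_assoc, ih, add_mul, mul_assoc (b ^ m), h, Finset.sum_range_succ,
      Finset.sum_mul]
    have h1 : ∀ i ∈ Finset.range m, b ^ i * c * a ^ (m - 1 - i) * a =
        b ^ i * c * a ^ (m + 1 - 1 - i) := fun i hi => by
      rw [mul_assoc _ _ a, ← pow_succ]
      congr 2
      have := Finset.mem_range.1 hi
      omega
    rw [Finset.sum_congr rfl h1, show m + 1 - 1 - m = 0 by omega, pow_zero, mul_one, mul_add,
      ← mul_assoc (b ^ m), ← pow_succ]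
    abel

theorem mul_pow_eq_neg_one_pow {A : Type*} [Ring A] {e a b : A} (hab : a * b = b * a)
    (h : e * (a + b) = 0) (m : ℕ) : e * b ^ m = (-1) ^ m * (e * a ^ m) := by
  induction m with
  | zero => simp
  | succ m ih =>
    have hb : e * b = -(e * a) := by rw [eq_neg_iff_add_eq_zero, add_comm, ← mul_add, h]
    have hc : a ^ m * b = b * a ^ m := ((show Commute a b from hab).pow_left m).eq
    rw [pow_succ b, ← mul_assoc, ih, mul_assoc, mul_assoc, hc, ← mul_assoc e, hb, pow_succ (-1 : A),
      pow_succ' a]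
    noncomm_ring

theorem pow_mul_eq_neg_one_pow {A : Type*} [Ring A] {e a b : A} (hab : a * b = b * a)
    (h : (a + b) * e = 0) (m : ℕ) : b ^ m * e = (-1) ^ m * (a ^ m * e) := by
  induction m with
  | zero => simp
  | succ m ih =>
    have hb : b * e = -(a * e) := by rw [eq_neg_iff_add_eq_zero, add_comm, ← add_mul, h]
    have hc : b * (-1) ^ m = (-1) ^ m * b := ((Commute.neg_one_right b).pow_right m).eq
    have hc' : b * a ^ m = a ^ m * b := ((show Commute b a from hab.symm).pow_right m).eq
    rw [pow_succ' b, mul_assoc, ih, ← mul_assoc, hc, mul_assoc, ← mul_assoc b, hc', mul_assoc, hb,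
      pow_succ (-1 : A), pow_succ a]
    noncomm_ring

/-- The corrections containing `e` agree in pairs, as the signs from replacing `a` by `-b` on both
sides of `e` multiply to `(-1) ^ (m - 1) = 1`. The remaining sum is antisymmetric under reversal of
the index. -/
theorem mul_add_pow_comm_of_odd {A : Type*} [Ring A] {s e a b : A} (hab : a * b = b * a)
    (h1 : s * a - b * s = e - 1) (h2 : s * b - a * s = 1 - e) (h3 : e * (a + b) = 0)
    (h4 : (a + b) * e = 0) {m : ℕ} (hm : Odd m) : s * (a ^ m + b ^ m) = (a ^ m + b ^ m) * s := by
  have e1 := mul_pow_eq_add_sum (s := s) (a := a) (b := b) (c := e - 1)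
    (by rw [← h1, add_sub_cancel]) m
  have e2 := mul_pow_eq_add_sum (s := s) (a := b) (b := a) (c := 1 - e)
    (by rw [← h2, add_sub_cancel]) m
  have hc : ∀ i j, a ^ i * b ^ j = b ^ j * a ^ i := fun i j =>
    ((show Commute a b from hab).pow_pow i j).eq
  have e3 : ∀ i ∈ Finset.range m, b ^ i * (e - 1) * a ^ (m - 1 - i) +
      a ^ i * (1 - e) * b ^ (m - 1 - i) = a ^ i * b ^ (m - 1 - i) - a ^ (m - 1 - i) * b ^ i := by
    intro i hi
    have hi' := Finset.mem_range.1 hi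
    have e4 : a ^ i * e * b ^ (m - 1 - i) = b ^ i * e * a ^ (m - 1 - i) := by
      rw [pow_mul_eq_neg_one_pow hab h4 i, mul_assoc, mul_pow_eq_neg_one_pow hab h3]
      have e5 : (-1 : A) ^ (m - 1 - i) = (-1) ^ i := by
        obtain ⟨r, rfl⟩ := hm
        rw [show (-1 : A) ^ i = (-1) ^ i * 1 by simp, neg_one_pow_eq_pow_mod_two, mul_one,
          neg_one_pow_eq_pow_mod_two (n := i)]
        congr 1
        omega
      rw [e5, ← mul_assoc (a ^ i), ((Commute.neg_one_right (a ^ i)).pow_right i).eq]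
      simp only [mul_assoc]
    rw [mul_sub, sub_mul, mul_sub, sub_mul, mul_one, mul_one, e4, hc (m - 1 - i) i]
    abel
  have e6 := Finset.sum_range_reflect (fun i => a ^ (m - 1 - i) * b ^ i) m
  have e7 : ∀ i ∈ Finset.range m, a ^ (m - 1 - (m - 1 - i)) * b ^ (m - 1 - i) =
      a ^ i * b ^ (m - 1 - i) := fun i hi => by
    have hi' := Finset.mem_range.1 hi
    rw [show m - 1 - (m - 1 - i) = i by omega]
  rw [Finset.sum_congr rfl e7] at e6
  have e8 := Finset.sum_congr rfl e3
  rw [Finset.sum_add_distrib, Finset.sum_sub_distrib, e6, sub_self] at e8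
  rw [mul_add, e1, e2, add_mul, add_add_add_comm, e8, add_zero, add_comm]

theorem MvPolynomial.IsWeightedHomogeneous.aeval {σ τ R : Type*} [CommSemiring R] {w : σ → ℕ}
    {w' : τ → ℕ} {f : σ → MvPolynomial τ R} (hf : ∀ v, IsWeightedHomogeneous w' (f v) (w v)) {e : ℕ}
    {p : MvPolynomial σ R} (hp : IsWeightedHomogeneous w p e) :
    IsWeightedHomogeneous w' (MvPolynomial.aeval f p) e := by
  refine hp.map_mem (MvPolynomial.aeval f).toLinearMap (weightedHomogeneousSubmodule R w' e)
    fun m hm => ?_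
  rw [mem_weightedHomogeneousSubmodule, AlgHom.toLinearMap_apply, aeval_monomial, map_one, one_mul,
    ← hm, Finsupp.weight_apply, Finsupp.prod, Finsupp.sum]
  exact IsWeightedHomogeneous.prod _ _ _ fun v _ => (hf v).pow _

namespace IsAffineBrauerModel

open AffineBrauerGen BrauerDiagram

variable {n : ℕ} {A : Type*} [Ring A] [Algebra ℂ A] {gen : AffineBrauerGen n → A}
  (hm : IsAffineBrauerModel gen)

include hm

/-- An element that commutes with the generators of the Brauer algebra commutes with all
diagrams. -/
theorem commute_b {z : A} (hs : ∀ (k : ℕ) (hk : k + 1 < n),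
      Commute z (gen (.b (.ofPerm (Equiv.swap ⟨k, by omega⟩ ⟨k + 1, hk⟩)))))
    (hb : ∀ (k : ℕ) (hk : k + 1 < n),
      Commute z (gen (.b (.bar ⟨k, by omega⟩ ⟨k + 1, hk⟩ (by simp))))) (γ : BrauerDiagram n) :
    Commute z (gen (.b γ)) := by
  have hperm : ∀ s, Commute z (gen (.b (.ofPerm s))) := fun s => by
    induction s using Equiv.Perm.induction_adjacent with
    | one => rw [hm.b_one]; exact Commute.one_right z
    | swap k hk => exact hs k hk
    | mul s t h1 h2 => rw [hm.b_ofPerm_mul]; exact h1.mul_right h2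
  induction γ using BrauerDiagram.induction_bar with
  | perm s => exact hperm s
  | step γ p q r t hpq hp hr ih =>
    rw [← hm.b_mul_of_loops (comp_bar_relabel hpq hp hr)]
    refine Commute.mul_right ?_ ih
    have hn : 0 + 1 < n := by
      have := p.2; have := q.2; have : (p : ℕ) ≠ q := fun h => hpq (Fin.ext h); omega
    have h01 : (⟨0, by omega⟩ : Fin n) ≠ ⟨0 + 1, hn⟩ := by simp
    obtain ⟨s, rfl, rfl⟩ := Equiv.Perm.exists_apply_eq_and h01 hpq
    rw [hm.b_conj_bar s h01]
    exact ((hperm s).mul_right (hb 0 hn)).mul_right (hperm s⁻¹)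

theorem commute_sum_pow_swap {m : ℕ} (hodd : Odd m) (k : ℕ) (hk : k + 1 < n) :
    Commute (∑ l, gen (.y l) ^ m)
      (gen (.b (.ofPerm (Equiv.swap ⟨k, by omega⟩ ⟨k + 1, hk⟩)))) := by
  refine Commute.symm ?_
  rw [commute_iff_eq, ← sub_eq_zero, Finset.mul_sum, Finset.sum_mul, ← Finset.sum_sub_distrib,
    Finset.sum_eq_add (⟨k, by omega⟩ : Fin n) ⟨k + 1, hk⟩ (by simp)]
  · rw [sub_add_sub_comm, ← mul_add, ← add_mul, sub_eq_zero]
    exact mul_add_pow_comm_of_odd (hm.y_comm _ _) (hm.s_y_self k hk) (hm.s_y_succ k hk)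
      (hm.sbar_mul_y_add k hk) (hm.y_add_mul_sbar k hk) hodd
  · intro l _ hl
    have h := hm.s_y k hk l (fun h => hl.1 (Fin.ext h)) (fun h => hl.2 (Fin.ext h))
    rw [sub_eq_zero]
    exact (Commute.pow_right h m).eq
  · simp
  · simp

theorem commute_sum_pow_bar {m : ℕ} (hodd : Odd m) (k : ℕ) (hk : k + 1 < n) :
    Commute (∑ l, gen (.y l) ^ m) (gen (.b (.bar ⟨k, by omega⟩ ⟨k + 1, hk⟩ (by simp)))) := by
  refine Commute.symm ?_
  rw [commute_iff_eq, ← sub_eq_zero, Finset.mul_sum, Finset.sum_mul, ← Finset.sum_sub_distrib,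
    Finset.sum_eq_add (⟨k, by omega⟩ : Fin n) ⟨k + 1, hk⟩ (by simp)]
  · have h1 := mul_pow_eq_neg_one_pow (hm.y_comm _ _) (hm.sbar_mul_y_add k hk) m
    have h2 := pow_mul_eq_neg_one_pow (hm.y_comm _ _) (hm.y_add_mul_sbar k hk) m
    rw [h1, h2, hodd.neg_one_pow]
    noncomm_ring
  · intro l _ hl
    have h := hm.sbar_y k hk l (fun h => hl.1 (Fin.ext h)) (fun h => hl.2 (Fin.ext h))
    rw [sub_eq_zero]
    exact (Commute.pow_right h m).eq
  · simp
  · simp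

/-- The power sums of the `y_k` with odd exponents are central. -/
theorem commute_sum_pow {m : ℕ} (hodd : Odd m) (g : AffineBrauerGen n) :
    Commute (∑ l, gen (.y l) ^ m) (gen g) := by
  rcases g with γ | k | i
  · exact hm.commute_b (hm.commute_sum_pow_swap hodd) (hm.commute_sum_pow_bar hodd) γ
  · exact Commute.sum_left _ _ _ fun l _ => Commute.pow_left (hm.y_comm l k) m
  · exact Commute.sum_left _ _ _ fun l _ => Commute.pow_left (hm.w_central i (.y l)).symm m

end IsAffineBrauerModel

/-! ### The centralizer of the `y k` -/

namespace AffineBrauer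

open AffineBrauerGen BrauerDiagram MvPolynomial IsAffineBrauerModel

variable {n : ℕ} {N : ℂ}

theorem act_specialize (p : VertexPoly n) (x : AffineBrauer n N) :
    isAffineBrauerModel_gen.act (specialize N p) x = isAffineBrauerModel_gen.act p x := by
  have h : (isAffineBrauerModel_gen (n := n) (N := N)).act.comp (specialize N) =
      isAffineBrauerModel_gen.act := by
    refine algHom_ext fun v => ?_
    rw [AlgHom.comp_apply, specialize, aeval_X]
    split_ifs with hv
    · rw [hv, act_X, ← algebraMap_eq, AlgHom.commutes]
      refine LinearMap.ext fun x => ?_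
      rw [Module.algebraMap_end_apply, Algebra.smul_def, ← gen_w_zero]
      rfl
    · rfl
  exact DFunLike.congr_fun (DFunLike.congr_fun h p) x

theorem act_mem_filt_of_specialize_reduce {p : VertexPoly n} {e : ℕ}
    (hp : IsWeightedHomogeneous vwt p e) {γ : BrauerDiagram n}
    (h : specialize N (reduce γ p) = 0) :
    isAffineBrauerModel_gen.act p (gen n N (.b γ)) ∈ filt (gen n N) e := by
  have h1 := (isAffineBrauerModel_gen (n := n) (N := N)).act_sub_reduce hp γ
  rwa [← act_specialize (reduce γ p), h, map_zero, LinearMap.zero_apply, sub_zero] at h1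

/-- The elements `w_2, w_4, …` and `y_1, …, y_n`. -/
noncomputable def polyGen : ℕ ⊕ Fin n → AffineBrauer n N :=
  Sum.elim (fun i => gen n N (.w (2 * (i + 1)))) (fun k => gen n N (.y k))

theorem polyGen_comm (u v : ℕ ⊕ Fin n) :
    (polyGen u * polyGen v : AffineBrauer n N) = polyGen v * polyGen u := by
  have hm := isAffineBrauerModel_gen (n := n) (N := N)
  rcases u with i | k
  · rcases v with j | l <;> exact hm.w_central _ _
  · rcases v with j | l
    · exact (hm.w_central _ _).symm
    · exact hm.y_comm k l

variable (n N) in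
/-- The homomorphism from the polynomial algebra to the subalgebra generated by the `y_k` and the
`w_i`. -/
noncomputable def polyHom : MvPolynomial (ℕ ⊕ Fin n) ℂ →ₐ[ℂ] AffineBrauer n N :=
  (exists_algHom_of_commute polyGen polyGen_comm).choose

theorem polyHom_X (v) : polyHom n N (X v) = polyGen v :=
  (exists_algHom_of_commute polyGen polyGen_comm).choose_spec v

theorem polyHom_comm (p q : MvPolynomial (ℕ ⊕ Fin n) ℂ) :
    polyHom n N p * polyHom n N q = polyHom n N q * polyHom n N p := by
  rw [← map_mul, mul_comm, map_mul]

/-- The degrees of the variables. -/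
def polyWt : ℕ ⊕ Fin n → ℕ := Sum.elim (fun i => 2 * (i + 1)) (fun _ => 1)

/-- The variables placed at the upper vertices. -/
def topVar : ℕ ⊕ Fin n → (Fin n ⊕ Fin n) ⊕ ℕ :=
  Sum.elim (fun i => Sum.inr (i + 1)) (fun k => Sum.inl (Sum.inl k))

/-- The variables placed at the lower vertices. -/
def botVar : ℕ ⊕ Fin n → (Fin n ⊕ Fin n) ⊕ ℕ :=
  Sum.elim (fun i => Sum.inr (i + 1)) (fun k => Sum.inl (Sum.inr k))

theorem act_rename_topVar (q : MvPolynomial (ℕ ⊕ Fin n) ℂ) (x : AffineBrauer n N) :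
    isAffineBrauerModel_gen.act (rename topVar q) x = polyHom n N q * x := by
  have hm := isAffineBrauerModel_gen (n := n) (N := N)
  induction q using MvPolynomial.induction_on generalizing x with
  | C r =>
    rw [rename_C, ← algebraMap_eq, ← algebraMap_eq, AlgHom.commutes, AlgHom.commutes,
      Module.algebraMap_end_apply, Algebra.smul_def]
  | add p q hp hq => rw [map_add, map_add, map_add, LinearMap.add_apply, hp, hq, add_mul]
  | mul_X p v hp =>
    rw [map_mul, hm.act_mul_apply, hp, rename_X, act_X, map_mul, polyHom_X, mul_assoc]
    rcases v with i | k <;> rfl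

theorem act_rename_botVar (q : MvPolynomial (ℕ ⊕ Fin n) ℂ) (γ : BrauerDiagram n) :
    isAffineBrauerModel_gen.act (rename botVar q) (gen n N (.b γ)) =
      gen n N (.b γ) * polyHom n N q := by
  have hm := isAffineBrauerModel_gen (n := n) (N := N)
  induction q using MvPolynomial.induction_on with
  | C r =>
    rw [rename_C, ← algebraMap_eq, ← algebraMap_eq, AlgHom.commutes, AlgHom.commutes,
      Module.algebraMap_end_apply, Algebra.smul_def, Algebra.commutes]
  | add p q hp hq => rw [map_add, map_add, map_add, LinearMap.add_apply, hp, hq, mul_add]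
  | mul_X p v hp =>
    rw [mul_comm, map_mul, hm.act_mul_apply, hp, rename_X, act_X, map_mul (polyHom n N), polyHom_X]
    rcases v with i | k
    · change gen n N (.w (2 * (i + 1))) * (gen n N (.b γ) * polyHom n N p) = _
      rw [← mul_assoc, hm.w_central, mul_assoc]
      rfl
    · change gen n N (.b γ) * polyHom n N p * polyGen (Sum.inr k) = _
      rw [mul_assoc, ← polyHom_X, polyHom_comm]

/-- The identification of the variables at the two ends of the edges `{k, k̄}`. -/
noncomputable def collapseVar (N : ℂ) : (Fin n ⊕ Fin n) ⊕ ℕ → MvPolynomial (ℕ ⊕ Fin n) ℂ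
  | Sum.inl (Sum.inl k) => X (Sum.inr k)
  | Sum.inl (Sum.inr k) => X (Sum.inr k)
  | Sum.inr 0 => C N
  | Sum.inr (i + 1) => X (Sum.inl i)

theorem isWeightedHomogeneous_collapseVar (v) :
    IsWeightedHomogeneous (polyWt (n := n)) (collapseVar N v) (vwt v) := by
  rcases v with (k | k) | _ | i
  · exact isWeightedHomogeneous_X ℂ polyWt (Sum.inr k)
  · exact isWeightedHomogeneous_X ℂ polyWt (Sum.inr k)
  · exact isWeightedHomogeneous_C polyWt N
  · exact isWeightedHomogeneous_X ℂ polyWt (Sum.inl i)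

theorem act_one (p : VertexPoly n) :
    isAffineBrauerModel_gen.act p (1 : AffineBrauer n N) =
      polyHom n N (aeval (collapseVar N) p) := by
  have hm := isAffineBrauerModel_gen (n := n) (N := N)
  induction p using MvPolynomial.induction_on with
  | C r =>
    rw [← algebraMap_eq, AlgHom.commutes, AlgHom.commutes, AlgHom.commutes,
      Module.algebraMap_end_apply, Algebra.smul_def, mul_one]
  | add p q hp hq => rw [map_add, map_add, map_add, LinearMap.add_apply, hp, hq]
  | mul_X p v hp =>
    rw [mul_comm, hm.act_mul_apply, hp, act_X, map_mul, map_mul, aeval_X]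
    rcases v with (k | k) | _ | i
    · rw [collapseVar, polyHom_X]; rfl
    · rw [polyHom_comm, collapseVar, polyHom_X]; rfl
    · rw [collapseVar, ← algebraMap_eq, AlgHom.commutes, ← gen_w_zero]; rfl
    · rw [collapseVar, polyHom_X]; rfl

theorem exists_mate_ne {γ : BrauerDiagram n} (h : γ ≠ ofPerm 1) :
    ∃ k, γ.mate (Sum.inl k) ≠ Sum.inr k := by
  by_contra! h1
  refine h (BrauerDiagram.ext (funext fun v => ?_))
  rcases v with k | k
  · exact h1 k
  · have h2 := γ.mate_mate (Sum.inl k)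
    rw [h1] at h2
    rw [h2]
    rfl

/-- The vertices `k` and `k̄` lie on different edges, whose variables are independent. -/
theorem specialize_reduce_sub_ne_zero {γ : BrauerDiagram n} {k : Fin n}
    (h : γ.mate (Sum.inl k) ≠ Sum.inr k) :
    specialize N (reduce γ (X (Sum.inl (Sum.inl k)) - X (Sum.inl (Sum.inr k)))) ≠ 0 := by
  have h1 : repSign γ (Sum.inl k) ≠ 0 := by
    unfold repSign edgeSign
    split_ifs <;> norm_num
  have h2 : γ.mate (Sum.inr k) ≠ Sum.inl k := fun h3 => h (by rw [← h3, mate_mate])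
  have h3 : edgeRep γ (Sum.inr k) ≠ edgeRep γ (Sum.inl k) := by
    unfold edgeRep
    split_ifs
    · simp
    · exact h.symm
    · exact h2
    · intro h4
      have := congrArg γ.mate h4
      simp [mate_mate] at this
  intro h4
  have h5 := congrArg (eval fun v => if v = Sum.inl (edgeRep γ (Sum.inl k)) then 1 else 0) h4
  simp [reduce, specialize, h3] at h5
  exact h1 h5

/-- The leading part of an element that commutes with the `y_k` is a polynomial. -/
theorem exists_sub_polyHom_mem (hn : 0 < n) {e : ℕ} {a : AffineBrauer n N}
    (ha : a ∈ filt (gen n N) (e + 1)) (hy : ∀ k, Commute a (gen n N (.y k))) :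
    ∃ q : MvPolynomial (ℕ ⊕ Fin n) ℂ, IsWeightedHomogeneous polyWt q e ∧
      a - polyHom n N q ∈ filt (gen n N) e := by
  have hm := isAffineBrauerModel_gen (n := n) (N := N)
  obtain ⟨p, hp, hap⟩ := hm.exists_sub_sum_mem ha
  have h1 : ∀ γ, γ ≠ ofPerm 1 → specialize N (reduce γ (p γ)) = 0 := by
    intro γ hγ
    obtain ⟨k, hk⟩ := exists_mate_ne hγ
    -- Acting by `D` is taking the commutator with `y k`, which annihilates `a`. By uniqueness, `D`
    -- times each coefficient vanishes in edge variables, and there `D` can be cancelled.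
    set D : VertexPoly n := X (Sum.inl (Sum.inl k)) - X (Sum.inl (Sum.inr k)) with hD
    have hDh : IsWeightedHomogeneous vwt D 1 := (weightedHomogeneousSubmodule ℂ vwt 1).sub_mem
      (isWeightedHomogeneous_X ℂ vwt (Sum.inl (Sum.inl k)))
      (isWeightedHomogeneous_X ℂ vwt (Sum.inl (Sum.inr k)))
    have hDa : hm.act D a = 0 := by
      rw [hD, map_sub, LinearMap.sub_apply, act_X, act_X]
      exact sub_eq_zero.2 (hy k).eq.symm
    have h2 := hm.act_mem hDh hap
    rw [map_sub, hDa, zero_sub, neg_mem_iff, map_sum] at h2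
    have h3 := specialize_reduce (N := N) hn (p := fun γ => D * p γ) (e := e + 1)
      (fun γ => by rw [add_comm e]; exact hDh.mul (hp γ))
      (by simpa only [hm.act_mul_apply] using h2) γ
    rw [map_mul, map_mul] at h3
    exact (mul_eq_zero.1 h3).resolve_left (specialize_reduce_sub_ne_zero hk)
  refine ⟨aeval (collapseVar N) (p (ofPerm 1)),
    (hp _).aeval isWeightedHomogeneous_collapseVar, ?_⟩
  classical
  rw [← act_one, ← hm.b_one]
  have h2 := Finset.add_sum_erase Finset.univ (fun γ => hm.act (p γ) (gen n N (.b γ)))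
    (Finset.mem_univ (ofPerm 1))
  have h3 : ∑ γ ∈ Finset.univ.erase (ofPerm 1), hm.act (p γ) (gen n N (.b γ)) ∈
      filt (gen n N) e := Submodule.sum_mem _ fun γ hγ =>
    act_mem_filt_of_specialize_reduce (hp γ) (h1 γ (Finset.ne_of_mem_erase hγ))
  rw [← h2, ← sub_sub] at hap
  have h4 := add_mem hap h3
  rwa [sub_add_cancel] at h4

/-- An element that commutes with the `y_k` is a polynomial in the `y_k` and the `w_i`. -/
theorem mem_range_polyHom (hn : 0 < n) {a : AffineBrauer n N}
    (hy : ∀ k, Commute a (gen n N (.y k))) : a ∈ (polyHom n N).range := by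
  obtain ⟨e, he⟩ := exists_mem_filt (gen := gen n N) (x := a) (by rw [adjoin_range_gen]; trivial)
  induction e generalizing a with
  | zero =>
    -- Level zero contains no words at all, so the descent in degree ends at the zero element.
    rw [filt_zero, Submodule.mem_bot] at he
    rw [he]
    exact zero_mem _
  | succ e ih =>
    obtain ⟨q, -, hq⟩ := exists_sub_polyHom_mem hn he hy
    have h1 := ih (fun k => Commute.sub_left (hy k) (by
      have := polyHom_comm (N := N) q (X (Sum.inr k))
      rwa [polyHom_X] at this)) hq
    have h2 := add_mem h1 (AlgHom.mem_range_self (polyHom n N) q)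
    rwa [sub_add_cancel] at h2

/-- The polynomial ring has variables only for `w 2, w 4, …`. The element `w 0` is a scalar, and the
recursion expresses the odd ones. -/
theorem range_polyHom : (polyHom n N).range = Algebra.adjoin ℂ
    (Set.range (y N : Fin n → AffineBrauer n N) ∪ {x | ∃ i : ℕ, 1 ≤ i ∧ x = w n N i}) := by
  have hm := isAffineBrauerModel_gen (n := n) (N := N)
  apply le_antisymm
  · rintro _ ⟨p, rfl⟩
    induction p using MvPolynomial.induction_on with
    | C r => rw [← algebraMap_eq]; simp
    | add p q hp hq => rw [map_add]; exact add_mem hp hq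
    | mul_X p v hp =>
      rw [map_mul]
      refine mul_mem hp ?_
      change polyHom n N (X v) ∈ _
      rw [polyHom_X]
      rcases v with i | k
      · exact Algebra.subset_adjoin (Or.inr ⟨_, by omega, rfl⟩)
      · exact Algebra.subset_adjoin (Or.inl ⟨k, rfl⟩)
  · rw [Algebra.adjoin_le_iff]
    have hw : ∀ i, gen n N (.w i) ∈ (polyHom n N).range := by
      intro i
      induction i using Nat.strong_induction_on with | _ i ih =>
      rcases Nat.even_or_odd i with hi | hi
      · obtain ⟨j, rfl⟩ := hi.two_dvd
        rcases j with _ | j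
        · rw [Nat.mul_zero, gen_w_zero]
          exact Subalgebra.algebraMap_mem _ _
        · exact ⟨X (Sum.inl j), polyHom_X _⟩
      · have h1 : gen n N (.w i) = (-2 : ℂ)⁻¹ • ((-2 : ℂ) • gen n N (.w i)) := by
          rw [smul_smul, inv_mul_cancel₀ (by norm_num), one_smul]
        rw [h1, hm.w_odd i hi]
        have := hi.pos
        refine Subalgebra.smul_mem _ (add_mem (ih _ (by omega)) (sum_mem fun j hj => ?_)) _
        rw [Finset.mem_Icc] at hj
        exact mul_mem (pow_mem (neg_mem (one_mem _)) _)
          (mul_mem (ih _ (by omega)) (ih _ (by omega)))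
    rintro _ (⟨k, rfl⟩ | ⟨i, -, rfl⟩)
    · exact ⟨X (Sum.inr k), polyHom_X _⟩
    · exact hw i

/-- A larger commutative subalgebra still contains the `y k`, so its elements commute with them. -/
theorem maximal_commutative (hn : 0 < n) :
    Maximal (fun S : Subalgebra ℂ (AffineBrauer n N) => ∀ a ∈ S, ∀ c ∈ S, a * c = c * a)
      (polyHom n N).range := by
  refine ⟨?_, fun S hS hle a ha => mem_range_polyHom hn fun k => ?_⟩
  · rintro _ ⟨p, rfl⟩ _ ⟨q, rfl⟩
    exact polyHom_comm p q
  · exact hS a ha _ (hle ⟨X (Sum.inr k), polyHom_X _⟩)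

end AffineBrauer

/-! ### The centre -/

namespace AffineBrauer

open AffineBrauerGen BrauerDiagram MvPolynomial IsAffineBrauerModel

variable {n : ℕ} {N : ℂ}

/-- Values `d` that satisfy the edge relations are not affected by `reduce`. The index `i - 1`
undoes the shift of the `w` variables, and the variable of `w 0` does not occur in a renamed
polynomial. -/
theorem eval_specialize_reduce_rename {γ : BrauerDiagram n} {d : Fin n ⊕ Fin n → ℂ}
    (hd : ∀ u, d u = edgeSign u (γ.mate u) * d (γ.mate u)) (t : ℕ → ℂ)
    (ρ : Fin n → Fin n ⊕ Fin n) (q : MvPolynomial (ℕ ⊕ Fin n) ℂ) :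
    eval (Sum.elim d fun i => t (i - 1)) (specialize N (reduce γ
      (rename (Sum.elim (fun i => Sum.inr (i + 1)) fun k => Sum.inl (ρ k)) q))) =
      eval (Sum.elim t fun k => d (ρ k)) q := by
  induction q using MvPolynomial.induction_on with
  | C r => rw [rename_C, ← algebraMap_eq, AlgHom.commutes, AlgHom.commutes]; simp [algebraMap_eq]
  | add p q hp hq => simp only [map_add, hp, hq]
  | mul_X p v hp =>
    rw [map_mul (rename _), map_mul (reduce γ), map_mul (specialize N), map_mul (eval _),
      map_mul (eval _), hp, rename_X, eval_X]
    refine congrArg (fun z => eval (Sum.elim t fun k => d (ρ k)) p * z) ?_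
    rcases v with i | k
    · simp [reduce, specialize]
    · have h1 : repSign γ (ρ k) * d (edgeRep γ (ρ k)) = d (ρ k) := by
        unfold repSign edgeRep
        split_ifs
        · rw [one_mul]
        · exact (hd _).symm
      simpa [reduce, specialize] using h1

/-- The leading part of a central element satisfies a relation for every diagram. -/
theorem eval_eq_eval_of_mem_center (hn : 0 < n) {e : ℕ} {z : AffineBrauer n N}
    (hz : z ∈ Subalgebra.center ℂ (AffineBrauer n N)) {q : MvPolynomial (ℕ ⊕ Fin n) ℂ}
    (hq : IsWeightedHomogeneous polyWt q e) (hzq : z - polyHom n N q ∈ filt (gen n N) e)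
    {γ : BrauerDiagram n} {d : Fin n ⊕ Fin n → ℂ}
    (hd : ∀ u, d u = edgeSign u (γ.mate u) * d (γ.mate u)) (t : ℕ → ℂ) :
    eval (Sum.elim t fun k => d (Sum.inl k)) q = eval (Sum.elim t fun k => d (Sum.inr k)) q := by
  classical
  have hm := isAffineBrauerModel_gen (n := n) (N := N)
  have htop : IsWeightedHomogeneous vwt (rename topVar q) e := by
    rw [rename_eq_aeval]
    exact hq.aeval fun v => by
      rcases v with i | k
      · exact isWeightedHomogeneous_X ℂ vwt (Sum.inr (i + 1))
      · exact isWeightedHomogeneous_X ℂ vwt (Sum.inl (Sum.inl k))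
  have hbot : IsWeightedHomogeneous vwt (rename botVar q) e := by
    rw [rename_eq_aeval]
    exact hq.aeval fun v => by
      rcases v with i | k
      · exact isWeightedHomogeneous_X ℂ vwt (Sum.inr (i + 1))
      · exact isWeightedHomogeneous_X ℂ vwt (Sum.inl (Sum.inr k))
  -- The commutator of `z` with `b γ` is zero, so moving its leading polynomial from above `γ` to
  -- below changes only lower degrees.
  have h1 : hm.act (rename topVar q - rename botVar q) (gen n N (.b γ)) ∈ filt (gen n N) e := by
    rw [map_sub, LinearMap.sub_apply, act_rename_topVar, act_rename_botVar]
    have h2 := sub_mem (mul_mem_filt_left (b_mem_filt γ) hzq)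
      (mul_mem_filt_right hzq (b_mem_filt (gen := gen n N) γ))
    convert h2 using 1
    rw [mul_sub, sub_mul, ← Subalgebra.mem_center_iff.1 hz]
    abel
  have h2 := specialize_reduce (N := N) hn (e := e)
    (p := fun γ' => if γ' = γ then rename topVar q - rename botVar q else 0)
    (fun γ' => by
      split_ifs
      · exact (weightedHomogeneousSubmodule ℂ vwt e).sub_mem htop hbot
      · exact isWeightedHomogeneous_zero ℂ vwt e)
    (by rw [Finset.sum_eq_single γ] <;> simp +contextual [-map_sub, h1]) γ
  rw [if_pos rfl, map_sub, map_sub, sub_eq_zero] at h2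
  have h3 := congrArg (eval (Sum.elim d fun i => t (i - 1))) h2
  rwa [topVar, botVar, eval_specialize_reduce_rename hd, eval_specialize_reduce_rename hd] at h3

/-- The diagrams of permutations give symmetry. In `bar k l` the upper values at `k` and `l` must be
opposite, while the lower ones may be chosen zero, which gives the cancellation property. -/
theorem isSupersymmetric_coeff {q : MvPolynomial (ℕ ⊕ Fin n) ℂ}
    (hq : ∀ (γ : BrauerDiagram n) (d : Fin n ⊕ Fin n → ℂ),
      (∀ u, d u = edgeSign u (γ.mate u) * d (γ.mate u)) → ∀ t : ℕ → ℂ,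
      eval (Sum.elim t fun k => d (Sum.inl k)) q = eval (Sum.elim t fun k => d (Sum.inr k)) q)
    (m : ℕ →₀ ℕ) : (coeff m (sumAlgEquiv ℂ ℕ (Fin n) q)).IsSupersymmetric := by
  have he : ∀ (q : MvPolynomial (ℕ ⊕ Fin n) ℂ) (t : ℕ → ℂ) (x : Fin n → ℂ),
      eval t (MvPolynomial.map (eval x) (sumAlgEquiv ℂ ℕ (Fin n) q)) = eval (Sum.elim t x) q := by
    intro q t x
    induction q using MvPolynomial.induction_on with
    | C r => simp
    | add p q hp hq => simp only [map_add, hp, hq]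
    | mul_X p v hp =>
      rw [map_mul, map_mul, map_mul, map_mul, hp]
      rcases v with i | k <;> simp
  have hcoeff : ∀ x x' : Fin n → ℂ, (∀ t : ℕ → ℂ, eval (Sum.elim t x) q = eval (Sum.elim t x') q) →
      eval x (coeff m (sumAlgEquiv ℂ ℕ (Fin n) q)) =
        eval x' (coeff m (sumAlgEquiv ℂ ℕ (Fin n) q)) := by
    intro x x' h
    rw [← coeff_map, ← coeff_map]
    congr 1
    exact MvPolynomial.funext fun t => by rw [he, he, h]
  refine ⟨fun s x => hcoeff _ _ fun t => ?_, fun k l hkl x hx => hcoeff _ _ fun t => ?_⟩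
  · refine (hq (ofPerm s) (Sum.elim x (x ∘ s)) ?_ t).symm
    rintro (k | k) <;> simp [ofPerm, edgeSign]
  · refine hq (bar k l hkl) (Sum.elim x (Function.update (Function.update x k 0) l 0)) ?_ t
    rintro (i | i)
    · by_cases h1 : i = k
      · subst h1
        simpa [bar, edgeSign] using eq_neg_of_add_eq_zero_left hx
      by_cases h2 : i = l
      · subst h2
        simpa [bar, edgeSign, h1] using eq_neg_of_add_eq_zero_right hx
      simp [bar, edgeSign, h1, h2]
    · by_cases h1 : i = k
      · subst h1
        simp [bar, edgeSign, hkl]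
      by_cases h2 : i = l
      · subst h2
        simp [bar, edgeSign, h1, hkl]
      simp [bar, edgeSign, h1, h2]

variable (n N) in
/-- The subalgebra generated by the power sums of the `y_k` with odd exponents and the `w_i` with
`i` even. -/
noncomputable def powerSumSubalgebra : Subalgebra ℂ (AffineBrauer n N) :=
  Algebra.adjoin ℂ ({x | ∃ i : ℕ, Odd i ∧ x = ∑ k : Fin n, y N k ^ i} ∪
    {x | ∃ i : ℕ, 2 ≤ i ∧ Even i ∧ x = w n N i})

theorem powerSumSubalgebra_le_center :
    powerSumSubalgebra n N ≤ Subalgebra.center ℂ (AffineBrauer n N) := by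
  have hm := isAffineBrauerModel_gen (n := n) (N := N)
  have key : ∀ z : AffineBrauer n N, (∀ g, Commute z (gen n N g)) →
      z ∈ Subalgebra.center ℂ (AffineBrauer n N) := by
    intro z hz
    rw [Subalgebra.mem_center_iff]
    intro x
    have hx : x ∈ Algebra.adjoin ℂ (Set.range (gen n N)) := by rw [adjoin_range_gen]; trivial
    change Commute x z
    induction hx using Algebra.adjoin_induction with
    | mem x hx => obtain ⟨g, rfl⟩ := hx; exact (hz g).symm
    | algebraMap r => exact Algebra.commutes r z
    | add x x' _ _ h h' => exact h.add_left h'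
    | mul x x' _ _ h h' => exact h.mul_left h'
  refine Algebra.adjoin_le ?_
  rintro _ (⟨i, hi, rfl⟩ | ⟨i, -, -, rfl⟩)
  · exact key _ (hm.commute_sum_pow hi)
  · exact key _ (hm.w_central i)

theorem polyHom_mem_powerSumSubalgebra {q : MvPolynomial (ℕ ⊕ Fin n) ℂ}
    (hq : ∀ m, coeff m (sumAlgEquiv ℂ ℕ (Fin n) q) ∈ oddPowerSums n) :
    polyHom n N q ∈ powerSumSubalgebra n N := by
  have hC : ∀ f ∈ oddPowerSums n,
      polyHom n N ((sumAlgEquiv ℂ ℕ (Fin n)).symm (C f)) ∈ powerSumSubalgebra n N := by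
    intro f hf
    induction hf using Algebra.adjoin_induction with
    | mem f hf =>
      obtain ⟨m, hm, rfl⟩ := hf
      simp only [map_sum, map_pow, sumAlgEquiv_symm_C_X, polyHom_X]
      exact Algebra.subset_adjoin (Or.inl ⟨m, hm, rfl⟩)
    | algebraMap r =>
      rw [algebraMap_eq, sumAlgEquiv_symm_C_C, ← algebraMap_eq, AlgHom.commutes]
      exact Subalgebra.algebraMap_mem _ _
    | add f g _ _ hf hg => simp only [map_add]; exact add_mem hf hg
    | mul f g _ _ hf hg => simp only [map_mul]; exact mul_mem hf hg
  rw [← (sumAlgEquiv ℂ ℕ (Fin n)).symm_apply_apply q, (sumAlgEquiv ℂ ℕ (Fin n) q).as_sum,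
    map_sum, map_sum]
  refine sum_mem fun m hm => ?_
  clear hm
  rw [← mul_one (coeff m _), ← C_mul_monomial, map_mul, map_mul]
  refine mul_mem (hC _ (hq m)) ?_
  induction m using Finsupp.induction_linear with
  | zero => rw [← C_apply]; exact hC 1 (one_mem _)
  | add f g hf hg =>
    rw [← mul_one (1 : MvPolynomial (Fin n) ℂ), ← monomial_mul, map_mul, map_mul]
    exact mul_mem hf hg
  | single i k =>
    rw [← X_pow_eq_monomial, map_pow, map_pow, sumAlgEquiv_symm_X, polyHom_X]
    have h1 : polyGen (Sum.inl i) ∈ powerSumSubalgebra n N :=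
      Algebra.subset_adjoin (Or.inr ⟨2 * (i + 1), by omega, even_two_mul _, rfl⟩)
    exact pow_mem h1 k

/-- The leading polynomial of a central element defines an element of the subalgebra which is itself
central. Their difference is central of lower degree, and the induction continues. -/
theorem center_eq (hn : 0 < n) :
    Subalgebra.center ℂ (AffineBrauer n N) = powerSumSubalgebra n N := by
  refine le_antisymm (fun z hz => ?_) powerSumSubalgebra_le_center
  obtain ⟨e, he⟩ := exists_mem_filt (gen := gen n N) (x := z) (by rw [adjoin_range_gen]; trivial)
  induction e generalizing z with
  | zero =>
    rw [filt_zero, Submodule.mem_bot] at he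
    rw [he]
    exact zero_mem _
  | succ e ih =>
    obtain ⟨q, hq, hzq⟩ := exists_sub_polyHom_mem hn he
      fun k => (Subalgebra.mem_center_iff.1 hz _).symm
    have h1 : polyHom n N q ∈ powerSumSubalgebra n N := polyHom_mem_powerSumSubalgebra fun m =>
      mem_oddPowerSums (isSupersymmetric_coeff
        (fun γ d hd t => eval_eq_eval_of_mem_center hn hz hq hzq hd t) m)
    have h2 := add_mem (ih _ (sub_mem hz (powerSumSubalgebra_le_center h1)) hzq) h1
    rwa [sub_add_cancel] at h2

end AffineBrauer

theorem corollary4p10 (n : ℕ) (hn : 1 ≤ n) (N : ℂ) :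
    Maximal (fun S : Subalgebra ℂ (AffineBrauer n N) => ∀ a ∈ S, ∀ c ∈ S, a * c = c * a)
      (Algebra.adjoin ℂ
        (Set.range (AffineBrauer.y N : Fin n → AffineBrauer n N) ∪
          {x | ∃ i : ℕ, 1 ≤ i ∧ x = AffineBrauer.w n N i})) ∧
    Subalgebra.center ℂ (AffineBrauer n N) =
      Algebra.adjoin ℂ
        ({x | ∃ i : ℕ, Odd i ∧ x = ∑ k : Fin n, AffineBrauer.y N k ^ i} ∪
          {x | ∃ i : ℕ, 2 ≤ i ∧ Even i ∧ x = AffineBrauer.w n N i}) := by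
  refine ⟨?_, AffineBrauer.center_eq hn⟩
  rw [← AffineBrauer.range_polyHom]
  exact AffineBrauer.maximal_commutative hn
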